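/- **Setting.** Let $m\ge 1$, let $\pi\colon E\to M$ be a smooth fibre bundle over an $m$-dimensional manifold $M$ with volume form $\omega$ (manifolds are Hausdorff, $\sigma$-compact and $C^\infty$; connectedness of $M$ and $E$ is not needed), and let $\pounds\in C^\infty(J^1E)$, with Lagrangian density $\pounds\,\omega$. Let $\mathcal M\pi=\Lambda_1^mT^*E$ be the bundle of $m$-forms on $E$ vanishing on any two $\pi$-vertical vectors, with its canonical forms $\Theta$ and $\Omega=-d\Theta$, let $J^{1*}E=\Lambda_1^mT^*E/\Lambda_0^mT^*E$, $\mu\colon\mathcal M\pi\to J^{1*}E$ the quotient map and $\tau^1\colon J^{1*}E\to E$, $\bar\tau^1=\pi\circ\tau^1$ the projections. Let $\widetilde{\mathcal{FL}}\colon J^1E\to\mathcal M\pi$ be the extended Legendre map, which in natural coordinates with $\omega=d^mx$ is $p^\alpha_A=\partial\pounds/\partial v^A_\alpha$, $p=\pounds-v^A_\alpha\,\partial\pounds/\partial v^A_\alpha$, and $\mathcal{FL}=\mu\circ\widetilde{\mathcal{FL}}$. Assume that the system is almost-regular or hyper-regular: $\mathcal P=\mathcal{FL}(J^1E)$ is a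 closed submanifold $\jmath_0\colon\mathcal P\hookrightarrow J^{1*}E$, and the induced map $\mathcal{FL}_0\colon J^1E\to\mathcal P$ is a submersion with connected fibres. Let $\tilde\jmath_0\circ\tilde h\colon\mathcal P\to\mathcal M\pi$ be the map $\widetilde{\mathcal{FL}}\circ\mathcal{FL}_0^{-1}$ and $\Omega_h^0=(\tilde\jmath_0\circ\tilde h)^*\Omega$. A smooth section $\psi_0\colon M\to\mathcal P$ *solves the Hamiltonian problem* if $\psi_0^*(i(X)\Omega_h^0)=0$ for every vector field $X$ on $\mathcal P$. An *extended operator* is a non-vanishing $m$-vector field $\tilde{\mathcal K}\colon J^1E\to\Lambda^mT\mathcal M\pi$ along $\widetilde{\mathcal{FL}}$ that is locally decomposable (with smooth factors), $(\bar\tau^1\circ\mu)$-transverse, satisfies $\widetilde{\mathcal{FL}}{}^*[i(\tilde{\mathcal K})(\Omega\circ\widetilde{\mathcal{FL}})]=0$, and is semi-holonomic: at every jet $\bar y$, $\Lambda^mT(\tau^1\circ\mu)\tilde{\mathcal K}(\bar y)$ spans the $m$-plane in $TE$ defined by $\bar y$. Its *restricted operator* is $\mathcal K=\Lambda^mT\mu\circ\tilde{\mathcal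 K}$. For a map $\psi$ on $M$ and an $m$-vector field $\mathcal K$ along a map defined on $J^1E$, the relation $$\Lambda^mT\psi=f\,\mathcal K\circ j\circ\sigma_M\qquad(\sigma_M\colon\Lambda^mTM\to M,\ j\colon M\to J^1E)$$ means that $\Lambda^mT\psi(u)=f(j(x))\,\mathcal K(j(x))$ for every $x\in M$ and every $u\in\Lambda^mT_xM$ with $\omega(u)=1$; in it $f\in C^\infty(J^1E)$ has no zeros. **Theorem.** Let $\psi_0\colon M\to\mathcal P$ be a smooth section, $\psi=\jmath_0\circ\psi_0$ and $\tilde\psi=\tilde\jmath_0\circ\tilde h\circ\psi_0$. 1. $\psi_0$ solves the Hamiltonian problem if and only if there are an extended operator $\tilde{\mathcal K}$, with restricted operator $\mathcal K$, and a non-vanishing $f\in C^\infty(J^1E)$ such that $$\Lambda^mT\psi=f\,\mathcal K\circ j^1(\tau^1\circ\psi)\circ\sigma_M.\qquad(*)$$ 2. For every extended operator $\tilde{\mathcal K}$ and every non-vanishing $f\in C^\infty(J^1E)$, $(*)$ is equivalent to $$\Lambda^mT\tilde\psi=f\,\tilde{\mathcal K}\circ j^1(\tau^1\circ\mu\circ\tilde\psi)\circ\sigma_M.$$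 3. Let $\tilde{\mathcal K}$ be any extended operator, $S\subseteq J^1E$ any subset, and $X_{\mathcal H_o}$ any $m$-vector field on $\mathcal P$ with $\Lambda^mT\jmath_0\circ X_{\mathcal H_o}\circ\mathcal{FL}_0=\mathcal K$ on $S$. Then $\psi_0$ takes values in $\mathcal{FL}_0(S)$ and is an integral section of the class of $X_{\mathcal H_o}$ (that is, $\Lambda^mT\psi_0=f'\,X_{\mathcal H_o}\circ\psi_0\circ\sigma_M$ for some non-vanishing $f'\in C^\infty(\mathcal P)$, in the same sense as above) if and only if $j^1(\tau^1\circ\psi)$ takes values in $S$ and $(*)$ holds for some non-vanishing $f\in C^\infty(J^1E)$. -/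

import Mathlib

open scoped Manifold ContDiff Topology
open Set
set_option maxSynthPendingDepth 3
noncomputable section
/-- The model space of the `m`-dimensional base. -/
abbrev VM (m : ℕ) := EuclideanSpace ℝ (Fin m)
/-- The model space of the total space, the typical fibre being `N`-dimensional. -/
abbrev VE (m N : ℕ) := VM m × VM N

/-- Smooth fibre bundles `E → M` with typical fibre `F`. -/
structure SmoothBundle (m N : ℕ) (M E F : Type*)
    [TopologicalSpace M] [ChartedSpace (VM m) M]
    [TopologicalSpace E] [ChartedSpace (VE m N) E]
    [TopologicalSpace F] [ChartedSpace (VM N) F] where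
  proj : E → M
  contMDiff_proj : ContMDiff 𝓘(ℝ, VE m N) 𝓘(ℝ, VM m) ∞ proj
  locTriv : ∀ x : M, ∃ e : Bundle.Trivialization F proj, x ∈ e.baseSet ∧
    ContMDiffOn 𝓘(ℝ, VE m N) (𝓘(ℝ, VM m).prod 𝓘(ℝ, VM N)) ∞ e e.source ∧
    ContMDiffOn (𝓘(ℝ, VM m).prod 𝓘(ℝ, VM N)) 𝓘(ℝ, VE m N) ∞
      e.toOpenPartialHomeomorph.symm e.target

variable {m N : ℕ} {M E F : Type*}
    [TopologicalSpace M] [ChartedSpace (VM m) M]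
    [TopologicalSpace E] [ChartedSpace (VE m N) E]
    [TopologicalSpace F] [ChartedSpace (VM N) F]

/-- Fibred coordinates `(x, y)` of the bundle, with the base coordinates `x`. -/
structure AdaptedChart (B : SmoothBundle m N M E F) where
  chart : OpenPartialHomeomorph E (VE m N)
  base : OpenPartialHomeomorph M (VM m)
  smooth : ContMDiffOn 𝓘(ℝ, VE m N) 𝓘(ℝ, VE m N) ∞ chart chart.source
  smooth_symm : ContMDiffOn 𝓘(ℝ, VE m N) 𝓘(ℝ, VE m N) ∞ chart.symm chart.target
  base_smooth : ContMDiffOn 𝓘(ℝ, VM m) 𝓘(ℝ, VM m) ∞ base base.source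
  base_smooth_symm : ContMDiffOn 𝓘(ℝ, VM m) 𝓘(ℝ, VM m) ∞ base.symm base.target
  proj_mem : ∀ y ∈ chart.source, B.proj y ∈ base.source
  fst_eq : ∀ y ∈ chart.source, (chart y).1 = base (B.proj y)

theorem exists_adaptedChart [IsManifold 𝓘(ℝ, VM m) ∞ M] [IsManifold 𝓘(ℝ, VM N) ∞ F]
    (B : SmoothBundle m N M E F) (y : E) : ∃ c : AdaptedChart B, y ∈ c.chart.source := by
  obtain ⟨e, hx, he, he'⟩ := B.locTriv (B.proj y)
  have hy : y ∈ e.source := by rw [e.source_eq]; exact hx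
  let ξ : OpenPartialHomeomorph M (VM m) := chartAt (VM m) (B.proj y)
  let ζ : OpenPartialHomeomorph F (VM N) := chartAt (VM N) (e y).2
  let χ : OpenPartialHomeomorph E (VE m N) := e.toOpenPartialHomeomorph ≫ₕ ξ.prod ζ
  have hproj : ∀ z ∈ e.source, (e z).1 = B.proj z := fun z hz => e.proj_toFun z hz
  have hsrc : ∀ z ∈ χ.source, z ∈ e.source ∧ (e z).1 ∈ ξ.source ∧ (e z).2 ∈ ζ.source := by
    intro z hz
    simpa [χ, OpenPartialHomeomorph.trans_source, mem_prod] using hz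
  have htgt : ∀ z ∈ χ.target, z.1 ∈ ξ.target ∧ z.2 ∈ ζ.target ∧
      (ξ.symm z.1, ζ.symm z.2) ∈ e.target := by
    intro z hz
    have := hz
    simp only [χ, OpenPartialHomeomorph.trans_target, mem_inter_iff, mem_preimage] at this
    refine ⟨this.1.1, this.1.2, this.2⟩
  have hξ : ContMDiffOn 𝓘(ℝ, VM m) 𝓘(ℝ, VM m) ∞ ξ ξ.source := contMDiffOn_chart
  have hξ' : ContMDiffOn 𝓘(ℝ, VM m) 𝓘(ℝ, VM m) ∞ ξ.symm ξ.target := contMDiffOn_chart_symm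
  have hζ : ContMDiffOn 𝓘(ℝ, VM N) 𝓘(ℝ, VM N) ∞ ζ ζ.source := contMDiffOn_chart
  have hζ' : ContMDiffOn 𝓘(ℝ, VM N) 𝓘(ℝ, VM N) ∞ ζ.symm ζ.target := contMDiffOn_chart_symm
  refine ⟨⟨χ, ξ, ?_, ?_, hξ, hξ', ?_, ?_⟩, ?_⟩
  · have h0 : ContMDiffOn 𝓘(ℝ, VE m N) (𝓘(ℝ, VM m).prod 𝓘(ℝ, VM N)) ∞ e χ.source :=
      he.mono fun z hz => (hsrc z hz).1
    have h1 : ContMDiffOn 𝓘(ℝ, VE m N) 𝓘(ℝ, VM m) ∞ (fun z => ξ (e z).1) χ.source :=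
      hξ.comp (contMDiff_fst.comp_contMDiffOn h0) fun z hz => (hsrc z hz).2.1
    have h2 : ContMDiffOn 𝓘(ℝ, VE m N) 𝓘(ℝ, VM N) ∞ (fun z => ζ (e z).2) χ.source :=
      hζ.comp (contMDiff_snd.comp_contMDiffOn h0) fun z hz => (hsrc z hz).2.2
    exact h1.prodMk_space h2
  · have h1 : ContMDiffOn 𝓘(ℝ, VE m N) 𝓘(ℝ, VM m) ∞ (fun z : VE m N => ξ.symm z.1) χ.target :=
      hξ'.comp (contDiff_fst.contMDiff.contMDiffOn) fun z hz => (htgt z hz).1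
    have h2 : ContMDiffOn 𝓘(ℝ, VE m N) 𝓘(ℝ, VM N) ∞ (fun z : VE m N => ζ.symm z.2) χ.target :=
      hζ'.comp (contDiff_snd.contMDiff.contMDiffOn) fun z hz => (htgt z hz).2.1
    exact he'.comp (h1.prodMk h2) fun z hz => (htgt z hz).2.2
  · intro z hz
    rw [← hproj z (hsrc z hz).1]; exact (hsrc z hz).2.1
  · intro z hz
    rw [← hproj z (hsrc z hz).1]; rfl
  · have h2 : (e y).2 ∈ ζ.source := mem_chart_source _ _
    have h1 : B.proj y ∈ ξ.source := mem_chart_source _ _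
    simpa [χ, mem_prod, hy, h2] using h1

/-- A family of sets `Fib y`, `y ∈ E`, which every adapted chart identifies with the fixed space `V`,
with smooth transition maps. Its total space is a manifold over `E`, with one natural chart for
every adapted chart. -/
structure FibreSystem (B : SmoothBundle m N M E F) (Fib : E → Type*)
    (V : Type*) [NormedAddCommGroup V] [NormedSpace ℝ V] where
  triv : ∀ (c : AdaptedChart B) (y : E), y ∈ c.chart.source → (Fib y ≃ V)
  smooth : ∀ c c' : AdaptedChart B, ∃ g : VE m N × V → V,
    ContDiffOn ℝ ∞ g {p | p.1 ∈ c.chart.target ∧ c.chart.symm p.1 ∈ c'.chart.source} ∧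
    ∀ (y : E) (h : y ∈ c.chart.source) (h' : y ∈ c'.chart.source) (w : V),
      triv c' y h' ((triv c y h).symm w) = g (c.chart y, w)

namespace FibreSystem

variable {B : SmoothBundle m N M E F} {Fib : E → Type*}
    {V : Type*} [NormedAddCommGroup V] [NormedSpace ℝ V] (S : FibreSystem B Fib V)

open Classical in
/-- Total space to coordinates. -/
def coord (c : AdaptedChart B) (q : Σ y, Fib y) : VE m N × V :=
  if h : q.1 ∈ c.chart.source then (c.chart q.1, S.triv c q.1 h q.2) else 0

open Classical in
/-- Coordinates to total space; `q₀` is the value outside the domain. -/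
def ofCoord (c : AdaptedChart B) (q₀ : Σ y, Fib y) (p : VE m N × V) : Σ y, Fib y :=
  if h : p.1 ∈ c.chart.target then
    ⟨c.chart.symm p.1, (S.triv c _ (c.chart.map_target h)).symm p.2⟩ else q₀

theorem coord_of_mem (c : AdaptedChart B) (q : Σ y, Fib y) (h : q.1 ∈ c.chart.source) :
    S.coord c q = (c.chart q.1, S.triv c q.1 h q.2) := dif_pos h

theorem ofCoord_of_mem (c : AdaptedChart B) (q₀ : Σ y, Fib y) (p : VE m N × V)
    (h : p.1 ∈ c.chart.target) : S.ofCoord c q₀ p =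
      ⟨c.chart.symm p.1, (S.triv c _ (c.chart.map_target h)).symm p.2⟩ := dif_pos h

/-- The natural chart of the total space induced by an adapted chart. -/
def natChart (c : AdaptedChart B) (q₀ : Σ y, Fib y) : PartialEquiv (Σ y, Fib y) (VE m N × V) where
  toFun := S.coord c
  invFun := S.ofCoord c q₀
  source := {q | q.1 ∈ c.chart.source}
  target := {p | p.1 ∈ c.chart.target}
  map_source' q hq := by
    have hq : q.1 ∈ c.chart.source := hq
    rw [S.coord_of_mem c q hq]
    exact c.chart.map_source hq
  map_target' p hp := by
    have hp : p.1 ∈ c.chart.target := hp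
    rw [S.ofCoord_of_mem c q₀ p hp]
    exact c.chart.map_target hp
  left_inv' q hq := by
    obtain ⟨y, v⟩ := q
    have hq : y ∈ c.chart.source := hq
    have aux : ∀ (z : E) (hz : z ∈ c.chart.source) (_ : z = y),
        (⟨z, (S.triv c z hz).symm (S.triv c y hq v)⟩ : Σ y, Fib y) = ⟨y, v⟩ := by
      rintro z hz rfl; simp
    rw [S.coord_of_mem c ⟨y, v⟩ hq, S.ofCoord_of_mem c q₀ _ (c.chart.map_source hq)]
    exact aux _ _ (c.chart.left_inv hq)
  right_inv' p hp := by
    have hp : p.1 ∈ c.chart.target := hp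
    rw [S.ofCoord_of_mem c q₀ p hp, S.coord_of_mem c _ (c.chart.map_target hp)]
    simp [c.chart.right_inv hp]

theorem natChart_apply (c : AdaptedChart B) (q₀ q : Σ y, Fib y) (h : q.1 ∈ c.chart.source) :
    S.natChart c q₀ q = (c.chart q.1, S.triv c q.1 h q.2) := S.coord_of_mem c q h

theorem natChart_symm_apply (c : AdaptedChart B) (q₀ : Σ y, Fib y) (p : VE m N × V)
    (h : p.1 ∈ c.chart.target) : (S.natChart c q₀).symm p =
      ⟨c.chart.symm p.1, (S.triv c _ (c.chart.map_target h)).symm p.2⟩ := S.ofCoord_of_mem c q₀ p h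

theorem overlap_source (c c' : AdaptedChart B) (q q' : Σ y, Fib y) :
    ((S.natChart c q).symm.trans (S.natChart c' q')).source =
      {p | p.1 ∈ c.chart.target ∧ c.chart.symm p.1 ∈ c'.chart.source} := by
  ext p
  simp only [PartialEquiv.trans_source, PartialEquiv.symm_source, mem_inter_iff, mem_preimage,
    mem_ofPred_eq]
  constructor
  · rintro ⟨h, h'⟩
    have h : p.1 ∈ c.chart.target := h
    rw [natChart_symm_apply S c q p h] at h'
    exact ⟨h, h'⟩
  · rintro ⟨h, h'⟩
    refine ⟨h, ?_⟩
    rw [natChart_symm_apply S c q p h]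
    exact h'

theorem overlap_isOpen (c c' : AdaptedChart B) :
    IsOpen {p : VE m N × V | p.1 ∈ c.chart.target ∧ c.chart.symm p.1 ∈ c'.chart.source} := by
  have h : IsOpen (c.chart.symm ≫ₕ c'.chart).source := (c.chart.symm ≫ₕ c'.chart).open_source
  have h2 := h.preimage (continuous_fst (X := VE m N) (Y := V))
  rwa [OpenPartialHomeomorph.trans_source, preimage_inter] at h2

theorem overlap_contDiffOn (c c' : AdaptedChart B) (q q' : Σ y, Fib y) :
    ContDiffOn ℝ ∞ ((S.natChart c q).symm.trans (S.natChart c' q'))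
      {p | p.1 ∈ c.chart.target ∧ c.chart.symm p.1 ∈ c'.chart.source} := by
  obtain ⟨g, hg, hg'⟩ := S.smooth c c'
  have h1 : ContDiffOn ℝ ∞ (fun a : VE m N => c'.chart (c.chart.symm a))
      {a | a ∈ c.chart.target ∧ c.chart.symm a ∈ c'.chart.source} := by
    rw [← contMDiffOn_iff_contDiffOn]
    exact c'.smooth.comp (c.smooth_symm.mono fun a ha => ha.1) fun a ha => ha.2
  have h2 : ContDiffOn ℝ ∞ (fun p : VE m N × V => (c'.chart (c.chart.symm p.1), g p))
      {p | p.1 ∈ c.chart.target ∧ c.chart.symm p.1 ∈ c'.chart.source} :=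
    (h1.comp contDiff_fst.contDiffOn fun p hp => hp).prodMk hg
  refine h2.congr ?_
  rintro p ⟨hp, hp'⟩
  rw [PartialEquiv.coe_trans, Function.comp_apply, natChart_symm_apply S c q p hp,
    natChart_apply S c' q' _ hp', hg' _ (c.chart.map_target hp) hp', c.chart.right_inv hp]

variable [IsManifold 𝓘(ℝ, VM m) ∞ M] [IsManifold 𝓘(ℝ, VM N) ∞ F]

/-- The atlas of natural charts. -/
def core : ChartedSpaceCore (VE m N × V) (Σ y, Fib y) where
  atlas := {e | ∃ c q, e = S.natChart c q}
  chartAt q := S.natChart (exists_adaptedChart B q.1).choose q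
  mem_chart_source q := (exists_adaptedChart B q.1).choose_spec
  chart_mem_atlas q := ⟨_, _, rfl⟩
  open_source := by
    rintro _ _ ⟨c, q, rfl⟩ ⟨c', q', rfl⟩
    rw [overlap_source]; exact overlap_isOpen c c'
  continuousOn_toFun := by
    rintro _ _ ⟨c, q, rfl⟩ ⟨c', q', rfl⟩
    rw [overlap_source]; exact (S.overlap_contDiffOn c c' q q').continuousOn

theorem isManifold :
    @IsManifold ℝ _ (VE m N × V) _ _ (VE m N × V) _ 𝓘(ℝ, VE m N × V) ∞ (Σ y, Fib y)
      S.core.toTopologicalSpace S.core.toChartedSpace := by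
  let := S.core.toTopologicalSpace
  let := S.core.toChartedSpace
  refine isManifold_of_contDiffOn _ _ _ ?_
  intro e e' he he'
  have key : ∀ e : OpenPartialHomeomorph (Σ y, Fib y) (VE m N × V), e ∈ atlas (VE m N × V) (Σ y, Fib y) →
      ∃ c q, e.toPartialEquiv = S.natChart c q := by
    intro e he
    obtain ⟨pe, hpe, he⟩ := mem_iUnion₂.1 he
    obtain ⟨c, q, rfl⟩ := hpe
    rw [mem_singleton_iff.1 he]
    exact ⟨c, q, rfl⟩
  obtain ⟨c, q, h⟩ := key e he
  obtain ⟨c', q', h'⟩ := key e' he'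
  have hs : (e.symm ≫ₕ e').toPartialEquiv = (S.natChart c q).symm.trans (S.natChart c' q') := by
    rw [← h, ← h']; rfl
  have := S.overlap_contDiffOn c c' q q'
  rw [← overlap_source S c c' q q', ← hs] at this
  simpa using this

theorem contMDiff_fst [IsManifold 𝓘(ℝ, VE m N) ∞ E] :
    @ContMDiff ℝ _ (VE m N × V) _ _ (VE m N × V) _ 𝓘(ℝ, VE m N × V) (Σ y, Fib y)
      S.core.toTopologicalSpace S.core.toChartedSpace (VE m N) _ _ (VE m N) _ 𝓘(ℝ, VE m N)
      E _ _ ∞ Sigma.fst := by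
  let := S.core.toTopologicalSpace
  let := S.core.toChartedSpace
  have := S.isManifold
  intro q
  set c := (exists_adaptedChart B q.1).choose with hc
  have hq : q.1 ∈ c.chart.source := (exists_adaptedChart B q.1).choose_spec
  have h1 : ContMDiffOn 𝓘(ℝ, VE m N × V) 𝓘(ℝ, VE m N × V) ∞ (chartAt (VE m N × V) q)
      (chartAt (VE m N × V) q).source := contMDiffOn_chart
  have h2 : ContMDiffOn 𝓘(ℝ, VE m N × V) 𝓘(ℝ, VE m N) ∞
      (fun z => c.chart.symm (chartAt (VE m N × V) q z).1) (chartAt (VE m N × V) q).source := by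
    refine c.smooth_symm.comp (contDiff_fst.contMDiff.comp_contMDiffOn h1) ?_
    intro z hz
    exact (chartAt (VE m N × V) q).map_source hz
  have h3 : ContMDiffAt 𝓘(ℝ, VE m N × V) 𝓘(ℝ, VE m N) ∞
      (fun z => c.chart.symm (chartAt (VE m N × V) q z).1) q :=
    h2.contMDiffAt ((chartAt (VE m N × V) q).open_source.mem_nhds (mem_chart_source _ q))
  refine h3.congr_of_eventuallyEq ?_
  filter_upwards [(chartAt (VE m N × V) q).open_source.mem_nhds (mem_chart_source _ q)] with z hz
  have hz : z.1 ∈ c.chart.source := hz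
  have : chartAt (VE m N × V) q z = (c.chart z.1, S.triv c z.1 hz z.2) :=
    S.natChart_apply c q z hz
  rw [this]
  exact (c.chart.left_inv hz).symm

end FibreSystem

/-! ### Linear algebra of forms -/

instance finiteDimensional_alternating (m : ℕ) (V : Type*) [NormedAddCommGroup V]
    [NormedSpace ℝ V] [FiniteDimensional ℝ V] : FiniteDimensional ℝ (V [⋀^Fin m]→L[ℝ] ℝ) := by
  let f : (V [⋀^Fin m]→L[ℝ] ℝ) →ₗ[ℝ] MultilinearMap ℝ (fun _ : Fin m => V) ℝ :=
    { toFun := fun g => g.toContinuousMultilinearMap.toMultilinearMap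
      map_add' := fun _ _ => rfl
      map_smul' := fun _ _ => rfl }
  refine FiniteDimensional.of_injective f ?_
  intro a b h
  ext v
  exact congrArg (fun g => g v) h

/-- The `m`-forms on `V` that vanish on any two vectors of `ker A`. -/
def forms₁ (m : ℕ) {V W : Type*} [NormedAddCommGroup V] [NormedSpace ℝ V]
    [NormedAddCommGroup W] [NormedSpace ℝ W] (A : V →L[ℝ] W) :
    Submodule ℝ (V [⋀^Fin m]→L[ℝ] ℝ) where
  carrier := {η | ∀ (v : Fin m → V) (i j : Fin m), i ≠ j → A (v i) = 0 → A (v j) = 0 → η v = 0}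
  add_mem' ha hb v i j hij hi hj := by
    simp [ha v i j hij hi hj, hb v i j hij hi hj]
  zero_mem' v i j hij hi hj := rfl
  smul_mem' r a ha v i j hij hi hj := by
    simp [ha v i j hij hi hj]

/-- The `m`-forms on `V` that are pulled back along `A`; for surjective `A`, these are the forms that
vanish on any vector of `ker A`. -/
def forms₀ (m : ℕ) {V W : Type*} [NormedAddCommGroup V] [NormedSpace ℝ V]
    [NormedAddCommGroup W] [NormedSpace ℝ W] (A : V →L[ℝ] W) : Submodule ℝ (forms₁ m A) :=
  (LinearMap.range (ContinuousAlternatingMap.compContinuousLinearMapₗ (N := ℝ) (ι := Fin m) A)).comap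
    (forms₁ m A).subtype

theorem mem_forms₀ {m : ℕ} {V W : Type*} [NormedAddCommGroup V] [NormedSpace ℝ V]
    [NormedAddCommGroup W] [NormedSpace ℝ W] {A : V →L[ℝ] W} {η : forms₁ m A} :
    η ∈ forms₀ m A ↔ ∃ β : W [⋀^Fin m]→L[ℝ] ℝ, β.compContinuousLinearMap A = η := Iff.rfl

instance isClosed_forms₀ (m : ℕ) {V W : Type*} [NormedAddCommGroup V] [NormedSpace ℝ V]
    [FiniteDimensional ℝ V]
    [NormedAddCommGroup W] [NormedSpace ℝ W] (A : V →L[ℝ] W) :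
    IsClosed (forms₀ m A : Set (forms₁ m A)) := Submodule.closed_of_finiteDimensional _

section pullback

variable {V W V' W' : Type*} [NormedAddCommGroup V] [NormedSpace ℝ V]
    [NormedAddCommGroup W] [NormedSpace ℝ W] [NormedAddCommGroup V'] [NormedSpace ℝ V']
    [NormedAddCommGroup W'] [NormedSpace ℝ W']

/-- A linear isomorphism `L` covering an isomorphism `Q` transports `forms₁` by `η ↦ η ∘ L⁻¹`. -/
def forms₁Equiv (m : ℕ) {A : V →L[ℝ] W} {A' : V' →L[ℝ] W'} (L : V ≃L[ℝ] V') (Q : W ≃L[ℝ] W')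
    (h : ∀ v, A' (L v) = Q (A v)) : forms₁ m A ≃ₗ[ℝ] forms₁ m A' where
  toFun η := ⟨η.1.compContinuousLinearMap (L.symm : V' →L[ℝ] V), by
    intro v i j hij hi hj
    have key : ∀ w, A' w = 0 → A (L.symm w) = 0 := fun w hw => by
      have := h (L.symm w)
      rw [L.apply_symm_apply, hw] at this
      exact (map_eq_zero_iff Q Q.injective).1 this.symm
    exact η.2 _ i j hij (key _ hi) (key _ hj)⟩
  invFun η := ⟨η.1.compContinuousLinearMap (L : V →L[ℝ] V'), by
    intro v i j hij hi hj
    have key : ∀ w, A w = 0 → A' (L w) = 0 := fun w hw => by rw [h, hw, map_zero]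
    exact η.2 _ i j hij (key _ hi) (key _ hj)⟩
  map_add' _ _ := rfl
  map_smul' _ _ := rfl
  left_inv η := by ext v; simp [Function.comp_def]
  right_inv η := by ext v; simp [Function.comp_def]

theorem forms₁Equiv_map (m : ℕ) {A : V →L[ℝ] W} {A' : V' →L[ℝ] W'} (L : V ≃L[ℝ] V')
    (Q : W ≃L[ℝ] W') (h : ∀ v, A' (L v) = Q (A v)) :
    (forms₀ m A).map (forms₁Equiv m L Q h : forms₁ m A →ₗ[ℝ] forms₁ m A') = forms₀ m A' := by
  ext η
  simp only [Submodule.mem_map, mem_forms₀]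
  constructor
  · rintro ⟨ζ, ⟨β, hβ⟩, rfl⟩
    refine ⟨β.compContinuousLinearMap (Q.symm : W' →L[ℝ] W), ?_⟩
    ext v
    have key : ∀ w, Q.symm (A' w) = A (L.symm w) := fun w => by
      rw [Q.symm_apply_eq, ← h, L.apply_symm_apply]
    change β _ = ζ.1 _
    rw [← hβ]
    simp [Function.comp_def, key]
  · rintro ⟨β, hβ⟩
    refine ⟨(forms₁Equiv m L Q h).symm η, ⟨β.compContinuousLinearMap (Q : W →L[ℝ] W'), ?_⟩, ?_⟩
    · ext v
      simp [forms₁Equiv, ← hβ, Function.comp_def, h]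
    · simp

/-- The induced isomorphism of the quotients. -/
def momentaEquiv (m : ℕ) {A : V →L[ℝ] W} {A' : V' →L[ℝ] W'} (L : V ≃L[ℝ] V') (Q : W ≃L[ℝ] W')
    (h : ∀ v, A' (L v) = Q (A v)) :
    (forms₁ m A ⧸ forms₀ m A) ≃ₗ[ℝ] (forms₁ m A' ⧸ forms₀ m A') :=
  Submodule.Quotient.equiv _ _ (forms₁Equiv m L Q h) (forms₁Equiv_map m L Q h)

end pullback

/-- Smoothness into a finite-dimensional space can be tested on separating functionals. -/
theorem contDiffOn_of_separating {X W : Type*} [NormedAddCommGroup X] [NormedSpace ℝ X]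
    [NormedAddCommGroup W] [NormedSpace ℝ W] [FiniteDimensional ℝ W] {ι : Type*}
    (ℓ : ι → W →ₗ[ℝ] ℝ) (hℓ : ∀ w, (∀ i, ℓ i w = 0) → w = 0) {f : X → W} {s : Set X}
    (hf : ∀ i, ContDiffOn ℝ ∞ (fun x => ℓ i (f x)) s) : ContDiffOn ℝ ∞ f s := by
  have hspan : Submodule.span ℝ (range ℓ) = ⊤ := by
    rw [← Subspace.dualCoannihilator_dualAnnihilator_eq (W := Submodule.span ℝ (range ℓ))]
    have : (Submodule.span ℝ (range ℓ)).dualCoannihilator = ⊥ := by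
      rw [eq_bot_iff]
      intro w hw
      refine hℓ w fun i => ?_
      exact (Submodule.mem_dualCoannihilator w).1 hw _ (Submodule.subset_span ⟨i, rfl⟩)
    rw [this, Submodule.dualAnnihilator_bot]
  have hall : ∀ φ : Module.Dual ℝ W, ContDiffOn ℝ ∞ (fun x => φ (f x)) s := by
    intro φ
    have hφ : φ ∈ Submodule.span ℝ (range ℓ) := by rw [hspan]; trivial
    induction hφ using Submodule.span_induction with
    | mem φ h => obtain ⟨i, rfl⟩ := h; exact hf i
    | zero => exact contDiffOn_const
    | add a b _ _ ha hb => exact ha.add hb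
    | smul r a _ ha => exact contDiffOn_const.smul ha
  let b := Module.finBasis ℝ W
  have : f = fun x => ∑ i, b.coord i (f x) • b i := by
    ext x; exact (b.sum_repr (f x)).symm
  rw [this]
  exact ContDiffOn.sum fun i _ => (hall (b.coord i)).smul contDiffOn_const

/-- The pullback of forms is smooth in the form and in the linear map. -/
theorem contDiffOn_forms₁ {m : ℕ} {X V V' W W' : Type*} [NormedAddCommGroup X] [NormedSpace ℝ X]
    [NormedAddCommGroup V] [NormedSpace ℝ V] [FiniteDimensional ℝ V]
    [NormedAddCommGroup W] [NormedSpace ℝ W]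
    [NormedAddCommGroup V'] [NormedSpace ℝ V'] [FiniteDimensional ℝ V']
    [NormedAddCommGroup W'] [NormedSpace ℝ W'] {A : V →L[ℝ] W} {A' : V' →L[ℝ] W'}
    {s : Set X} {η : X → forms₁ m A} {D : X → V' →L[ℝ] V} {f : X → forms₁ m A'}
    (hη : ContDiffOn ℝ ∞ η s) (hD : ContDiffOn ℝ ∞ D s)
    (hf : ∀ x ∈ s, (f x).1 = (η x).1.compContinuousLinearMap (D x)) : ContDiffOn ℝ ∞ f s := by
  let ℓ : (Fin m → V') → forms₁ m A' →ₗ[ℝ] ℝ := fun v =>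
    { toFun := fun ζ => ζ.1 v
      map_add' := fun _ _ => rfl
      map_smul' := fun _ _ => rfl }
  refine contDiffOn_of_separating ℓ (fun w hw => Subtype.ext (by ext v; exact hw v)) fun v => ?_
  have h1 : ∀ x ∈ s, ℓ v (f x) = (η x).1 (fun i => D x (v i)) := fun x hx => by
    change (f x).1 v = _
    rw [hf x hx]; rfl
  refine ContDiffOn.congr ?_ h1
  let b := Module.finBasis ℝ (forms₁ m A)
  have h2 : (fun x => (η x).1 (fun i => D x (v i))) =
      fun x => ∑ k, b.coord k (η x) * (b k).1 (fun i => D x (v i)) := by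
    ext x
    let ev : forms₁ m A →ₗ[ℝ] ℝ :=
      { toFun := fun ζ => ζ.1 (fun i => D x (v i))
        map_add' := fun _ _ => rfl
        map_smul' := fun _ _ => rfl }
    have := congrArg ev (b.sum_repr (η x))
    rw [map_sum] at this
    refine this.symm.trans (Finset.sum_congr rfl fun k _ => ?_)
    rw [map_smul]
    rfl
  rw [h2]
  refine ContDiffOn.sum fun k _ => ContDiffOn.mul ?_ ?_
  · exact ((b.coord k).toContinuousLinearMap.contDiff).comp_contDiffOn hη
  · have hm : ContDiff ℝ ∞ (fun u : Fin m → V => (b k).1 u) :=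
      (b k).1.toContinuousMultilinearMap.contDiff
    exact hm.comp_contDiffOn (contDiffOn_pi.2 fun i => hD.clm_apply contDiffOn_const)

/-! ### Derivatives of adapted charts -/

/-- The tangent map `T_yπ`. -/
def SmoothBundle.dproj (B : SmoothBundle m N M E F) (y : E) : VE m N →L[ℝ] VM m :=
  mfderiv 𝓘(ℝ, VE m N) 𝓘(ℝ, VM m) B.proj y

namespace AdaptedChart

variable {B : SmoothBundle m N M E F} (c c' : AdaptedChart B)

theorem mdifferentiable : c.chart.MDifferentiable 𝓘(ℝ, VE m N) 𝓘(ℝ, VE m N) :=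
  ⟨c.smooth.mdifferentiableOn (by simp), c.smooth_symm.mdifferentiableOn (by simp)⟩

theorem mdifferentiable_base : c.base.MDifferentiable 𝓘(ℝ, VM m) 𝓘(ℝ, VM m) :=
  ⟨c.base_smooth.mdifferentiableOn (by simp), c.base_smooth_symm.mdifferentiableOn (by simp)⟩

/-- The tangent map at `y` of the chart of the total space. -/
def lin (y : E) (hy : y ∈ c.chart.source) : VE m N ≃L[ℝ] VE m N :=
  c.mdifferentiable.mfderiv hy

/-- The tangent map at `π y` of the chart of the base. -/
def blin (y : E) (hy : y ∈ c.chart.source) : VM m ≃L[ℝ] VM m :=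
  c.mdifferentiable_base.mfderiv (c.proj_mem y hy)

theorem lin_apply (y : E) (hy : y ∈ c.chart.source) (v : VE m N) :
    c.lin y hy v = mfderiv 𝓘(ℝ, VE m N) 𝓘(ℝ, VE m N) c.chart y v := rfl

theorem fst_lin (y : E) (hy : y ∈ c.chart.source) (v : VE m N) :
    (c.lin y hy v).1 = c.blin y hy (B.dproj y v) := by
  have hs := c.chart.open_source.mem_nhds hy
  have h1 : MDifferentiableAt 𝓘(ℝ, VE m N) 𝓘(ℝ, VE m N) c.chart y :=
    (c.smooth.contMDiffAt hs).mdifferentiableAt (by simp)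
  have h2 : MDifferentiableAt 𝓘(ℝ, VE m N) 𝓘(ℝ, VM m) B.proj y :=
    (B.contMDiff_proj y).mdifferentiableAt (by simp)
  have h3 : MDifferentiableAt 𝓘(ℝ, VM m) 𝓘(ℝ, VM m) c.base (B.proj y) :=
    (c.base_smooth.contMDiffAt (c.base.open_source.mem_nhds (c.proj_mem y hy))).mdifferentiableAt
      (by simp)
  have h4 : MDifferentiableAt 𝓘(ℝ, VE m N) 𝓘(ℝ, VM m) (ContinuousLinearMap.fst ℝ (VM m) (VM N))
      (c.chart y) := (ContinuousLinearMap.fst ℝ (VM m) (VM N)).mdifferentiableAt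
  have e1 := mfderiv_comp y h4 h1
  have e2 := mfderiv_comp y h3 h2
  have e3 : (ContinuousLinearMap.fst ℝ (VM m) (VM N)) ∘ c.chart =ᶠ[𝓝 y] c.base ∘ B.proj := by
    filter_upwards [hs] with z hz using c.fst_eq z hz
  rw [e3.mfderiv_eq, e2, (ContinuousLinearMap.fst ℝ (VM m) (VM N)).mfderiv_eq] at e1
  exact (congrArg (fun L : VE m N →L[ℝ] VM m => L v) e1).symm

/-- The derivative of the change of adapted coordinates. -/
def trans (a : VE m N) : VE m N →L[ℝ] VE m N := fderiv ℝ (c'.chart ∘ c.chart.symm) a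

theorem lin_lin_symm (y : E) (hy : y ∈ c.chart.source) (hy' : y ∈ c'.chart.source) (w : VE m N) :
    c'.lin y hy' ((c.lin y hy).symm w) = c.trans c' (c.chart y) w := by
  have hs := c.chart.open_source.mem_nhds hy
  have ht := c.chart.open_target.mem_nhds (c.chart.map_source hy)
  have h1 : MDifferentiableAt 𝓘(ℝ, VE m N) 𝓘(ℝ, VE m N) c.chart.symm (c.chart y) :=
    (c.smooth_symm.contMDiffAt ht).mdifferentiableAt (by simp)
  have h2 : MDifferentiableAt 𝓘(ℝ, VE m N) 𝓘(ℝ, VE m N) c'.chart (c.chart.symm (c.chart y)) := by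
    rw [c.chart.left_inv hy]
    exact (c'.smooth.contMDiffAt (c'.chart.open_source.mem_nhds hy')).mdifferentiableAt (by simp)
  have e := mfderiv_comp (c.chart y) h2 h1
  have e' := congrArg (fun L : VE m N →L[ℝ] VE m N => L w) e
  have e'' : c.trans c' (c.chart y) w = mfderiv 𝓘(ℝ, VE m N) 𝓘(ℝ, VE m N) c'.chart
      (c.chart.symm (c.chart y)) (mfderiv 𝓘(ℝ, VE m N) 𝓘(ℝ, VE m N) c.chart.symm (c.chart y) w) := by
    rw [trans, ← mfderiv_eq_fderiv]; exact e'
  rw [e'']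
  have aux : ∀ z, z = y → ∀ u : VE m N, (mfderiv 𝓘(ℝ, VE m N) 𝓘(ℝ, VE m N) c'.chart z :
      VE m N →L[ℝ] VE m N) u = (mfderiv 𝓘(ℝ, VE m N) 𝓘(ℝ, VE m N) c'.chart y :
      VE m N →L[ℝ] VE m N) u := by
    rintro z rfl u; rfl
  exact (aux _ (c.chart.left_inv hy) _).symm

theorem blin_blin_symm (y : E) (hy : y ∈ c.chart.source) (hy' : y ∈ c'.chart.source) (w : VM m) :
    c'.blin y hy' ((c.blin y hy).symm w) = (c.trans c' (c.chart y) (w, 0)).1 := by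
  rw [← lin_lin_symm c c' y hy hy', fst_lin]
  congr 1
  rw [ContinuousLinearEquiv.symm_apply_eq, ← fst_lin, ContinuousLinearEquiv.apply_symm_apply]

/-- The domain of the change of adapted coordinates. -/
def overlap : Set (VE m N) := {a | a ∈ c.chart.target ∧ c.chart.symm a ∈ c'.chart.source}

theorem contDiffOn_change : ContDiffOn ℝ ∞ (c'.chart ∘ c.chart.symm) (c.overlap c') := by
  rw [← contMDiffOn_iff_contDiffOn]
  exact c'.smooth.comp (c.smooth_symm.mono fun a ha => ha.1) fun a ha => ha.2

theorem isOpen_overlap : IsOpen (c.overlap c') := by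
  have h : IsOpen (c.chart.symm ≫ₕ c'.chart).source := (c.chart.symm ≫ₕ c'.chart).open_source
  rwa [OpenPartialHomeomorph.trans_source] at h

theorem contDiffOn_trans : ContDiffOn ℝ ∞ (c.trans c') (c.overlap c') :=
  (c.contDiffOn_change c').fderiv_of_isOpen (c.isOpen_overlap c') (by simp)

theorem contDiffOn_trans' :
    ContDiffOn ℝ ∞ (fun a => c'.trans c (c'.chart (c.chart.symm a))) (c.overlap c') := by
  refine (c'.contDiffOn_trans c).comp (c.contDiffOn_change c') ?_
  rintro a ⟨ha, ha'⟩
  refine ⟨c'.chart.map_source ha', ?_⟩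
  change c'.chart.symm (c'.chart (c.chart.symm a)) ∈ c.chart.source
  rw [c'.chart.left_inv ha']
  exact c.chart.map_target ha

end AdaptedChart

/-! ### Quotients of finite-dimensional normed spaces -/

section quotient

variable {V : Type*} [NormedAddCommGroup V] [NormedSpace ℝ V] (S : Submodule ℝ V)
  [IsClosed (S : Set V)]

theorem exists_quotient_section [FiniteDimensional ℝ V] :
    ∃ σ : (V ⧸ S) →L[ℝ] V, ∀ w, (Submodule.Quotient.mk (σ w) : V ⧸ S) = w := by
  obtain ⟨s, hs⟩ := LinearMap.exists_rightInverse_of_surjective S.mkQ S.range_mkQ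
  exact ⟨s.toContinuousLinearMap, fun w => congrArg (fun L => L w) hs⟩

theorem contDiff_quotient_mk [FiniteDimensional ℝ V] :
    ContDiff ℝ ∞ (fun v => (Submodule.Quotient.mk v : V ⧸ S)) :=
  S.mkQ.toContinuousLinearMap.contDiff

theorem contDiffOn_quotient [FiniteDimensional ℝ V] {X : Type*} [NormedAddCommGroup X]
    [NormedSpace ℝ X] {p : X → Prop} {g : X × V → V} (hg : ContDiffOn ℝ ∞ g {x | p x.1})
    (σ : (V ⧸ S) →L[ℝ] V) :
    ContDiffOn ℝ ∞ (fun x : X × (V ⧸ S) => (Submodule.Quotient.mk (g (x.1, σ x.2)) : V ⧸ S))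
      {x | p x.1} :=
  (contDiff_quotient_mk S).comp_contDiffOn (hg.comp
    (contDiff_fst.prodMk (σ.contDiff.comp contDiff_snd)).contDiffOn fun x hx => hx)

end quotient

/-! ### The bundles over the configuration bundle -/

section bundles

variable (B : SmoothBundle m N M E F)

/-- `1`-jets at `y` of sections of the bundle: linear sections of `T_y π`. -/
abbrev JetFibre (y : E) : Type := {γ : VM m →L[ℝ] VE m N // (B.dproj y).comp γ = .id ℝ (VM m)}

/-- The coordinate space of the jets at a point. -/
abbrev J1Model (m N : ℕ) := VM m →L[ℝ] VM N

/-- The jet coordinates `v^A_α`. -/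
def jetTriv (c : AdaptedChart B) (y : E) (hy : y ∈ c.chart.source) :
    JetFibre B y ≃ J1Model m N where
  toFun γ := ((ContinuousLinearMap.snd ℝ (VM m) (VM N)).comp
    (c.lin y hy : VE m N →L[ℝ] VE m N)).comp (γ.1.comp ((c.blin y hy).symm : VM m →L[ℝ] VM m))
  invFun v := ⟨((c.lin y hy).symm : VE m N →L[ℝ] VE m N).comp
    (((ContinuousLinearMap.id ℝ (VM m)).prod v).comp (c.blin y hy : VM m →L[ℝ] VM m)), by
      ext1 x
      apply (c.blin y hy).injective
      simp [← c.fst_lin]⟩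
  left_inv γ := by
    apply Subtype.ext
    ext1 x
    apply (c.lin y hy).injective
    have h : (B.dproj y) (γ.1 x) = x := congrArg (fun L : VM m →L[ℝ] VM m => L x) γ.2
    refine Prod.ext ?_ ?_
    · simp [c.fst_lin, h]
    · simp
  right_inv v := by
    ext1 x
    simp

/-- The natural charts of the jet bundle. -/
def jetSystem : FibreSystem B (JetFibre B) (J1Model m N) where
  triv := jetTriv B
  smooth c c' := by
    refine ⟨fun p => ((ContinuousLinearMap.snd ℝ (VM m) (VM N)).comp (c.trans c' p.1)).comp
      (((ContinuousLinearMap.id ℝ (VM m)).prod p.2).comp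
        ((ContinuousLinearMap.fst ℝ (VM m) (VM N)).comp
          ((c'.trans c (c'.chart (c.chart.symm p.1))).comp
            (ContinuousLinearMap.inl ℝ (VM m) (VM N))))), ?_, ?_⟩
    · have h1 : ContDiffOn ℝ ∞ (fun p : VE m N × J1Model m N => c.trans c' p.1)
          {p | p.1 ∈ c.chart.target ∧ c.chart.symm p.1 ∈ c'.chart.source} :=
        (c.contDiffOn_trans c').comp contDiff_fst.contDiffOn fun p hp => hp
      have h2 : ContDiffOn ℝ ∞ (fun p : VE m N × J1Model m N =>
          c'.trans c (c'.chart (c.chart.symm p.1)))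
          {p | p.1 ∈ c.chart.target ∧ c.chart.symm p.1 ∈ c'.chart.source} :=
        (c.contDiffOn_trans' c').comp contDiff_fst.contDiffOn fun p hp => hp
      have h3 : ContDiff ℝ ∞ (fun p : VE m N × J1Model m N =>
          (ContinuousLinearMap.id ℝ (VM m)).prod p.2) := by
        have : (fun p : VE m N × J1Model m N => (ContinuousLinearMap.id ℝ (VM m)).prod p.2) =
            fun p => (ContinuousLinearMap.inl ℝ (VM m) (VM N)) +
              (ContinuousLinearMap.inr ℝ (VM m) (VM N)).comp p.2 := by
          ext p x <;> simp
        rw [this]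
        exact contDiff_const.add (contDiff_const.clm_comp contDiff_snd)
      exact (contDiffOn_const.clm_comp h1).clm_comp (h3.contDiffOn.clm_comp
        (contDiffOn_const.clm_comp (h2.clm_comp contDiffOn_const)))
    · intro y h h' w
      ext1 x
      have e1 := c.lin_lin_symm c' y h h'
      have e2 := c'.blin_blin_symm c y h' h
      change (c'.lin y h' ((c.lin y h).symm (c.blin y h ((c'.blin y h').symm x),
        w (c.blin y h ((c'.blin y h').symm x))))).2 = _
      rw [e1, e2]
      simp [c.chart.left_inv h]

/-- `m`-forms at `y` that vanish on two vertical vectors. -/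
abbrev MultimomentumFibre (y : E) : Type := forms₁ m (B.dproj y)

def MpiModel (m N : ℕ) : Type := forms₁ m (ContinuousLinearMap.fst ℝ (VM m) (VM N))

instance (m N : ℕ) : NormedAddCommGroup (MpiModel m N) :=
  (forms₁ m (ContinuousLinearMap.fst ℝ (VM m) (VM N))).normedAddCommGroup

instance (m N : ℕ) : NormedSpace ℝ (MpiModel m N) :=
  (forms₁ m (ContinuousLinearMap.fst ℝ (VM m) (VM N))).normedSpace

/-- The natural charts of the extended multimomentum bundle. -/
def mpiSystem : FibreSystem B (MultimomentumFibre B) (MpiModel m N) where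
  triv c y hy := (forms₁Equiv m (c.lin y hy) (c.blin y hy)
    (fun v => c.fst_lin y hy v)).toEquiv
  smooth c c' := by
    classical
    let f : ∀ (y : E), y ∈ c.chart.source → y ∈ c'.chart.source → MpiModel m N → MpiModel m N :=
      fun y h h' w => forms₁Equiv m (c'.lin y h') (c'.blin y h') (fun v => c'.fst_lin y h' v)
        ((forms₁Equiv m (c.lin y h) (c.blin y h) (fun v => c.fst_lin y h v)).symm w)
    have hf : ∀ y h h' w, (f y h h' w).1 =
        w.1.compContinuousLinearMap (c'.trans c (c'.chart y)) := by
      intro y h h' w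
      ext v
      change w.1 (fun i => c.lin y h ((c'.lin y h').symm (v i))) = _
      simp only [c'.lin_lin_symm c y h' h]
      rfl
    refine ⟨fun p => if h : p.1 ∈ c.chart.target ∧ c.chart.symm p.1 ∈ c'.chart.source then
      f (c.chart.symm p.1) (c.chart.map_target h.1) h.2 p.2 else 0, ?_, ?_⟩
    · have h2 : ContDiffOn ℝ ∞ (fun p : VE m N × MpiModel m N =>
          c'.trans c (c'.chart (c.chart.symm p.1)))
          {p | p.1 ∈ c.chart.target ∧ c.chart.symm p.1 ∈ c'.chart.source} :=
        (c.contDiffOn_trans' c').comp contDiff_fst.contDiffOn fun p hp => hp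
      refine contDiffOn_forms₁ contDiff_snd.contDiffOn h2 ?_
      intro p hp
      have hp : p.1 ∈ c.chart.target ∧ c.chart.symm p.1 ∈ c'.chart.source := hp
      simp only [dif_pos hp]
      exact hf _ _ _ _
    · intro y h h' w
      have hp : c.chart y ∈ c.chart.target ∧ c.chart.symm (c.chart y) ∈ c'.chart.source :=
        ⟨c.chart.map_source h, by rwa [c.chart.left_inv h]⟩
      simp only [dif_pos hp]
      have aux : ∀ z hz hz', z = y → f z hz hz' w = f y h h' w := by
        rintro z hz hz' rfl; rfl
      exact (aux _ _ _ (c.chart.left_inv h)).symm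

/-- The quotient by the `m`-forms that come from the base. -/
abbrev MomentumFibre (y : E) : Type := forms₁ m (B.dproj y) ⧸ forms₀ m (B.dproj y)

def J1sModel (m N : ℕ) : Type :=
  forms₁ m (ContinuousLinearMap.fst ℝ (VM m) (VM N)) ⧸
    forms₀ m (ContinuousLinearMap.fst ℝ (VM m) (VM N))

instance (m N : ℕ) : NormedAddCommGroup (J1sModel m N) :=
  Submodule.Quotient.normedAddCommGroup (forms₀ m (ContinuousLinearMap.fst ℝ (VM m) (VM N)))

instance (m N : ℕ) : NormedSpace ℝ (J1sModel m N) :=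
  Submodule.Quotient.normedSpace (forms₀ m (ContinuousLinearMap.fst ℝ (VM m) (VM N))) ℝ

/-- The natural charts of the restricted multimomentum bundle. -/
def momSystem : FibreSystem B (MomentumFibre B) (J1sModel m N) where
  triv c y hy := (momentaEquiv m (c.lin y hy) (c.blin y hy)
    (fun v => c.fst_lin y hy v)).toEquiv
  smooth c c' := by
    obtain ⟨g, hg, hg'⟩ := (mpiSystem B).smooth c c'
    obtain ⟨σ, hσ⟩ := exists_quotient_section
      (forms₀ m (ContinuousLinearMap.fst ℝ (VM m) (VM N)))
    refine ⟨fun p => Submodule.Quotient.mk (g (p.1, σ p.2)), ?_, ?_⟩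
    · exact contDiffOn_quotient (p := fun a => a ∈ c.chart.target ∧ c.chart.symm a ∈ c'.chart.source)
        (forms₀ m (ContinuousLinearMap.fst ℝ (VM m) (VM N))) hg σ
    · intro y h h' w
      beta_reduce
      rw [← hg' y h h' (σ w)]
      conv_lhs => rw [← hσ w]
      rfl

end bundles

section manifolds

/-- The first jet bundle `J¹E`. -/
def J1 (B : SmoothBundle m N M E F) := Σ y, JetFibre B y

/-- The extended multimomentum bundle `Λ₁ᵐT*E`. -/
def Mpi (B : SmoothBundle m N M E F) := Σ y, MultimomentumFibre B y

/-- The restricted multimomentum bundle `Λ₁ᵐT*E / Λ₀ᵐT*E`. -/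
def J1s (B : SmoothBundle m N M E F) := Σ y, MomentumFibre B y

abbrev J1Space (m N : ℕ) := VE m N × J1Model m N
abbrev MpiSpace (m N : ℕ) := VE m N × MpiModel m N
abbrev J1sSpace (m N : ℕ) := VE m N × J1sModel m N

variable [IsManifold 𝓘(ℝ, VM m) ∞ M] [IsManifold 𝓘(ℝ, VM N) ∞ F]
  (B : SmoothBundle m N M E F)

instance : TopologicalSpace (J1 B) := (jetSystem B).core.toTopologicalSpace
instance : ChartedSpace (J1Space m N) (J1 B) := (jetSystem B).core.toChartedSpace
instance : IsManifold 𝓘(ℝ, J1Space m N) ∞ (J1 B) := (jetSystem B).isManifold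
instance : TopologicalSpace (Mpi B) := (mpiSystem B).core.toTopologicalSpace
instance : ChartedSpace (MpiSpace m N) (Mpi B) := (mpiSystem B).core.toChartedSpace
instance : IsManifold 𝓘(ℝ, MpiSpace m N) ∞ (Mpi B) := (mpiSystem B).isManifold
instance : TopologicalSpace (J1s B) := (momSystem B).core.toTopologicalSpace
instance : ChartedSpace (J1sSpace m N) (J1s B) := (momSystem B).core.toChartedSpace
instance : IsManifold 𝓘(ℝ, J1sSpace m N) ∞ (J1s B) := (momSystem B).isManifold

/-- The projection `τ¹ : J¹*E → E`. -/
def tau1 (q : J1s B) : E := q.1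

theorem contMDiff_tau1 [IsManifold 𝓘(ℝ, VE m N) ∞ E] :
    ContMDiff 𝓘(ℝ, J1sSpace m N) 𝓘(ℝ, VE m N) ∞ (tau1 B) := (momSystem B).contMDiff_fst

/-- The projection `μ : 𝓜π → J¹*E`. -/
def mu (q : Mpi B) : J1s B := ⟨q.1, Submodule.Quotient.mk q.2⟩

end manifolds

/-! ### Tangent maps, multivectors, differential forms -/

section calculus

variable {V W : Type*} [NormedAddCommGroup V] [NormedSpace ℝ V]
  [NormedAddCommGroup W] [NormedSpace ℝ W]
  {X Y : Type*} [TopologicalSpace X] [ChartedSpace V X] [TopologicalSpace Y] [ChartedSpace W Y]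

/-- The tangent map `T_x f`. -/
def tangent (V W : Type*) [NormedAddCommGroup V] [NormedSpace ℝ V]
    [NormedAddCommGroup W] [NormedSpace ℝ W]
    {X Y : Type*} [TopologicalSpace X] [ChartedSpace V X] [TopologicalSpace Y] [ChartedSpace W Y]
    (f : X → Y) (x : X) : TangentSpace 𝓘(ℝ, V) x →L[ℝ] TangentSpace 𝓘(ℝ, W) (f x) :=
  mfderiv 𝓘(ℝ, V) 𝓘(ℝ, W) f x

/-- The `m`-vectors at `x`. -/
abbrev MVector (m : ℕ) (V : Type*) [NormedAddCommGroup V] [NormedSpace ℝ V]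
    {X : Type*} [TopologicalSpace X] [ChartedSpace V X] (x : X) :=
  ⋀[ℝ]^m (TangentSpace 𝓘(ℝ, V) x)

/-- The map `ΛᵐT_x f` on `m`-vectors. -/
def wedgeT (m : ℕ) (V W : Type*) [NormedAddCommGroup V] [NormedSpace ℝ V]
    [NormedAddCommGroup W] [NormedSpace ℝ W]
    {X Y : Type*} [TopologicalSpace X] [ChartedSpace V X] [TopologicalSpace Y] [ChartedSpace W Y]
    (f : X → Y) (x : X) : MVector m V x →ₗ[ℝ] MVector m W (f x) :=
  exteriorPower.map m (tangent V W f x).toLinearMap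

/-- Differential `k`-forms (not necessarily smooth). -/
abbrev DForm (V X : Type*) [NormedAddCommGroup V] [NormedSpace ℝ V]
    [TopologicalSpace X] [ChartedSpace V X] (k : ℕ) :=
  ∀ x : X, (TangentSpace 𝓘(ℝ, V) x) [⋀^Fin k]→L[ℝ] ℝ

namespace DForm

/-- The representative of a form in the preferred chart at `x₀`. -/
def loc {k : ℕ} (η : DForm V X k) (x₀ : X) (a : V) : V [⋀^Fin k]→L[ℝ] ℝ :=
  (η ((chartAt V x₀).symm a)).compContinuousLinearMap (tangent V V (chartAt V x₀).symm a)

/-- Smoothness of a form. -/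
def IsSmooth {k : ℕ} (η : DForm V X k) : Prop :=
  ∀ x₀ : X, ContDiffOn ℝ ∞ (η.loc x₀) (chartAt V x₀).target

/-- The exterior derivative, computed at `x` in the preferred chart at `x`. -/
def d {k : ℕ} (η : DForm V X k) : DForm V X (k + 1) := fun x =>
  (extDeriv (η.loc x) (chartAt V x x)).compContinuousLinearMap (tangent V V (chartAt V x) x)

/-- The pullback of a form. -/
def pullback {k : ℕ} (f : X → Y) (η : DForm W Y k) : DForm V X k := fun x =>
  (η (f x)).compContinuousLinearMap (tangent V W f x)

end DForm

/-- The pairing of an alternating form with a multivector. -/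
def pair {T : Type*} [AddCommGroup T] [Module ℝ T] [TopologicalSpace T] {k : ℕ}
    (η : T [⋀^Fin k]→L[ℝ] ℝ) : ⋀[ℝ]^k T →ₗ[ℝ] ℝ :=
  exteriorPower.alternatingMapLinearEquiv η.toAlternatingMap

/-- The inner contraction `i(v)η`. -/
def contract {T : Type*} [AddCommGroup T] [Module ℝ T] [TopologicalSpace T] {k : ℕ}
    (v : T) (η : T [⋀^Fin (k + 1)]→L[ℝ] ℝ) : T [⋀^Fin k]→ₗ[ℝ] ℝ :=
  η.toAlternatingMap.curryLeft v

/-- The inner contraction `i(K)η` of a `(k+1)`-form with a `k`-vector, evaluated on `v`;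
for `K = K₁ ∧ ⋯ ∧ K_k` this is `η(K₁, …, K_k, v) = (-1)ᵏ η(v, K₁, …, K_k)`. -/
def contractMV {T : Type*} [AddCommGroup T] [Module ℝ T] [TopologicalSpace T] {k : ℕ}
    (K : ⋀[ℝ]^k T) (η : T [⋀^Fin (k + 1)]→L[ℝ] ℝ) (v : T) : ℝ :=
  (-1) ^ k * exteriorPower.alternatingMapLinearEquiv (contract v η) K

/-- Smoothness of a vector field. -/
def IsSmoothVectorField (Z : ∀ x : X, TangentSpace 𝓘(ℝ, V) x) [IsManifold 𝓘(ℝ, V) ∞ X] : Prop :=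
  ContMDiff 𝓘(ℝ, V) 𝓘(ℝ, V).tangent ∞ (fun x => (⟨x, Z x⟩ : TangentBundle 𝓘(ℝ, V) X))

/-- Smoothness on `U` of a vector field along `Φ`. -/
def IsSmoothFieldAlong (V W : Type*) [NormedAddCommGroup V] [NormedSpace ℝ V]
    [NormedAddCommGroup W] [NormedSpace ℝ W]
    {X Y : Type*} [TopologicalSpace X] [ChartedSpace V X] [TopologicalSpace Y] [ChartedSpace W Y]
    [IsManifold 𝓘(ℝ, W) ∞ Y] (Φ : X → Y) (Z : ∀ x : X, TangentSpace 𝓘(ℝ, W) (Φ x))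
    (U : Set X) : Prop :=
  ContMDiffOn 𝓘(ℝ, V) 𝓘(ℝ, W).tangent ∞
    (fun x => (⟨Φ x, Z x⟩ : TangentBundle 𝓘(ℝ, W) Y)) U

/-- Smooth functions without zeros. -/
def IsNonvanishing (V : Type*) [NormedAddCommGroup V] [NormedSpace ℝ V]
    {X : Type*} [TopologicalSpace X] [ChartedSpace V X] (f : X → ℝ) : Prop :=
  ContMDiff 𝓘(ℝ, V) 𝓘(ℝ, ℝ) ∞ f ∧ ∀ x, f x ≠ 0

/-- Smooth sections of `p : Y → X`. -/
def IsSmoothSection (V W : Type*) [NormedAddCommGroup V] [NormedSpace ℝ V]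
    [NormedAddCommGroup W] [NormedSpace ℝ W]
    {X Y : Type*} [TopologicalSpace X] [ChartedSpace V X] [TopologicalSpace Y] [ChartedSpace W Y]
    (p : Y → X) (s : X → Y) : Prop :=
  ContMDiff 𝓘(ℝ, V) 𝓘(ℝ, W) ∞ s ∧ ∀ x, p (s x) = x

end calculus

/-! ### Lagrangian systems -/

section lagrangian

variable [IsManifold 𝓘(ℝ, VM m) ∞ M] [IsManifold 𝓘(ℝ, VM N) ∞ F]

/-- The first jet prolongation of a section. -/
def j1 (B : SmoothBundle m N M E F) (φ : M → E)
    (hφ : IsSmoothSection (VM m) (VE m N) B.proj φ) (x : M) : J1 B :=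
  ⟨φ x, ⟨tangent (VM m) (VE m N) φ x, by
    have h1 : MDifferentiableAt 𝓘(ℝ, VM m) 𝓘(ℝ, VE m N) φ x :=
      (hφ.1 x).mdifferentiableAt (by simp)
    have h2 : MDifferentiableAt 𝓘(ℝ, VE m N) 𝓘(ℝ, VM m) B.proj (φ x) :=
      (B.contMDiff_proj (φ x)).mdifferentiableAt (by simp)
    have h3 := mfderiv_comp x h2 h1
    have h4 : B.proj ∘ φ = id := funext hφ.2
    rw [h4, mfderiv_id] at h3
    exact h3.symm⟩⟩

/-- A Lagrangian density `𝓛 = £ ω` on `J¹E`, with `ω` a volume form on `M`. -/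
structure LagrangianSystem (m N : ℕ) (M E F : Type*)
    [TopologicalSpace M] [ChartedSpace (VM m) M]
    [TopologicalSpace E] [ChartedSpace (VE m N) E]
    [TopologicalSpace F] [ChartedSpace (VM N) F]
    [IsManifold 𝓘(ℝ, VM m) ∞ M] [IsManifold 𝓘(ℝ, VM N) ∞ F] where
  bundle : SmoothBundle m N M E F
  vol : DForm (VM m) M m
  vol_smooth : vol.IsSmooth
  vol_ne_zero : ∀ x, vol x ≠ 0
  lag : J1 bundle → ℝ
  lag_smooth : ContMDiff 𝓘(ℝ, J1Space m N) 𝓘(ℝ, ℝ) ∞ lag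

namespace LagrangianSystem

variable (L : LagrangianSystem m N M E F)

/-- The jet `γ + (1 - γ ∘ T_yπ) ∘ A`. -/
def shift (s : J1 L.bundle) (A : VM m →L[ℝ] VE m N) : J1 L.bundle :=
  ⟨s.1, ⟨s.2.1 + (A - s.2.1.comp ((L.bundle.dproj s.1).comp A)), by
    have h : (L.bundle.dproj s.1).comp s.2.1 = .id ℝ (VM m) := s.2.2
    have h' : ∀ v, L.bundle.dproj s.1 (s.2.1 v) = v := fun v =>
      congrArg (fun L : VM m →L[ℝ] VM m => L v) h
    ext1 v
    simp [h']⟩⟩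

/-- The derivative of `£` along the fibre of `J¹E → E`. -/
def fibreDeriv (s : J1 L.bundle) : (VM m →L[ℝ] VE m N) →L[ℝ] ℝ :=
  fderiv ℝ (fun A => L.lag (L.shift s A)) 0

/-- The fibre derivative as a linear map `T_yE → T_xM`: in adapted coordinates
`∂/∂xᵝ ↦ -v^A_β (∂£/∂v^A_α) ∂/∂xᵅ`, `∂/∂y^A ↦ (∂£/∂v^A_α) ∂/∂xᵅ`. -/
def momentum (s : J1 L.bundle) : VE m N →L[ℝ] VM m :=
  ∑ a : Fin m, ((L.fibreDeriv s).comp (ContinuousLinearMap.smulRightL ℝ (VM m) (VE m N)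
    (EuclideanSpace.proj a))).smulRight (EuclideanSpace.single a (1 : ℝ))

/-- The extended Legendre map, as the first order vertical Taylor approximation of `£ vol`:
in adapted coordinates with `vol = dᵐx` it is
`p^α_A = ∂£/∂v^A_α`, `p = £ - v^A_α ∂£/∂v^A_α`. -/
def FLt (s : J1 L.bundle) : Mpi L.bundle :=
  ⟨s.1, ⟨L.lag s • (show VM m [⋀^Fin m]→L[ℝ] ℝ from L.vol (L.bundle.proj s.1)).compContinuousLinearMap
      (L.bundle.dproj s.1) +
    ContinuousAlternatingMap.fderivCompContinuousLinearMap
      (show VM m [⋀^Fin m]→L[ℝ] ℝ from L.vol (L.bundle.proj s.1)) (L.bundle.dproj s.1)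
      (L.momentum s), by
    intro v i j hij hi hj
    set η : VM m [⋀^Fin m]→L[ℝ] ℝ := L.vol (L.bundle.proj s.1)
    have h1 : η (fun k => L.bundle.dproj s.1 (v k)) = 0 :=
      η.toAlternatingMap.map_coord_zero i hi
    have h2 : ∀ k, η (fun l => Function.update (fun _ => L.bundle.dproj s.1) k (L.momentum s) l
        (v l)) = 0 := by
      intro k
      by_cases hk : k = i
      · refine η.toAlternatingMap.map_coord_zero j ?_
        rw [Function.update_of_ne (by rw [hk]; exact hij.symm)]
        exact hj
      · refine η.toAlternatingMap.map_coord_zero i ?_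
        rw [Function.update_of_ne (Ne.symm hk)]
        exact hi
    rw [ContinuousAlternatingMap.add_apply, ContinuousAlternatingMap.smul_apply,
      ContinuousAlternatingMap.fderivCompContinuousLinearMap_apply, Finset.sum_eq_zero fun k _ => h2 k]
    have h3 : (η.compContinuousLinearMap (L.bundle.dproj s.1)) v = 0 := h1
    rw [h3]; simp⟩⟩

/-- The restricted Legendre map. -/
def FL (s : J1 L.bundle) : J1s L.bundle := mu L.bundle (L.FLt s)

/-- The multimomentum Liouville `m`-form. -/
def Θ : DForm (MpiSpace m N) (Mpi L.bundle) m := fun q =>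
  q.2.1.compContinuousLinearMap (tangent (MpiSpace m N) (VE m N) (fun q : Mpi L.bundle => q.1) q)

/-- The multimomentum Liouville `(m+1)`-form. -/
def Ω : DForm (MpiSpace m N) (Mpi L.bundle) (m + 1) := fun q => -(L.Θ.d q)

/-- Extended `m`-vector field operators: `m`-vector fields along the extended Legendre map that are
locally decomposable (with smooth factors), transverse, satisfy the field equation and are
semi-holonomic. -/
structure IsExtendedOperator (K : ∀ s : J1 L.bundle, MVector m (MpiSpace m N) (L.FLt s)) : Prop where
  decomposable : ∀ s₀ : J1 L.bundle, ∃ U ∈ 𝓝 s₀,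
    ∃ X : Fin m → ∀ s : J1 L.bundle, TangentSpace 𝓘(ℝ, MpiSpace m N) (L.FLt s),
      (∀ i, IsSmoothFieldAlong (J1Space m N) (MpiSpace m N) L.FLt (X i) U) ∧
      ∀ s ∈ U, K s = exteriorPower.ιMulti ℝ m (fun i => X i s)
  ne_zero : ∀ s, K s ≠ 0
  transverse : ∀ s, pair (L.vol (L.bundle.proj s.1)) (wedgeT m (MpiSpace m N) (VM m)
    (fun q : Mpi L.bundle => L.bundle.proj (tau1 L.bundle (mu L.bundle q))) (L.FLt s) (K s)) ≠ 0
  field_eq : ∀ (s : J1 L.bundle) (w : TangentSpace 𝓘(ℝ, J1Space m N) s),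
    contractMV (K s) (L.Ω (L.FLt s)) (tangent (J1Space m N) (MpiSpace m N) L.FLt s w) = 0
  semiholonomic : ∀ s : J1 L.bundle, ∃ e : MVector m (VM m) (L.bundle.proj s.1),
    wedgeT m (MpiSpace m N) (VE m N)
      (fun q : Mpi L.bundle => tau1 L.bundle (mu L.bundle q)) (L.FLt s) (K s) =
    exteriorPower.map m (show VM m →L[ℝ] VE m N from s.2.1).toLinearMap e

/-- The restricted operator `ΛᵐTμ ∘ K̃`. -/
def restrict (K : ∀ s : J1 L.bundle, MVector m (MpiSpace m N) (L.FLt s)) (s : J1 L.bundle) :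
    MVector m (J1sSpace m N) (L.FL s) :=
  wedgeT m (MpiSpace m N) (J1sSpace m N) (mu L.bundle) (L.FLt s) (K s)

/-- The relation `ΛᵐTψ = f K ∘ j ∘ σ_M`, where `K` is an `m`-vector field along `Φ : J¹E → Y`,
evaluated on the `m`-vectors of `M` that are normalized by the volume form; the equality is in
the total space of `m`-vectors of `Y`. -/
def Relation {W Y : Type*} [NormedAddCommGroup W] [NormedSpace ℝ W] [TopologicalSpace Y]
    [ChartedSpace W Y] (Φ : J1 L.bundle → Y) (K : ∀ s, MVector m W (Φ s)) (f : J1 L.bundle → ℝ)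
    (ψ : M → Y) (j : M → J1 L.bundle) : Prop :=
  ∀ (x : M) (u : MVector m (VM m) x), pair (L.vol x) u = 1 →
    (⟨ψ x, wedgeT m (VM m) W ψ x u⟩ : Σ y : Y, MVector m W y) = ⟨Φ (j x), f (j x) • K (j x)⟩

/-- `ψ` is an integral section of the (class of the) `m`-vector field `X`. -/
def IsIntegralSection {VP P : Type*} [NormedAddCommGroup VP] [NormedSpace ℝ VP]
    [TopologicalSpace P] [ChartedSpace VP P] (X : ∀ p : P, MVector m VP p) (ψ : M → P) : Prop :=
  ∃ f : P → ℝ, IsNonvanishing VP f ∧ ∀ (x : M) (u : MVector m (VM m) x), pair (L.vol x) u = 1 →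
    wedgeT m (VM m) VP ψ x u = f (ψ x) • X (ψ x)

/-- An almost-regular system (hyper-regular systems are the case where `incl` is a diffeomorphism):
the image `P` of the Legendre map is a closed submanifold, the Legendre map is a submersion onto it
and its fibres are connected. -/
structure AlmostRegular (VP P : Type*) [NormedAddCommGroup VP] [NormedSpace ℝ VP]
    [TopologicalSpace P] [ChartedSpace VP P] where
  incl : P → J1s L.bundle
  incl_smooth : ContMDiff 𝓘(ℝ, VP) 𝓘(ℝ, J1sSpace m N) ∞ incl
  incl_closed : Topology.IsClosedEmbedding incl
  incl_immersion : ∀ p, Function.Injective (tangent VP (J1sSpace m N) incl p)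
  FL₀ : J1 L.bundle → P
  incl_FL₀ : ∀ s, incl (FL₀ s) = L.FL s
  FL₀_smooth : ContMDiff 𝓘(ℝ, J1Space m N) 𝓘(ℝ, VP) ∞ FL₀
  FL₀_surjective : Function.Surjective FL₀
  FL₀_submersion : ∀ s, Function.Surjective (tangent (J1Space m N) VP FL₀ s)
  FL₀_connected : ∀ p, IsConnected (FL₀ ⁻¹' {p})

namespace AlmostRegular

variable {L} {VP P : Type*} [NormedAddCommGroup VP] [NormedSpace ℝ VP]
    [TopologicalSpace P] [ChartedSpace VP P] (A : L.AlmostRegular VP P)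

/-- The projection of `P` to `M`. -/
def toBase (p : P) : M := L.bundle.proj (tau1 L.bundle (A.incl p))

/-- The lift of `P` to the extended multimomentum bundle, that is the extended Legendre map composed
with the inverse of `FL₀`. -/
def lift (p : P) : Mpi L.bundle := L.FLt (Function.surjInv A.FL₀_surjective p)

/-- The Hamilton-Cartan `(m+1)`-form. -/
def Ωh : DForm VP P (m + 1) := DForm.pullback A.lift L.Ω

/-- `ψ` solves the Hamiltonian problem: `ψ^*(i(X)Ω_h) = 0` for every vector field `X` on `P`. -/
def SolvesHamilton [IsManifold 𝓘(ℝ, VP) ∞ P] (ψ : M → P) : Prop :=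
  ∀ X : (∀ p : P, TangentSpace 𝓘(ℝ, VP) p), IsSmoothVectorField X →
    ∀ (x : M) (v : Fin m → TangentSpace 𝓘(ℝ, VM m) x),
      contract (X (ψ x)) (A.Ωh (ψ x)) (fun i => tangent (VM m) VP ψ x (v i)) = 0

variable {A}

theorem isSmoothSection_phi [IsManifold 𝓘(ℝ, VE m N) ∞ E] {ψ : M → P} (hψ : IsSmoothSection (VM m) VP A.toBase ψ) :
    IsSmoothSection (VM m) (VE m N) L.bundle.proj (fun x => tau1 L.bundle (A.incl (ψ x))) :=
  ⟨((contMDiff_tau1 L.bundle).comp A.incl_smooth).comp hψ.1, hψ.2⟩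

theorem tau1_mu_lift (p : P) : tau1 L.bundle (mu L.bundle (A.lift p)) = tau1 L.bundle (A.incl p) := by
  conv_rhs => rw [← Function.surjInv_eq A.FL₀_surjective p, A.incl_FL₀]
  rfl

theorem isSmoothSection_phi_lift [IsManifold 𝓘(ℝ, VE m N) ∞ E] {ψ : M → P} (hψ : IsSmoothSection (VM m) VP A.toBase ψ) :
    IsSmoothSection (VM m) (VE m N) L.bundle.proj
      (fun x => tau1 L.bundle (mu L.bundle (A.lift (ψ x)))) := by
  simp only [tau1_mu_lift]
  exact isSmoothSection_phi hψ

end AlmostRegular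

end LagrangianSystem

end lagrangian

end

/-! In natural coordinates, with the density of the volume form absorbed into the Lagrangian as
`lam`, the extended Legendre map is `leg lam`: it sends `(x, y, v)` to the momenta `π = ∂lam/∂v` and
the energy component `p = lam - π v`. Differentiating `p + π v = lam` gives `dp + dπ(v) = ∂lam` with
only the derivatives along `E` on the right (`fderiv_leg_energy`). This identity controls the energy
component everywhere. It shows that the tangent kernel of `FL₀` is contained in that of `FLt`; hence
`FLt` is constant on the connected fibres of `FL₀`, and `lift` is a smooth map with `lift ∘ FL₀ =
FLt` (`lift_FL₀`, `smoothAt_lift`).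

The value of an extended operator at a jet `s` is `ΛᵐD` of an `m`-vector of the base, for a linear
map `D` that lifts `s` and satisfies the field equation (`IsFieldSection`,
`IsExtendedOperator.exists_section`). Linear sections are recovered from their effect on a nonzero
`m`-vector (`section_eq_of_wmap_eq`), so it is enough to work with `D`. In coordinates
(`isFieldSection_iff`) the field equation says that the momenta of `D` have divergence `∂lam/∂y` and
that its energy component is determined by its momenta. A lifted section of `P` is tangent to the
image of `FLt`, so its energy component obeys the same rule. Thus the relation for the restricted
operator forces the one for the extended operator (`relation_lift`), which is the second statement.
It also makes the tangent map of the lift a field section. Since `T FL₀` is onto, testing on the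
image of `T FLt` is testing on the image of `T lift`, so the Hamiltonian problem is solved.

For the third statement, semi-holonomy recovers the jet from the value of the restricted operator
(`jet_eq_of_relation`), and the factors are carried between `J¹E` and `P` by `FL₀` and by the jet of
the section.

The remaining implication starts from a solution and needs two things. First, `ψ₀` must be `FL₀` of
the jet `j` of its projection to `E`. If `s` is any jet over `ψ₀ x`, contraction with the images of
vertical vectors shows that the Hessian of `lam` in `v` at `s` kills `j - s`, so `j - s` is tangent
at `s` to the fibre of `FL₀` (`fderiv_FL₀C_sub`). Choose `s` in this closed fibre nearest to `j`.
Then `j - s` is also orthogonal to the fibre, hence zero (`eq_of_lagrange_multiplier`,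
`eq_FL₀_jet_of_solvesHamilton`).

Second, the tangent maps of the lifted solution, which are field sections along the image of `j`,
must be extended to all jets. The field equation is affine in `D` and has explicit local solutions
with prescribed values along that image; a partition of unity glues them
(`exists_smooth_fieldSection`). Applying `ΛᵐD` to the normalized `m`-vector of the base gives the
operator, with factor `1`. -/

set_option linter.unusedSectionVars false
noncomputable section

variable {m N : ℕ} {M E F : Type*}
    [TopologicalSpace M] [ChartedSpace (VM m) M]
    [TopologicalSpace E] [ChartedSpace (VE m N) E]
    [TopologicalSpace F] [ChartedSpace (VM N) F]


/-! ### Tangent maps between model spaces -/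

section tangentMaps

variable {V W Z : Type*} [NormedAddCommGroup V] [NormedSpace ℝ V]
  [NormedAddCommGroup W] [NormedSpace ℝ W] [NormedAddCommGroup Z] [NormedSpace ℝ Z]
  {X Y R : Type*} [TopologicalSpace X] [ChartedSpace V X] [TopologicalSpace Y] [ChartedSpace W Y]
  [TopologicalSpace R] [ChartedSpace Z R]

/-- The tangent map, as a map between the model spaces. -/
def tg (V W : Type*) [NormedAddCommGroup V] [NormedSpace ℝ V]
    [NormedAddCommGroup W] [NormedSpace ℝ W]
    {X Y : Type*} [TopologicalSpace X] [ChartedSpace V X] [TopologicalSpace Y] [ChartedSpace W Y]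
    (f : X → Y) (x : X) : V →L[ℝ] W :=
  mfderiv 𝓘(ℝ, V) 𝓘(ℝ, W) f x

/-- Smoothness at a point. -/
abbrev SmoothAt (V W : Type*) [NormedAddCommGroup V] [NormedSpace ℝ V]
    [NormedAddCommGroup W] [NormedSpace ℝ W]
    {X Y : Type*} [TopologicalSpace X] [ChartedSpace V X] [TopologicalSpace Y] [ChartedSpace W Y]
    (f : X → Y) (x : X) : Prop :=
  ContMDiffAt 𝓘(ℝ, V) 𝓘(ℝ, W) ∞ f x

theorem SmoothAt.mdiff {f : X → Y} {x : X} (h : SmoothAt V W f x) :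
    MDifferentiableAt 𝓘(ℝ, V) 𝓘(ℝ, W) f x := ContMDiffAt.mdifferentiableAt h (by simp)

theorem tg_comp {g : Y → R} {f : X → Y} {x : X} (hg : SmoothAt W Z g (f x))
    (hf : SmoothAt V W f x) : tg V Z (fun x => g (f x)) x = (tg W Z g (f x)).comp (tg V W f x) :=
  mfderiv_comp x hg.mdiff hf.mdiff

theorem tg_comp_of_eq {g : Y → R} {f : X → Y} {x : X} {y : Y} (hy : f x = y)
    (hg : SmoothAt W Z g y) (hf : SmoothAt V W f x) :
    tg V Z (fun x => g (f x)) x = (tg W Z g y).comp (tg V W f x) := by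
  subst hy; exact tg_comp hg hf

theorem SmoothAt.comp_of_eq {g : Y → R} {f : X → Y} {x : X} {y : Y} (hy : f x = y)
    (hg : SmoothAt W Z g y) (hf : SmoothAt V W f x) : SmoothAt V Z (fun x => g (f x)) x := by
  subst hy; exact ContMDiffAt.comp x hg hf

theorem tg_congr {f g : X → Y} {x : X} (h : f =ᶠ[𝓝 x] g) : tg V W f x = tg V W g x :=
  h.mfderiv_eq

theorem tg_id (x : X) : tg V V (fun x : X => x) x = .id ℝ V := mfderiv_id

theorem tg_eq_fderiv (f : V → W) (x : V) : tg V W f x = fderiv ℝ f x := mfderiv_eq_fderiv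

theorem tg_clm (f : V →L[ℝ] W) (x : V) : tg V W f x = f := by
  rw [tg_eq_fderiv]; exact f.fderiv

/-- The tangent space at `x` is identified with the model space by the preferred chart at `x`
itself. -/
theorem tg_chartAt_self [IsManifold 𝓘(ℝ, V) ∞ X] (x : X) : tg V V (chartAt V x) x = .id ℝ V := by
  have : IsManifold 𝓘(ℝ, V) 1 X := .of_le (n := ∞) (by simp)
  have h := mfderiv_extChartAt_self (I := 𝓘(ℝ, V)) (x := x)
  simp only [mfld_simps] at h
  exact h

/-- Charts with values in a normed space that are smooth in both directions. -/
structure IsSmoothChart (V : Type*) {W : Type*} [NormedAddCommGroup V] [NormedSpace ℝ V]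
    [NormedAddCommGroup W] [NormedSpace ℝ W] {X : Type*} [TopologicalSpace X] [ChartedSpace V X]
    (e : OpenPartialHomeomorph X W) : Prop where
  smooth : ContMDiffOn 𝓘(ℝ, V) 𝓘(ℝ, W) ∞ e e.source
  smooth_symm : ContMDiffOn 𝓘(ℝ, W) 𝓘(ℝ, V) ∞ e.symm e.target

namespace IsSmoothChart

theorem of_mem_atlas [IsManifold 𝓘(ℝ, V) ∞ X] {e : OpenPartialHomeomorph X V}
    (h : e ∈ atlas V X) : IsSmoothChart V e :=
  ⟨contMDiffOn_of_mem_maximalAtlas (IsManifold.subset_maximalAtlas h),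
    contMDiffOn_symm_of_mem_maximalAtlas (IsManifold.subset_maximalAtlas h)⟩

theorem chartAt [IsManifold 𝓘(ℝ, V) ∞ X] (x : X) : IsSmoothChart V (chartAt V x) :=
  of_mem_atlas (chart_mem_atlas V x)

variable {e : OpenPartialHomeomorph X W} (he : IsSmoothChart V e)
include he

theorem at_source {x : X} (hx : x ∈ e.source) : SmoothAt V W e x :=
  he.smooth.contMDiffAt (e.open_source.mem_nhds hx)

theorem at_target {p : W} (hp : p ∈ e.target) : SmoothAt W V e.symm p :=
  he.smooth_symm.contMDiffAt (e.open_target.mem_nhds hp)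

theorem trans_clm (Λ : W ≃L[ℝ] Z) :
    IsSmoothChart V (e.transHomeomorph Λ.toHomeomorph) := by
  constructor
  · exact Λ.contDiff.contMDiff.comp_contMDiffOn he.smooth
  · refine he.smooth_symm.comp (Λ.symm.contDiff.contMDiff.contMDiffOn) ?_
    intro p hp
    simpa using hp

theorem tg_symm_tg {x : X} (hx : x ∈ e.source) (v : V) :
    tg W V e.symm (e x) (tg V W e x v) = v := by
  have h := tg_comp (he.at_target (e.map_source hx)) (he.at_source hx)
  rw [tg_congr (g := fun x => x), tg_id] at h
  · exact (congrArg (fun L : V →L[ℝ] V => L v) h).symm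
  · filter_upwards [e.open_source.mem_nhds hx] with y hy using e.left_inv hy

theorem tg_tg_symm {p : W} (hp : p ∈ e.target) (w : W) :
    tg V W e (e.symm p) (tg W V e.symm p w) = w := by
  have h := tg_comp (he.at_source (e.map_target hp)) (he.at_target hp)
  rw [tg_congr (g := fun x => x), tg_id] at h
  · exact (congrArg (fun L : W →L[ℝ] W => L w) h).symm
  · filter_upwards [e.open_target.mem_nhds hp] with y hy using e.right_inv hy

theorem tg_tg_symm' {x : X} (hx : x ∈ e.source) (w : W) :
    tg V W e x (tg W V e.symm (e x) w) = w := by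
  have h := he.tg_tg_symm (e.map_source hx) w
  rwa [e.left_inv hx] at h

theorem tg_injective {x : X} (hx : x ∈ e.source) : Function.Injective (tg V W e x) := by
  intro v v' h
  rw [← he.tg_symm_tg hx v, h, he.tg_symm_tg hx]

/-- A map into a manifold is smooth if its expression in a chart is. -/
theorem smoothAt_of_chart {f : R → X} {r : R} (hr : ∀ᶠ r' in 𝓝 r, f r' ∈ e.source)
    (h : SmoothAt Z W (fun r => e (f r)) r) : SmoothAt Z V f r := by
  have h1 : SmoothAt Z V (fun r => e.symm (e (f r))) r :=
    SmoothAt.comp_of_eq rfl (he.at_target (e.map_source hr.self_of_nhds)) h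
  refine ContMDiffAt.congr_of_eventuallyEq h1 ?_
  filter_upwards [hr] with r' hr' using (e.left_inv hr').symm

/-- Smoothness of a map out of a manifold, tested in a chart. -/
theorem smoothAt_comp_symm {f : X → R} {x : X} (hx : x ∈ e.source) (hf : SmoothAt V Z f x) :
    SmoothAt W Z (fun p => f (e.symm p)) (e x) :=
  SmoothAt.comp_of_eq (e.left_inv hx) hf (he.at_target (e.map_source hx))

end IsSmoothChart

end tangentMaps

/-! ### Natural charts -/

namespace FibreSystem

variable {B : SmoothBundle m N M E F} {Fib : E → Type*}
    {V : Type*} [NormedAddCommGroup V] [NormedSpace ℝ V] (S : FibreSystem B Fib V)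

/-- The total space. -/
def Tot (_S : FibreSystem B Fib V) := Σ y, Fib y

variable [IsManifold 𝓘(ℝ, VM m) ∞ M] [IsManifold 𝓘(ℝ, VM N) ∞ F]

instance : TopologicalSpace S.Tot := S.core.toTopologicalSpace
instance : ChartedSpace (VE m N × V) S.Tot := S.core.toChartedSpace
instance : IsManifold 𝓘(ℝ, VE m N × V) ∞ S.Tot := S.isManifold

/-- The natural chart, as a local homeomorphism. -/
def nat (c : AdaptedChart B) (q₀ : S.Tot) : OpenPartialHomeomorph S.Tot (VE m N × V) :=
  S.core.openPartialHomeomorph (S.natChart c q₀) ⟨c, q₀, rfl⟩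

theorem nat_coe (c : AdaptedChart B) (q₀ : S.Tot) : ⇑(S.nat c q₀) = S.coord c := rfl

theorem nat_fst (c : AdaptedChart B) (q₀ q : S.Tot) (h : q.1 ∈ c.chart.source) :
    (S.nat c q₀ q).1 = c.chart q.1 := by
  rw [nat_coe, S.coord_of_mem c q h]

theorem nat_mem_atlas (c : AdaptedChart B) (q₀ : S.Tot) : S.nat c q₀ ∈ atlas (VE m N × V) S.Tot :=
  mem_iUnion₂.2 ⟨S.natChart c q₀, ⟨c, q₀, rfl⟩, rfl⟩

theorem isSmoothChart_nat (c : AdaptedChart B) (q₀ : S.Tot) :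
    IsSmoothChart (VE m N × V) (S.nat c q₀) := .of_mem_atlas (S.nat_mem_atlas c q₀)

theorem continuous_fst' : Continuous (fun q : S.Tot => q.1) := by
  rw [continuous_iff_continuousAt]
  intro q
  obtain ⟨c, hc⟩ := exists_adaptedChart B q.1
  have hq : q ∈ (S.nat c q).source := hc
  have h1 : ContinuousAt (fun q' : S.Tot => c.chart.symm (S.nat c q q').1) q := by
    refine ContinuousAt.comp (f := fun q' : S.Tot => (S.nat c q q').1) ?_
      (continuousAt_fst.comp ((S.nat c q).continuousAt hq))
    exact c.chart.symm.continuousAt ((S.nat c q).map_source hq)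
  refine h1.congr ?_
  filter_upwards [(S.nat c q).open_source.mem_nhds hq] with q' hq'
  rw [S.nat_fst c q q' hq', c.chart.left_inv hq']

theorem eventually_mem (c : AdaptedChart B) {q : S.Tot} (hq : q.1 ∈ c.chart.source) :
    ∀ᶠ q' : S.Tot in 𝓝 q, q'.1 ∈ c.chart.source :=
  (S.nat c q).open_source.mem_nhds hq

/-- Two points over the same point of `E` are separated inside one natural chart, other pairs by
open sets pulled back from `E`. -/
theorem t2Space [T2Space E] : T2Space S.Tot := by
  refine ⟨fun q q' hne => ?_⟩
  by_cases h : q.1 = q'.1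
  · obtain ⟨c, hc⟩ := exists_adaptedChart B q.1
    have hq : q ∈ (S.nat c q).source := hc
    have hq' : q' ∈ (S.nat c q).source := by
      change q'.1 ∈ c.chart.source
      rwa [← h]
    have hne' : S.nat c q q ≠ S.nat c q q' := fun h => hne ((S.nat c q).injOn hq hq' h)
    obtain ⟨u, v, hu, hv, huq, hvq, huv⟩ := t2_separation hne'
    refine ⟨_, _, (S.nat c q).isOpen_inter_preimage hu, (S.nat c q).isOpen_inter_preimage hv,
      ⟨hq, huq⟩, ⟨hq', hvq⟩, ?_⟩
    exact (huv.preimage _).mono inter_subset_right inter_subset_right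
  · obtain ⟨u, v, hu, hv, huq, hvq, huv⟩ := t2_separation h
    exact ⟨_, _, hu.preimage S.continuous_fst', hv.preimage S.continuous_fst', huq, hvq,
      huv.preimage _⟩

/-- Since `E` is second countable, countably many adapted charts cover it, and their natural charts
cover the total space. This is needed for partitions of unity on the jet bundle. -/
theorem secondCountable [SigmaCompactSpace E] [FiniteDimensional ℝ V] :
    SecondCountableTopology S.Tot := by
  have : SecondCountableTopology E := ChartedSpace.secondCountable_of_sigmaCompact (VE m N) E
  obtain ⟨t, ht, hcover⟩ := TopologicalSpace.countable_cover_nhds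
    (f := fun y : E => (exists_adaptedChart B y).choose.chart.source)
    (fun y => OpenPartialHomeomorph.open_source _ |>.mem_nhds (exists_adaptedChart B y).choose_spec)
  by_cases hE : Nonempty S.Tot
  · obtain ⟨q₀⟩ := hE
    let e : t → OpenPartialHomeomorph S.Tot (VE m N × V) := fun y =>
      S.nat (exists_adaptedChart B y.1).choose q₀
    have : Countable t := ht.to_subtype
    have h1 : ∀ i, IsOpen (e i).source := fun i => (e i).open_source
    have h2 : ⋃ i, (e i).source = univ := by
      refine eq_univ_of_forall fun q => ?_
      have : q.1 ∈ ⋃ y ∈ t, (exists_adaptedChart B y).choose.chart.source := by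
        rw [hcover]; trivial
      obtain ⟨y, hy, hq⟩ := mem_iUnion₂.1 this
      exact mem_iUnion.2 ⟨⟨y, hy⟩, hq⟩
    have h3 : ∀ i, SecondCountableTopology (e i).source := fun i =>
      (e i).secondCountableTopology_source
    exact TopologicalSpace.secondCountableTopology_of_countable_cover h1 h2
  · have : IsEmpty S.Tot := not_nonempty_iff.1 hE
    infer_instance

theorem sigmaCompact [SigmaCompactSpace E] [FiniteDimensional ℝ V] : SigmaCompactSpace S.Tot := by
  have := S.secondCountable
  have : LocallyCompactSpace S.Tot := ChartedSpace.locallyCompactSpace (VE m N × V) S.Tot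
  infer_instance

end FibreSystem

/-! ### Coordinates of multimomenta -/

instance (m N : ℕ) : ContinuousSMul ℝ (J1Space m N) := inferInstance

section multimomenta

/-- The standard basis vectors of the base. -/
def eb (i : Fin m) : VM m := EuclideanSpace.single i (1 : ℝ)

theorem sum_eb (x : VM m) : ∑ i, x i • eb i = x := by
  ext j
  simp [eb, Pi.single_apply]

theorem eb_apply (i j : Fin m) : (eb i : VM m) j = if j = i then 1 else 0 := by
  simp [eb]

/-- The jet coordinates `dxⁱ ⊗ z`. -/
def tens (i : Fin m) (z : VM N) : J1Model m N := (EuclideanSpace.proj i).smulRight z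

theorem tens_apply (i : Fin m) (z : VM N) (x : VM m) : tens i z x = x i • z := rfl

theorem sum_tens (a : J1Model m N) : ∑ i, tens i (a (eb i)) = a := by
  ext1 x
  conv_rhs => rw [← sum_eb x, map_sum]
  rw [sum_apply]
  simp [tens_apply]

theorem tens_zero (i : Fin m) : tens i (0 : VM N) = 0 := by
  ext1 x; simp [tens_apply]

theorem contAlt_update_sum {V : Type*} [NormedAddCommGroup V] [NormedSpace ℝ V]
    (ν : V [⋀^Fin m]→L[ℝ] ℝ) (w : Fin m → V) (k : Fin m) {ι : Type*} (t : Finset ι) (g : ι → V) :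
    ν (Function.update w k (∑ l ∈ t, g l)) = ∑ l ∈ t, ν (Function.update w k (g l)) :=
  ν.toMultilinearMap.map_update_sum t k g w

theorem contAlt_update_smul {V : Type*} [NormedAddCommGroup V] [NormedSpace ℝ V]
    (ν : V [⋀^Fin m]→L[ℝ] ℝ) (w : Fin m → V) (k : Fin m) (r : ℝ) (g : V) :
    ν (Function.update w k (r • g)) = r * ν (Function.update w k g) :=
  ν.toMultilinearMap.map_update_smul w k r g

theorem contAlt_update_add {V : Type*} [NormedAddCommGroup V] [NormedSpace ℝ V]
    (ν : V [⋀^Fin m]→L[ℝ] ℝ) (w : Fin m → V) (k : Fin m) (g g' : V) :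
    ν (Function.update w k (g + g')) = ν (Function.update w k g) + ν (Function.update w k g') :=
  ν.toMultilinearMap.map_update_add w k g g'

/-- Replacing one vector of a family `w` by a linear combination of the family. -/
theorem contAlt_update_comb {V : Type*} [NormedAddCommGroup V] [NormedSpace ℝ V]
    (ν : V [⋀^Fin m]→L[ℝ] ℝ) (w : Fin m → V) (k : Fin m) (x : Fin m → ℝ) :
    ν (Function.update w k (∑ l, x l • w l)) = x k * ν w := by
  rw [contAlt_update_sum, Finset.sum_eq_single k]
  · rw [contAlt_update_smul, Function.update_eq_self]
  · intro l _ hl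
    rw [contAlt_update_smul, ν.map_eq_zero_of_eq (i := k) (j := l) _ _ (Ne.symm hl), mul_zero]
    simp [Function.update_of_ne hl]
  · simp

theorem vol_update (ν : VM m [⋀^Fin m]→L[ℝ] ℝ) (k : Fin m) (x : VM m) :
    ν (Function.update eb k x) = x k * ν eb := by
  conv_lhs => rw [← sum_eb x]
  exact contAlt_update_comb ν eb k x

/-- The graph of a jet, evaluated on the standard basis. -/
def graphBasis (A : J1Model m N) (i : Fin m) : VE m N := (eb i, A (eb i))

/-- The vector `(x, z)` is the combination of the graph basis with coefficients `x`, plus a vertical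
vector. Of the combination, an alternating form sees only the `k`-th coefficient. -/
theorem update_graphBasis (ξ : VE m N [⋀^Fin m]→L[ℝ] ℝ) (A : J1Model m N) (k : Fin m) (x : VM m)
    (z : VM N) : ξ (Function.update (graphBasis A) k (x, z)) =
      x k * ξ (graphBasis A) + ξ (Function.update (graphBasis A) k (0, z - A x)) := by
  have h : ((x, z) : VE m N) = (∑ l, x l • graphBasis A l) + (0, z - A x) := by
    have h1 : (∑ l, x l • graphBasis A l) = (x, A x) := by
      have : ∀ l, x l • graphBasis A l = ((ContinuousLinearMap.id ℝ (VM m)).prod A) (x l • eb l) := by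
        intro l; simp [graphBasis]
      simp only [this]
      rw [← map_sum, sum_eb]; rfl
    rw [h1]; simp
  rw [h, contAlt_update_add, contAlt_update_comb]

/-- The `m`-forms of the shape of the values of the extended Legendre map. -/
def genForm (ν : VM m [⋀^Fin m]→L[ℝ] ℝ) (p : ℝ) (T : VE m N →L[ℝ] VM m) :
    VE m N [⋀^Fin m]→L[ℝ] ℝ :=
  p • ν.compContinuousLinearMap (ContinuousLinearMap.fst ℝ (VM m) (VM N)) +
    ν.fderivCompContinuousLinearMap (ContinuousLinearMap.fst ℝ (VM m) (VM N)) T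

theorem genForm_apply (ν : VM m [⋀^Fin m]→L[ℝ] ℝ) (p : ℝ) (T : VE m N →L[ℝ] VM m)
    (w : Fin m → VE m N) : genForm ν p T w = p * ν (fun i => (w i).1) +
      ∑ k, ν (Function.update (fun i => (w i).1) k (T (w k))) := by
  rw [genForm, ContinuousAlternatingMap.add_apply, ContinuousAlternatingMap.smul_apply,
    ContinuousAlternatingMap.fderivCompContinuousLinearMap_apply]
  congr 1
  refine Finset.sum_congr rfl fun k _ => congrArg ν ?_
  funext j
  by_cases h : j = k
  · subst h; simp
  · simp [Function.update_of_ne h]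

theorem genForm_mem (ν : VM m [⋀^Fin m]→L[ℝ] ℝ) (p : ℝ) (T : VE m N →L[ℝ] VM m) :
    genForm ν p T ∈ forms₁ m (ContinuousLinearMap.fst ℝ (VM m) (VM N)) := by
  intro v i j hij hi hj
  have hi : (v i).1 = 0 := hi
  have hj : (v j).1 = 0 := hj
  rw [genForm_apply, Finset.sum_eq_zero, ν.map_coord_zero i hi]
  · simp
  · intro k _
    by_cases hk : k = i
    · refine ν.map_coord_zero j ?_
      rw [Function.update_of_ne (by rw [hk]; exact hij.symm), hj]
    · refine ν.map_coord_zero i ?_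
      rw [Function.update_of_ne (Ne.symm hk), hi]

theorem genForm_graphBasis (ν : VM m [⋀^Fin m]→L[ℝ] ℝ) (p : ℝ) (T : VE m N →L[ℝ] VM m)
    (A : J1Model m N) :
    genForm ν p T (graphBasis A) = (p + ∑ k, T (eb k, A (eb k)) k) * ν eb := by
  rw [genForm_apply]
  change p * ν eb + ∑ k, ν (Function.update eb k (T (eb k, A (eb k)))) = _
  simp only [vol_update, add_mul, Finset.sum_mul]

theorem genForm_update_vertical (ν : VM m [⋀^Fin m]→L[ℝ] ℝ) (p : ℝ) (T : VE m N →L[ℝ] VM m)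
    (A : J1Model m N) (k : Fin m) (z : VM N) :
    genForm ν p T (Function.update (graphBasis A) k (0, z)) = T (0, z) k * ν eb := by
  have h : (fun i => (Function.update (graphBasis A) k (0, z) i).1) = Function.update eb k 0 := by
    funext i
    by_cases h : i = k
    · subst h; simp
    · simp [Function.update_of_ne h, graphBasis]
  rw [genForm_apply, h, ν.map_coord_zero k (by simp), mul_zero, zero_add,
    Finset.sum_eq_single k]
  · rw [Function.update_idem, Function.update_self, vol_update]
  · intro l _ hl
    exact ν.map_coord_zero k (by rw [Function.update_of_ne (Ne.symm hl), Function.update_self])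
  · simp

/-- The coordinate space `(p, p^α_A)` of the multimomenta at a point. -/
abbrev PModel (m N : ℕ) := ℝ × (J1Model m N →L[ℝ] ℝ)

instance (m N : ℕ) : FiniteDimensional ℝ (MpiModel m N) :=
  inferInstanceAs (FiniteDimensional ℝ (forms₁ m (ContinuousLinearMap.fst ℝ (VM m) (VM N))))

instance (m N : ℕ) : FiniteDimensional ℝ (J1sModel m N) :=
  inferInstanceAs (FiniteDimensional ℝ (forms₁ m (ContinuousLinearMap.fst ℝ (VM m) (VM N)) ⧸
    forms₀ m (ContinuousLinearMap.fst ℝ (VM m) (VM N))))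

/-- The coordinates `p^α_A` of an `m`-form. -/
def momentumCoord : (VE m N [⋀^Fin m]→L[ℝ] ℝ) →ₗ[ℝ] (J1Model m N →L[ℝ] ℝ) where
  toFun ξ := ∑ k, (ξ.toContinuousMultilinearMap.toContinuousLinearMap (graphBasis 0) k).comp
    ((ContinuousLinearMap.inr ℝ (VM m) (VM N)).comp (ContinuousLinearMap.apply ℝ (VM N) (eb k)))
  map_add' ξ η := by
    ext a
    simp [sum_apply, Finset.sum_add_distrib]
  map_smul' r ξ := by
    ext a
    simp [sum_apply, Finset.mul_sum]

theorem momentumCoord_apply (ξ : VE m N [⋀^Fin m]→L[ℝ] ℝ) (a : J1Model m N) :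
    momentumCoord ξ a = ∑ k, ξ (Function.update (graphBasis 0) k (0, a (eb k))) := by
  simp only [momentumCoord, LinearMap.coe_mk, AddHom.coe_mk, sum_apply]
  rfl

theorem momentumCoord_tens (ξ : VE m N [⋀^Fin m]→L[ℝ] ℝ) (k : Fin m) (z : VM N) :
    momentumCoord ξ (tens k z) = ξ (Function.update (graphBasis 0) k (0, z)) := by
  rw [momentumCoord_apply, Finset.sum_eq_single k]
  · simp [tens_apply, eb_apply]
  · intro l _ hl
    refine ξ.map_coord_zero l ?_
    simp [tens_apply, eb_apply, Ne.symm hl]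
  · simp

/-- An element of the model of the multimomenta. -/
def MpiModel.mk (ξ : VE m N [⋀^Fin m]→L[ℝ] ℝ)
    (h : ξ ∈ forms₁ m (ContinuousLinearMap.fst ℝ (VM m) (VM N))) : MpiModel m N := ⟨ξ, h⟩

/-- The coordinates of a multimomentum. -/
def toPₗ (m N : ℕ) : MpiModel m N →ₗ[ℝ] PModel m N where
  toFun ξ := (ξ.1 (graphBasis 0), momentumCoord ξ.1)
  map_add' ξ η := by
    have h : (ξ + η).1 = ξ.1 + η.1 := rfl
    rw [h, map_add]; rfl
  map_smul' r ξ := by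
    have h : (r • ξ).1 = r • ξ.1 := rfl
    rw [h, map_smul]; rfl

/-- On the horizontal basis each slot `k` contributes the `k`-th component of `T (eb k, 0)`, so the
energy component acquires a trace. For the Legendre map this trace is the term `-v^A_α ∂£/∂v^A_α`.
-/
theorem genForm_coord (ν : VM m [⋀^Fin m]→L[ℝ] ℝ) (p : ℝ) (T : VE m N →L[ℝ] VM m)
    {π : J1Model m N →L[ℝ] ℝ} (hπ : ∀ k z, T (0, z) k = π (tens k z)) :
    toPₗ m N (.mk (genForm ν p T) (genForm_mem ν p T)) =
      ((p + ∑ k, T (eb k, 0) k) * ν eb, ν eb • π) := by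
  refine Prod.ext ?_ ?_
  · change genForm ν p T (graphBasis 0) = _
    rw [genForm_graphBasis]; simp
  · ext a
    change momentumCoord (genForm ν p T) a = _
    rw [momentumCoord_apply]
    simp only [genForm_update_vertical, hπ]
    rw [← Finset.sum_mul, ← map_sum, sum_tens]
    simp [mul_comm]

theorem exists_stdVol (m : ℕ) : ∃ ν : VM m [⋀^Fin m]→L[ℝ] ℝ, ν eb = 1 := by
  let b := (EuclideanSpace.basisFun (Fin m) ℝ).toBasis
  refine ⟨{ b.det with cont := ?_ }, ?_⟩
  · change Continuous fun v : Fin m → VM m => b.det v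
    simp only [b.det_apply]
    refine Continuous.matrix_det (continuous_pi fun i => continuous_pi fun j => ?_)
    exact (LinearMap.continuous_of_finiteDimensional (b.coord i)).comp (continuous_apply j)
  · have : (eb : Fin m → VM m) = b := by
      funext i; simp [b, eb]
    change b.det eb = 1
    rw [this, b.det_self]

/-- The linear map `T` with `T (0, z) k = π (dxᵏ ⊗ z)`. -/
def momentumMap (π : J1Model m N →L[ℝ] ℝ) : VE m N →L[ℝ] VM m :=
  ∑ a : Fin m, ((π.comp (ContinuousLinearMap.smulRightL ℝ (VM m) (VM N)
    (EuclideanSpace.proj a))).comp (ContinuousLinearMap.snd ℝ (VM m) (VM N))).smulRight (eb a)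

theorem momentumMap_apply (π : J1Model m N →L[ℝ] ℝ) (w : VE m N) (k : Fin m) :
    momentumMap π w k = π (tens k w.2) := by
  have h : momentumMap π w = ∑ a, π (tens a w.2) • eb a := by
    simp only [momentumMap, sum_apply]; rfl
  rw [h, show (∑ a, π (tens a w.2) • eb a : VM m) k = ∑ a, π (tens a w.2) * (eb a : VM m) k by
    simp [Finset.sum_apply]]
  simp [eb_apply]

theorem toPₗ_surjective (m N : ℕ) : Function.Surjective (toPₗ m N) := by
  rintro ⟨p, π⟩
  obtain ⟨ν, hν⟩ := exists_stdVol m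
  refine ⟨.mk (genForm ν p (momentumMap π)) (genForm_mem _ _ _), ?_⟩
  rw [genForm_coord ν p _ (π := π) (fun k z => momentumMap_apply π _ k), hν]
  simp [momentumMap_apply, tens_zero]

/-- An alternating form is determined by its values on families of distinct basis vectors. For a
form that vanishes on two vertical vectors only families with at most one vertical member matter,
and up to order these are the ones that the coordinates record. -/
theorem toPₗ_injective (m N : ℕ) : Function.Injective (toPₗ m N) := by
  rw [← LinearMap.ker_eq_bot, LinearMap.ker_eq_bot']
  rintro ⟨ξ, hξ⟩ h
  have h1 : ξ (graphBasis 0) = 0 := congrArg Prod.fst h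
  have h2 : ∀ k z, ξ (Function.update (graphBasis 0) k (0, z)) = 0 := fun k z => by
    rw [← momentumCoord_tens]
    exact congrArg (fun q : PModel m N => q.2 (tens k z)) h
  refine Subtype.ext ?_
  change ξ = 0
  let b₁ := (EuclideanSpace.basisFun (Fin m) ℝ).toBasis
  let b₂ := (EuclideanSpace.basisFun (Fin N) ℝ).toBasis
  have hb₁ : ∀ i, (b₁.prod b₂) (Sum.inl i) = graphBasis 0 i := fun i => by
    simp [b₁, graphBasis, eb]
  have hb₂ : ∀ i, ((b₁.prod b₂) (Sum.inr i)).1 = 0 := fun i => by simp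
  have key : ξ.toAlternatingMap = 0 := by
    refine Module.Basis.ext_alternating (b₁.prod b₂) fun v hv => ?_
    change ξ (fun i => (b₁.prod b₂) (v i)) = 0
    -- The cases are at least two, exactly one, or no vertical basis vectors in the family. They use
    -- the defining condition of `forms₁`, the momenta and the energy component, respectively.
    by_cases hex : ∃ k z, v k = Sum.inr z
    · obtain ⟨k, z, hk⟩ := hex
      by_cases hex2 : ∃ l, l ≠ k ∧ ∃ z', v l = Sum.inr z'
      · obtain ⟨l, hlk, z', hl⟩ := hex2
        refine hξ _ k l (Ne.symm hlk) ?_ ?_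
        · change ((b₁.prod b₂) (v k)).1 = 0
          rw [hk, hb₂]
        · change ((b₁.prod b₂) (v l)).1 = 0
          rw [hl, hb₂]
      · have h3 : ∀ l, l ≠ k → ∃ i, v l = Sum.inl i := by
          intro l hl
          rcases hvl : v l with i | z'
          · exact ⟨i, rfl⟩
          · exact absurd ⟨l, hl, z', hvl⟩ hex2
        choose τ hτ using h3
        -- The `m - 1` horizontal members use fewer than `m` indices, so some index `i₀` is free.
        -- The vertical vector takes the slot `i₀`.
        have hcard : (Finset.univ.image (fun l : {l // l ≠ k} => τ l.1 l.2)).card < m := by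
          refine lt_of_le_of_lt Finset.card_image_le ?_
          rw [Finset.card_univ, Fintype.card_subtype_compl, Fintype.card_subtype_eq,
            Fintype.card_fin]
          exact Nat.sub_lt (Nat.pos_of_ne_zero (fun h0 => by subst h0; exact k.elim0)) one_pos
        obtain ⟨i₀, hi₀⟩ : ∃ i₀, i₀ ∉ Finset.univ.image (fun l : {l // l ≠ k} => τ l.1 l.2) := by
          by_contra! hall
          have := Finset.eq_univ_iff_forall.2 hall
          rw [this, Finset.card_univ, Fintype.card_fin] at hcard
          exact lt_irrefl _ hcard
        let σ : Fin m → Fin m := fun l => if hl : l = k then i₀ else τ l hl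
        have hσk : σ k = i₀ := dif_pos rfl
        have hσ : ∀ l (hl : l ≠ k), σ l = τ l hl := fun l hl => dif_neg hl
        have hne : ∀ l, l ≠ k → σ l ≠ i₀ := fun l hl h => hi₀ (by
          rw [Finset.mem_image]
          exact ⟨⟨l, hl⟩, Finset.mem_univ _, by rw [← hσ l hl, h]⟩)
        have hinj : Function.Injective σ := by
          intro l l' hll
          by_cases hl : l = k
          · by_contra hne'
            subst hl
            exact hne l' (Ne.symm hne') (by rw [← hll, hσk])
          · by_cases hl' : l' = k
            · subst hl'
              exact absurd (by rw [hll, hσk]) (hne l hl)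
            · rw [hσ l hl, hσ l' hl'] at hll
              apply hv
              rw [hτ l hl, hτ l' hl', hll]
        let e : Equiv.Perm (Fin m) := Equiv.ofBijective σ (Finite.injective_iff_bijective.1 hinj)
        have hfam : (fun i => (b₁.prod b₂) (v i)) =
            Function.update (graphBasis 0) i₀ ((b₁.prod b₂) (Sum.inr z)) ∘ e := by
          funext l
          change _ = Function.update (graphBasis 0) i₀ ((b₁.prod b₂) (Sum.inr z)) (σ l)
          by_cases hl : l = k
          · subst hl
            rw [hσk, Function.update_self, hk]
          · rw [Function.update_of_ne (hne l hl), hτ l hl, hb₁, hσ l hl]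
        rw [hfam]
        have hp := ξ.toAlternatingMap.map_perm
          (Function.update (graphBasis 0) i₀ ((b₁.prod b₂) (Sum.inr z))) e
        refine hp.trans ?_
        have h4 : (b₁.prod b₂) (Sum.inr z) = (0, ((b₁.prod b₂) (Sum.inr z)).2) :=
          Prod.ext (hb₂ z) rfl
        have h5 := h2 i₀ ((b₁.prod b₂) (Sum.inr z)).2
        rw [← h4] at h5
        change _ • ξ _ = 0
        rw [h5, smul_zero]
    · have h3 : ∀ l, ∃ i, v l = Sum.inl i := by
        intro l
        rcases hvl : v l with i | z'
        · exact ⟨i, rfl⟩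
        · exact absurd ⟨l, z', hvl⟩ hex
      choose σ hσ using h3
      have hinj : Function.Injective σ := fun l l' hll => hv (by rw [hσ, hσ, hll])
      let e : Equiv.Perm (Fin m) := Equiv.ofBijective σ (Finite.injective_iff_bijective.1 hinj)
      have hfam : (fun i => (b₁.prod b₂) (v i)) = graphBasis 0 ∘ e := by
        funext l
        rw [hσ, hb₁]; rfl
      rw [hfam]
      refine (ξ.toAlternatingMap.map_perm (graphBasis 0) e).trans ?_
      change _ • ξ _ = 0
      rw [h1, smul_zero]
  ext w
  exact congrArg (fun η : VE m N [⋀^Fin m]→ₗ[ℝ] ℝ => η w) key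

/-- The coordinates of a multimomentum. -/
def toP (m N : ℕ) : MpiModel m N ≃L[ℝ] PModel m N :=
  (LinearEquiv.ofBijective (toPₗ m N) ⟨toPₗ_injective m N, toPₗ_surjective m N⟩).toContinuousLinearEquiv

theorem toP_genForm (ν : VM m [⋀^Fin m]→L[ℝ] ℝ) (p : ℝ) (T : VE m N →L[ℝ] VM m)
    {π : J1Model m N →L[ℝ] ℝ} (hπ : ∀ k z, T (0, z) k = π (tens k z)) :
    toP m N (.mk (genForm ν p T) (genForm_mem ν p T)) =
      ((p + ∑ k, T (eb k, 0) k) * ν eb, ν eb • π) := genForm_coord ν p T hπ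

/-- A multimomentum evaluated on the graph of a jet, with one vector replaced. -/
theorem toP_slot (ξ : MpiModel m N) (A : J1Model m N) (k : Fin m) (x : VM m) (z : VM N) :
    ξ.1 (Function.update (graphBasis A) k (x, z)) =
      x k * ((toP m N ξ).1 + (toP m N ξ).2 A) + (toP m N ξ).2 (tens k (z - A x)) := by
  obtain ⟨ν, hν⟩ := exists_stdVol m
  -- Every multimomentum is a `genForm` of the standard volume form, for which both sides are
  -- explicit.
  obtain ⟨⟨p, π⟩, rfl⟩ := (toP m N).symm.surjective ξ
  have hξ : (toP m N).symm (p, π) =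
      .mk (genForm ν p (momentumMap π)) (genForm_mem ν p (momentumMap π)) := by
    rw [ContinuousLinearEquiv.symm_apply_eq,
      toP_genForm ν p _ (π := π) (fun k z => momentumMap_apply π _ k), hν]
    simp [momentumMap_apply, tens_zero]
  rw [ContinuousLinearEquiv.apply_symm_apply, hξ]
  change genForm ν p (momentumMap π) _ = _
  rw [update_graphBasis, genForm_graphBasis,
    genForm_update_vertical, hν]
  simp only [momentumMap_apply, mul_one]
  rw [← map_sum, sum_tens]

theorem toP_graph (ξ : MpiModel m N) (A : J1Model m N) :
    ξ.1 (graphBasis A) = (toP m N ξ).1 + (toP m N ξ).2 A := by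
  obtain ⟨ν, hν⟩ := exists_stdVol m
  obtain ⟨⟨p, π⟩, rfl⟩ := (toP m N).symm.surjective ξ
  have hξ : (toP m N).symm (p, π) =
      .mk (genForm ν p (momentumMap π)) (genForm_mem ν p (momentumMap π)) := by
    rw [ContinuousLinearEquiv.symm_apply_eq,
      toP_genForm ν p _ (π := π) (fun k z => momentumMap_apply π _ k), hν]
    simp [momentumMap_apply, tens_zero]
  rw [ContinuousLinearEquiv.apply_symm_apply, hξ]
  change genForm ν p (momentumMap π) _ = _
  rw [genForm_graphBasis, hν]
  simp only [momentumMap_apply, mul_one]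
  rw [← map_sum, sum_tens]

/-- The forms that come from the base have no momenta. -/
theorem momentumCoord_forms₀ {ξ : forms₁ m (ContinuousLinearMap.fst ℝ (VM m) (VM N))}
    (h : ξ ∈ forms₀ m (ContinuousLinearMap.fst ℝ (VM m) (VM N))) : momentumCoord ξ.1 = 0 := by
  obtain ⟨β, hβ⟩ := mem_forms₀.1 h
  ext a
  rw [momentumCoord_apply, zero_apply]
  refine Finset.sum_eq_zero fun k _ => ?_
  rw [← hβ]
  exact β.map_coord_zero k (by simp)

/-- The momentum coordinates of an element of the quotient. -/
def toQ (m N : ℕ) : J1sModel m N →L[ℝ] (J1Model m N →L[ℝ] ℝ) :=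
  LinearMap.toContinuousLinearMap ((forms₀ m (ContinuousLinearMap.fst ℝ (VM m) (VM N))).liftQ
    (momentumCoord.comp (forms₁ m (ContinuousLinearMap.fst ℝ (VM m) (VM N))).subtype)
    fun _ hξ => momentumCoord_forms₀ hξ)

end multimomenta

/-! ### Tangent maps of natural coordinates on the three bundles. -/

namespace FibreSystem

variable {B : SmoothBundle m N M E F} {Fib : E → Type*}
    {V : Type*} [NormedAddCommGroup V] [NormedSpace ℝ V] (S : FibreSystem B Fib V)
variable [IsManifold 𝓘(ℝ, VM m) ∞ M] [IsManifold 𝓘(ℝ, VM N) ∞ F]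

theorem coord_fst (c : AdaptedChart B) (q : S.Tot) (h : q.1 ∈ c.chart.source) :
    (S.coord c q).1 = c.chart q.1 := by rw [S.coord_of_mem c q h]

theorem smoothAt_fst [IsManifold 𝓘(ℝ, VE m N) ∞ E] (q : S.Tot) :
    SmoothAt (VE m N × V) (VE m N) (fun q : S.Tot => q.1) q := S.contMDiff_fst q

theorem smoothAt_coord (c : AdaptedChart B) {q : S.Tot} (h : q.1 ∈ c.chart.source) :
    SmoothAt (VE m N × V) (VE m N × V) (fun q : S.Tot => S.coord c q) q :=
  (S.isSmoothChart_nat c q).at_source h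

theorem tg_coord_fst [IsManifold 𝓘(ℝ, VE m N) ∞ E] (c : AdaptedChart B) (q : S.Tot)
    (h : q.1 ∈ c.chart.source) (v : VE m N × V) :
    (tg (VE m N × V) (VE m N × V) (fun q : S.Tot => S.coord c q) q v).1 =
      c.lin q.1 h (tg (VE m N × V) (VE m N) (fun q : S.Tot => q.1) q v) := by
  have h1 := tg_comp (g := ContinuousLinearMap.fst ℝ (VE m N) V)
    (f := fun q : S.Tot => S.coord c q) (x := q)
    ((ContinuousLinearMap.fst ℝ (VE m N) V).contDiff.contMDiff _) (S.smoothAt_coord c h)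
  have hc : SmoothAt (VE m N) (VE m N) c.chart q.1 :=
    c.smooth.contMDiffAt (c.chart.open_source.mem_nhds h)
  have h2 := tg_comp (g := c.chart) (f := fun q : S.Tot => q.1) (x := q) hc (S.smoothAt_fst q)
  rw [tg_congr (g := fun q : S.Tot => c.chart q.1), h2, tg_clm] at h1
  · exact (congrArg (fun L : VE m N × V →L[ℝ] VE m N => L v) h1).symm
  · filter_upwards [S.eventually_mem c h] with q' hq' using S.coord_fst c q' hq'

end FibreSystem

namespace AdaptedChart

variable {B : SmoothBundle m N M E F} (c : AdaptedChart B)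

theorem isSmoothChart : IsSmoothChart (VE m N) c.chart := ⟨c.smooth, c.smooth_symm⟩

theorem isSmoothChart_base : IsSmoothChart (VM m) c.base := ⟨c.base_smooth, c.base_smooth_symm⟩

theorem blin_symm_eq (y : E) (hy : y ∈ c.chart.source) :
    ((c.blin y hy).symm : VM m →L[ℝ] VM m) =
      tg (VM m) (VM m) c.base.symm (c.base (B.proj y)) := by
  ext1 w
  apply (c.blin y hy).injective
  refine ((c.blin y hy).apply_symm_apply w).trans ?_
  exact (c.isSmoothChart_base.tg_tg_symm' (c.proj_mem y hy) w).symm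

end AdaptedChart

section naturalCharts

variable [IsManifold 𝓘(ℝ, VM m) ∞ M] [IsManifold 𝓘(ℝ, VM N) ∞ F]
  {B : SmoothBundle m N M E F} (c : AdaptedChart B)

/-- The natural coordinates of jets. -/
def jc (s : J1 B) : J1Space m N := (jetSystem B).coord c s

/-- The natural chart of the jet bundle. -/
def jetChart (s₀ : J1 B) : OpenPartialHomeomorph (J1 B) (J1Space m N) := (jetSystem B).nat c s₀

theorem isSmoothChart_jetChart (s₀ : J1 B) : IsSmoothChart (J1Space m N) (jetChart c s₀) :=
  (jetSystem B).isSmoothChart_nat c s₀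

theorem jetChart_apply (s₀ s : J1 B) : jetChart c s₀ s = jc c s := rfl

theorem jc_of_mem (s : J1 B) (h : s.1 ∈ c.chart.source) :
    jc c s = (c.chart s.1, jetTriv B c s.1 h s.2) := (jetSystem B).coord_of_mem c s h

theorem smoothAt_jc {s : J1 B} (h : s.1 ∈ c.chart.source) :
    SmoothAt (J1Space m N) (J1Space m N) (jc c) s := (jetSystem B).smoothAt_coord c h

/-- In adapted coordinates the plane of a jet is the graph of its jet coordinates. -/
theorem lin_jet (s : J1 B) (h : s.1 ∈ c.chart.source) (x : VM m) :
    c.lin s.1 h (s.2.1 x) = (c.blin s.1 h x, (jc c s).2 (c.blin s.1 h x)) := by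
  rw [jc_of_mem c s h]
  refine Prod.ext ?_ ?_
  · rw [c.fst_lin]
    have : B.dproj s.1 (s.2.1 x) = x := congrArg (fun L : VM m →L[ℝ] VM m => L x) s.2.2
    rw [this]
  · change _ = (c.lin s.1 h (s.2.1 ((c.blin s.1 h).symm (c.blin s.1 h x)))).2
    rw [ContinuousLinearEquiv.symm_apply_apply]

theorem smoothAt_jet_fst [IsManifold 𝓘(ℝ, VE m N) ∞ E] (s : J1 B) :
    SmoothAt (J1Space m N) (VE m N) (fun s : J1 B => s.1) s := (jetSystem B).smoothAt_fst s

theorem eventually_jet_mem {s : J1 B} (h : s.1 ∈ c.chart.source) :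
    ∀ᶠ s' : J1 B in 𝓝 s, s'.1 ∈ c.chart.source := (jetSystem B).eventually_mem c h

instance [T2Space E] : T2Space (J1 B) := (jetSystem B).t2Space

instance [SigmaCompactSpace E] : SigmaCompactSpace (J1 B) := (jetSystem B).sigmaCompact

instance [T2Space E] : T2Space (J1s B) := (momSystem B).t2Space

/-- The coordinate space of the extended multimomentum bundle. -/
abbrev PSpace (m N : ℕ) := VE m N × PModel m N

/-- The natural coordinates of multimomenta. -/
def mc (q : Mpi B) : PSpace m N :=
  (((mpiSystem B).coord c q).1, toP m N ((mpiSystem B).coord c q).2)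

/-- The natural chart of the extended multimomentum bundle. -/
def mpiChart (q₀ : Mpi B) : OpenPartialHomeomorph (Mpi B) (PSpace m N) :=
  (show OpenPartialHomeomorph (Mpi B) (MpiSpace m N) from (mpiSystem B).nat c q₀).transHomeomorph
    ((ContinuousLinearEquiv.refl ℝ (VE m N)).prodCongr (toP m N)).toHomeomorph

theorem isSmoothChart_mpiChart (q₀ : Mpi B) : IsSmoothChart (MpiSpace m N) (mpiChart c q₀) :=
  IsSmoothChart.trans_clm ((mpiSystem B).isSmoothChart_nat c q₀) _

theorem mc_of_mem (q : Mpi B) (h : q.1 ∈ c.chart.source) :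
    mc c q = (c.chart q.1, toP m N ((mpiSystem B).triv c q.1 h q.2)) := by
  rw [mc, (mpiSystem B).coord_of_mem c q h]

theorem smoothAt_mc {q : Mpi B} (h : q.1 ∈ c.chart.source) :
    SmoothAt (MpiSpace m N) (PSpace m N) (mc c) q :=
  (isSmoothChart_mpiChart c q).at_source h

theorem tg_mc_injective {q : Mpi B} (h : q.1 ∈ c.chart.source) :
    Function.Injective (tg (MpiSpace m N) (PSpace m N) (mc c) q) :=
  (isSmoothChart_mpiChart c q).tg_injective h

theorem smoothAt_mpi_fst [IsManifold 𝓘(ℝ, VE m N) ∞ E] (q : Mpi B) :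
    SmoothAt (MpiSpace m N) (VE m N) (fun q : Mpi B => q.1) q := (mpiSystem B).smoothAt_fst q

theorem eventually_mpi_mem {q : Mpi B} (h : q.1 ∈ c.chart.source) :
    ∀ᶠ q' : Mpi B in 𝓝 q, q'.1 ∈ c.chart.source := (mpiSystem B).eventually_mem c h

theorem tg_mc_fst [IsManifold 𝓘(ℝ, VE m N) ∞ E] (q : Mpi B) (h : q.1 ∈ c.chart.source)
    (v : MpiSpace m N) : (tg (MpiSpace m N) (PSpace m N) (mc c) q v).1 =
      c.lin q.1 h (tg (MpiSpace m N) (VE m N) (fun q : Mpi B => q.1) q v) := by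
  have h1 : SmoothAt (MpiSpace m N) (MpiSpace m N)
    (fun q : Mpi B => ((mpiSystem B).coord c q : MpiSpace m N)) q :=
    (mpiSystem B).smoothAt_coord c h
  let Λ : MpiSpace m N →L[ℝ] PSpace m N :=
    ((ContinuousLinearEquiv.refl ℝ (VE m N)).prodCongr (toP m N) : MpiSpace m N →L[ℝ] PSpace m N)
  have h2 := tg_comp (g := Λ) (f := fun q : Mpi B => ((mpiSystem B).coord c q : MpiSpace m N))
    (x := q) (Λ.contDiff.contMDiff _) h1
  have h3 : tg (MpiSpace m N) (PSpace m N) (mc c) q = Λ.comp (tg (MpiSpace m N) (MpiSpace m N)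
      (fun q : Mpi B => ((mpiSystem B).coord c q : MpiSpace m N)) q) := by
    rw [tg_clm] at h2; exact h2
  rw [h3]
  exact (mpiSystem B).tg_coord_fst c q h v

/-- The natural coordinates of the restricted multimomenta. -/
def rc (r : J1s B) : VE m N × (J1Model m N →L[ℝ] ℝ) :=
  (((momSystem B).coord c r).1, toQ m N ((momSystem B).coord c r).2)

theorem smoothAt_rc {r : J1s B} (h : r.1 ∈ c.chart.source) :
    SmoothAt (J1sSpace m N) (VE m N × (J1Model m N →L[ℝ] ℝ)) (rc c) r := by
  have h1 : SmoothAt (J1sSpace m N) (J1sSpace m N)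
    (fun q : J1s B => ((momSystem B).coord c q : J1sSpace m N)) r :=
    (momSystem B).smoothAt_coord c h
  exact SmoothAt.comp_of_eq (g := (ContinuousLinearMap.id ℝ (VE m N)).prodMap (toQ m N)) rfl
    (((ContinuousLinearMap.id ℝ (VE m N)).prodMap (toQ m N)).contDiff.contMDiff _) h1

theorem rc_mu (q : Mpi B) (h : q.1 ∈ c.chart.source) :
    rc c (mu B q) = ((mc c q).1, (mc c q).2.2) := by
  have h' : (mu B q).1 ∈ c.chart.source := h
  rw [rc, mc_of_mem c q h, (momSystem B).coord_of_mem c (mu B q) h']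
  rfl

theorem smoothAt_mu (q : Mpi B) : SmoothAt (MpiSpace m N) (J1sSpace m N) (mu B) q := by
  obtain ⟨c, hc⟩ := exists_adaptedChart B q.1
  have h1 : SmoothAt (MpiSpace m N) (MpiSpace m N)
    (fun q : Mpi B => ((mpiSystem B).coord c q : MpiSpace m N)) q :=
    (mpiSystem B).smoothAt_coord c hc
  let mk : MpiModel m N →L[ℝ] J1sModel m N := LinearMap.toContinuousLinearMap
    (forms₀ m (ContinuousLinearMap.fst ℝ (VM m) (VM N))).mkQ
  have h2 : SmoothAt (MpiSpace m N) (J1sSpace m N)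
      (fun q : Mpi B => (ContinuousLinearMap.id ℝ (VE m N)).prodMap mk
        ((mpiSystem B).coord c q : MpiSpace m N)) q :=
    SmoothAt.comp_of_eq rfl (((ContinuousLinearMap.id ℝ (VE m N)).prodMap mk).contDiff.contMDiff _) h1
  have h3 : IsSmoothChart (J1sSpace m N) (X := J1s B) ((momSystem B).nat c (mu B q)) :=
    (momSystem B).isSmoothChart_nat c _
  refine IsSmoothChart.smoothAt_of_chart h3 (eventually_mpi_mem c hc) ?_
  refine ContMDiffAt.congr_of_eventuallyEq h2 ?_
  filter_upwards [eventually_mpi_mem c hc] with q' hq'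
  have h' : (mu B q').1 ∈ c.chart.source := hq'
  change (momSystem B).coord c (mu B q') = _
  rw [(momSystem B).coord_of_mem c (mu B q') h', (mpiSystem B).coord_of_mem c q' hq']
  rfl

/-- In coordinates `μ` forgets the energy component and keeps everything else. What it loses has to
be recovered from `fderiv_leg_energy` or from the field equation. -/
theorem tg_rc_mu (q : Mpi B) (h : q.1 ∈ c.chart.source) (v : MpiSpace m N) :
    tg (J1sSpace m N) (VE m N × (J1Model m N →L[ℝ] ℝ)) (rc c) (mu B q)
      (tg (MpiSpace m N) (J1sSpace m N) (mu B) q v) =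
      ((tg (MpiSpace m N) (PSpace m N) (mc c) q v).1,
        (tg (MpiSpace m N) (PSpace m N) (mc c) q v).2.2) := by
  have h1 := tg_comp (g := rc c) (f := mu B) (x := q) (smoothAt_rc c h) (smoothAt_mu q)
  let Λ : PSpace m N →L[ℝ] VE m N × (J1Model m N →L[ℝ] ℝ) :=
    (ContinuousLinearMap.id ℝ (VE m N)).prodMap (ContinuousLinearMap.snd ℝ ℝ _)
  have h2 := tg_comp (g := Λ) (f := mc c) (x := q) (Λ.contDiff.contMDiff _) (smoothAt_mc c h)
  rw [tg_congr (g := fun q => Λ (mc c q)), h2, tg_clm] at h1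
  · exact (congrArg (fun L : MpiSpace m N →L[ℝ] VE m N × (J1Model m N →L[ℝ] ℝ) => L v) h1).symm
  · filter_upwards [eventually_mpi_mem c h] with q' hq' using rc_mu c q' hq'

end naturalCharts

/-- Expanding the form in a fixed basis leaves smooth coefficients times fixed multilinear maps. -/
theorem contDiffAt_alternating_apply {k : ℕ} {X V : Type*} [NormedAddCommGroup X] [NormedSpace ℝ X]
    [NormedAddCommGroup V] [NormedSpace ℝ V] [FiniteDimensional ℝ V]
    {η : X → V [⋀^Fin k]→L[ℝ] ℝ} {w : X → Fin k → V} {x : X}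
    (hη : ContDiffAt ℝ ∞ η x) (hw : ∀ i, ContDiffAt ℝ ∞ (fun x => w x i) x) :
    ContDiffAt ℝ ∞ (fun x => η x (w x)) x := by
  let b := Module.finBasis ℝ (V [⋀^Fin k]→L[ℝ] ℝ)
  have h2 : (fun x => η x (w x)) = fun x => ∑ l, b.coord l (η x) * b l (w x) := by
    ext x
    let ev : (V [⋀^Fin k]→L[ℝ] ℝ) →ₗ[ℝ] ℝ :=
      { toFun := fun ζ => ζ (w x)
        map_add' := fun _ _ => rfl
        map_smul' := fun _ _ => rfl }
    have := congrArg ev (b.sum_repr (η x))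
    rw [map_sum] at this
    refine this.symm.trans (Finset.sum_congr rfl fun k _ => ?_)
    rw [map_smul]
    rfl
  rw [h2]
  refine ContDiffAt.sum fun l _ => ContDiffAt.mul ?_ ?_
  · exact ((b.coord l).toContinuousLinearMap.contDiff).contDiffAt.comp x hη
  · have hm : ContDiff ℝ ∞ (fun u : Fin k → V => b l u) :=
      (b l).toContinuousMultilinearMap.contDiff
    exact hm.contDiffAt.comp x (contDiffAt_pi.2 hw)

/-! ### The volume form, the Lagrangian and the Legendre map in natural coordinates. -/

namespace LagrangianSystem

variable [IsManifold 𝓘(ℝ, VM m) ∞ M] [IsManifold 𝓘(ℝ, VM N) ∞ F]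
  (L : LagrangianSystem m N M E F) (c : AdaptedChart L.bundle)

/-- The volume form at a point, on the model space. -/
def volAt (x : M) : VM m [⋀^Fin m]→L[ℝ] ℝ := L.vol x

/-- The volume form in the base coordinates. -/
def volC (b : VM m) : VM m [⋀^Fin m]→L[ℝ] ℝ :=
  (L.volAt (c.base.symm b)).compContinuousLinearMap
    (tg (VM m) (VM m) c.base.symm b)

/-- The density of the volume form. -/
def density (b : VM m) : ℝ := L.volC c b eb

theorem eq_zero_of_apply_eb {ν : VM m [⋀^Fin m]→L[ℝ] ℝ} (h : ν eb = 0) : ν = 0 := by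
  let b := (EuclideanSpace.basisFun (Fin m) ℝ).toBasis
  have hb : (b : Fin m → VM m) = eb := by
    funext i; simp [b, eb]
  have h1 := (ν.toAlternatingMap).eq_smul_basis_det b
  have h2 : ν.toAlternatingMap b = 0 := by rw [hb]; exact h
  rw [h2, zero_smul] at h1
  ext w
  exact congrArg (fun η : VM m [⋀^Fin m]→ₗ[ℝ] ℝ => η w) h1

theorem density_ne_zero {b : VM m} (hb : b ∈ c.base.target) : L.density c b ≠ 0 := by
  intro h
  have h1 := eq_zero_of_apply_eb h
  refine L.vol_ne_zero (c.base.symm b) ?_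
  ext w
  have h2 : ∀ i, tg (VM m) (VM m) c.base.symm b
      (tg (VM m) (VM m) c.base (c.base.symm b) (w i)) = w i := fun i => by
    have := c.isSmoothChart_base.tg_symm_tg (c.base.map_target hb) (w i)
    rwa [c.base.right_inv hb] at this
  have h3 := congrArg (fun ν : VM m [⋀^Fin m]→L[ℝ] ℝ =>
    ν fun i => tg (VM m) (VM m) c.base (c.base.symm b) (w i)) h1
  change L.volAt (c.base.symm b)
    (fun i => tg (VM m) (VM m) c.base.symm b
      (tg (VM m) (VM m) c.base (c.base.symm b) (w i))) = 0 at h3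
  simp only [h2] at h3
  exact h3

/-- Smoothness of the volume form is given in preferred charts only, so the density is computed
through the transition map `g` from the adapted base chart to a preferred one. -/
theorem contDiffAt_density {b : VM m} (hb : b ∈ c.base.target) :
    ContDiffAt ℝ ∞ (L.density c) b := by
  set x₀ := c.base.symm b with hx₀
  let κ := chartAt (VM m) x₀
  have hκ : IsSmoothChart (VM m) κ := .chartAt x₀
  have hx : x₀ ∈ κ.source := mem_chart_source _ x₀
  let g : VM m → VM m := fun b => κ (c.base.symm b)
  have hev : ∀ᶠ b' in 𝓝 b, b' ∈ c.base.target ∧ c.base.symm b' ∈ κ.source :=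
    Filter.Eventually.and (c.base.open_target.mem_nhds hb)
      ((c.base.symm.continuousAt hb).preimage_mem_nhds (κ.open_source.mem_nhds hx))
  have hg : ContDiffAt ℝ ∞ g b := contMDiffAt_iff_contDiffAt.1
    (SmoothAt.comp_of_eq hx₀.symm (hκ.at_source hx) (c.isSmoothChart_base.at_target hb))
  have hloc : ContDiffAt ℝ ∞ (fun b => L.vol.loc x₀ (g b)) b :=
    ContDiffAt.comp (g := fun a : VM m => (L.vol.loc x₀ a : VM m [⋀^Fin m]→L[ℝ] ℝ)) b
      ((L.vol_smooth x₀).contDiffAt (κ.open_target.mem_nhds (κ.map_source hx))) hg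
  have hdg : ContDiffAt ℝ ∞ (fderiv ℝ g) b := hg.fderiv_right (by simp)
  have hsm : ContDiffAt ℝ ∞ (fun b => L.vol.loc x₀ (g b) (fun i => fderiv ℝ g b (eb i))) b :=
    contDiffAt_alternating_apply hloc fun i => hdg.clm_apply contDiffAt_const
  refine hsm.congr_of_eventuallyEq ?_
  filter_upwards [hev] with b' hb'
  have h1 : fderiv ℝ g b' = (tg (VM m) (VM m) κ (c.base.symm b')).comp
      (tg (VM m) (VM m) c.base.symm b') := by
    rw [← tg_eq_fderiv]
    exact tg_comp (hκ.at_source hb'.2) (c.isSmoothChart_base.at_target hb'.1)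
  have h2 : ∀ i, tg (VM m) (VM m) κ.symm (g b') (fderiv ℝ g b' (eb i)) =
      tg (VM m) (VM m) c.base.symm b' (eb i) := fun i => by
    rw [h1]
    exact hκ.tg_symm_tg hb'.2 _
  change L.volAt (c.base.symm b')
      (fun i => tg (VM m) (VM m) c.base.symm b' (eb i)) =
    L.volAt (κ.symm (g b'))
      (fun i => tg (VM m) (VM m) κ.symm (g b') (fderiv ℝ g b' (eb i)))
  simp only [h2]
  have h3 : κ.symm (g b') = c.base.symm b' := κ.left_inv hb'.2
  rw [h3]

/-- The Lagrangian function in natural coordinates; `s₀` is a value outside of the domain. -/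
def lagC (s₀ : J1 L.bundle) (p : J1Space m N) : ℝ := L.lag ((jetChart c s₀).symm p)

/-- The Lagrangian density in natural coordinates. -/
def lam (s₀ : J1 L.bundle) (p : J1Space m N) : ℝ := L.density c p.1.1 * L.lagC c s₀ p

theorem contDiffAt_lagC (s₀ : J1 L.bundle) {p : J1Space m N} (hp : p.1 ∈ c.chart.target) :
    ContDiffAt ℝ ∞ (L.lagC c s₀) p :=
  contMDiffAt_iff_contDiffAt.1 (SmoothAt.comp_of_eq (g := L.lag) rfl (L.lag_smooth _)
    ((isSmoothChart_jetChart c s₀).at_target hp))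

theorem fst_mem_target {a : VE m N} (ha : a ∈ c.chart.target) : a.1 ∈ c.base.target := by
  have h1 := c.fst_eq _ (c.chart.map_target ha)
  rw [c.chart.right_inv ha] at h1
  rw [h1]
  exact c.base.map_source (c.proj_mem _ (c.chart.map_target ha))

theorem contDiffAt_lam (s₀ : J1 L.bundle) {p : J1Space m N} (hp : p.1 ∈ c.chart.target) :
    ContDiffAt ℝ ∞ (L.lam c s₀) p := by
  have h1 : ContDiffAt ℝ ∞ (fun p : J1Space m N => L.density c p.1.1) p :=
    (L.contDiffAt_density c (L.fst_mem_target c hp)).comp p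
      (contDiff_fst.comp contDiff_fst).contDiffAt
  exact h1.mul (L.contDiffAt_lagC c s₀ hp)

/-- The derivative with respect to the jet coordinates. -/
def dv (f : J1Space m N → ℝ) (p : J1Space m N) : J1Model m N →L[ℝ] ℝ :=
  (fderiv ℝ f p).comp (ContinuousLinearMap.inr ℝ (VE m N) (J1Model m N))

theorem dv_apply (f : J1Space m N → ℝ) (p : J1Space m N) (a : J1Model m N) :
    dv f p a = fderiv ℝ f p (0, a) := rfl

/-- The density depends on the base point alone, so it is a constant factor for derivatives in the
jet coordinates. -/
theorem dv_lam (s₀ : J1 L.bundle) {p : J1Space m N} (hp : p.1 ∈ c.chart.target) :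
    dv (L.lam c s₀) p = L.density c p.1.1 • dv (L.lagC c s₀) p := by
  have h1 : DifferentiableAt ℝ (fun p : J1Space m N => L.density c p.1.1) p :=
    ((L.contDiffAt_density c (L.fst_mem_target c hp)).comp p
      (contDiff_fst.comp contDiff_fst).contDiffAt).differentiableAt (by simp)
  have h2 : DifferentiableAt ℝ (L.lagC c s₀) p :=
    (L.contDiffAt_lagC c s₀ hp).differentiableAt (by simp)
  have h3 : ∀ a : J1Model m N, fderiv ℝ (fun p : J1Space m N => L.density c p.1.1) p (0, a) = 0 := by
    intro a
    have h4 : (fun p : J1Space m N => L.density c p.1.1) =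
      L.density c ∘ (fun p : J1Space m N => p.1.1) := rfl
    rw [h4, fderiv_comp p ((L.contDiffAt_density c (L.fst_mem_target c hp)).differentiableAt
      (by simp)) (by fun_prop)]
    have h5 : fderiv ℝ (fun p : J1Space m N => p.1.1) p =
        (ContinuousLinearMap.fst ℝ (VM m) (VM N)).comp
          (ContinuousLinearMap.fst ℝ (VE m N) (J1Model m N)) :=
      ((ContinuousLinearMap.fst ℝ (VM m) (VM N)).comp
          (ContinuousLinearMap.fst ℝ (VE m N) (J1Model m N))).fderiv
    rw [h5]
    simp
  ext a
  have h6 := fderiv_mul h1 h2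
  rw [dv_apply, show L.lam c s₀ = (fun p : J1Space m N => L.density c p.1.1) * L.lagC c s₀ from rfl,
    h6]
  simp [h3, dv_apply]

/-- Only the part of `A` that is vertical relative to the jet moves the jet; in coordinates it is `z
- v x` for a vector `(x, z)`. The coordinates are therefore affine in `A`. -/
theorem jc_shift (s : J1 L.bundle) (h : s.1 ∈ c.chart.source) (A : VM m →L[ℝ] VE m N) :
    jc c (L.shift s A) = jc c s + (0, (ContinuousLinearMap.snd ℝ (VM m) (VM N) -
      (jc c s).2.comp (ContinuousLinearMap.fst ℝ (VM m) (VM N))).comp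
        ((c.lin s.1 h : VE m N →L[ℝ] VE m N).comp
          (A.comp ((c.blin s.1 h).symm : VM m →L[ℝ] VM m)))) := by
  have h' : (L.shift s A).1 ∈ c.chart.source := h
  have h0 := jc_of_mem c s h
  rw [jc_of_mem c (L.shift s A) h']
  refine Prod.ext (by rw [h0]; simp [shift]) ?_
  ext1 x
  change (c.lin s.1 h (s.2.1 ((c.blin s.1 h).symm x) + (A ((c.blin s.1 h).symm x) -
    s.2.1 (L.bundle.dproj s.1 (A ((c.blin s.1 h).symm x)))))).2 = _
  rw [map_add, map_sub, lin_jet, lin_jet, ← c.fst_lin, ContinuousLinearEquiv.apply_symm_apply]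
  simp

/-- By `jc_shift` the shift is affine in coordinates, so the chain rule gives the derivative of the
coordinate Lagrangian composed with its linear part. -/
theorem fibreDeriv_apply (s : J1 L.bundle) (h : s.1 ∈ c.chart.source) (s₀ : J1 L.bundle)
    (A : VM m →L[ℝ] VE m N) :
    L.fibreDeriv s A = dv (L.lagC c s₀) (jc c s) ((ContinuousLinearMap.snd ℝ (VM m) (VM N) -
      (jc c s).2.comp (ContinuousLinearMap.fst ℝ (VM m) (VM N))).comp
        ((c.lin s.1 h : VE m N →L[ℝ] VE m N).comp
          (A.comp ((c.blin s.1 h).symm : VM m →L[ℝ] VM m)))) := by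
  set P := ContinuousLinearMap.snd ℝ (VM m) (VM N) -
      (jc c s).2.comp (ContinuousLinearMap.fst ℝ (VM m) (VM N)) with hP
  let Q : (VM m →L[ℝ] VE m N) →L[ℝ] J1Space m N :=
    (ContinuousLinearMap.inr ℝ (VE m N) (J1Model m N)).comp
      ((ContinuousLinearMap.compL ℝ (VM m) (VE m N) (VM N)
        (P.comp (c.lin s.1 h : VE m N →L[ℝ] VE m N))).comp
      ((ContinuousLinearMap.compL ℝ (VM m) (VM m) (VE m N)).flip
        ((c.blin s.1 h).symm : VM m →L[ℝ] VM m)))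
  have hQ : ∀ A, Q A = (0, P.comp ((c.lin s.1 h : VE m N →L[ℝ] VE m N).comp
          (A.comp ((c.blin s.1 h).symm : VM m →L[ℝ] VM m)))) := fun A => rfl
  have h1 : (fun A => L.lag (L.shift s A)) = fun A => L.lagC c s₀ (jc c s + Q A) := by
    funext A
    have h' : (L.shift s A) ∈ (jetChart c s₀).source := h
    rw [hQ, ← L.jc_shift c s h A, lagC, ← jetChart_apply c s₀, (jetChart c s₀).left_inv h']
  have hp : (jc c s).1 ∈ c.chart.target := by
    rw [jc_of_mem c s h]; exact c.chart.map_source h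
  have h2 : HasFDerivAt (L.lagC c s₀) (fderiv ℝ (L.lagC c s₀) (jc c s)) (jc c s + Q 0) := by
    rw [map_zero, add_zero]
    exact ((L.contDiffAt_lagC c s₀ hp).differentiableAt (by simp)).hasFDerivAt
  have h3 : HasFDerivAt (fun A => jc c s + Q A) Q 0 := Q.hasFDerivAt.const_add _
  rw [fibreDeriv, h1]
  exact congrArg (fun T : (VM m →L[ℝ] VE m N) →L[ℝ] ℝ => T A) (h2.comp 0 h3).fderiv

/-- `momentum` is defined by its components in the standard basis; this characterization by
arbitrary covectors allows evaluation on the coordinate covectors of an adapted chart. -/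
theorem apply_momentum (s : J1 L.bundle) (α : VM m →L[ℝ] ℝ) (w : VE m N) :
    α (L.momentum s w) = L.fibreDeriv s (α.smulRight w) := by
  have h1 : L.momentum s w = ∑ a, L.fibreDeriv s ((EuclideanSpace.proj a).smulRight w) • eb a := by
    simp only [momentum, sum_apply]; rfl
  have h2 : α.smulRight w = ∑ a, α (eb a) • (EuclideanSpace.proj a : VM m →L[ℝ] ℝ).smulRight w := by
    ext1 x
    rw [sum_apply, ContinuousLinearMap.smulRight_apply]
    conv_lhs => rw [← sum_eb x, map_sum, Finset.sum_smul]
    refine Finset.sum_congr rfl fun a _ => ?_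
    simp [smul_smul, mul_comm]
  rw [h1, h2, map_sum, map_sum]
  refine Finset.sum_congr rfl fun a _ => ?_
  rw [map_smul, map_smul, smul_eq_mul, smul_eq_mul, mul_comm]

/-- The extended Legendre map in natural coordinates. -/
theorem mc_FLt (s : J1 L.bundle) (h : s.1 ∈ c.chart.source) (s₀ : J1 L.bundle) :
    mc c (L.FLt s) = ((jc c s).1, (L.lam c s₀ (jc c s) - dv (L.lam c s₀) (jc c s) (jc c s).2,
      dv (L.lam c s₀) (jc c s))) := by
  have h' : (L.FLt s).1 ∈ c.chart.source := h
  have hp : (jc c s).1 ∈ c.chart.target := by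
    rw [jc_of_mem c s h]; exact c.chart.map_source h
  have hp1 : (jc c s).1.1 = c.base (L.bundle.proj s.1) := by
    rw [jc_of_mem c s h]; exact c.fst_eq _ h
  rw [mc_of_mem c (L.FLt s) h']
  refine Prod.ext (by rw [jc_of_mem c s h]; rfl) ?_
  let T : VE m N →L[ℝ] VM m := (c.blin s.1 h : VM m →L[ℝ] VM m).comp ((L.momentum s).comp
    ((c.lin s.1 h).symm : VE m N →L[ℝ] VE m N))
  set b := (jc c s).1.1 with hb
  set v := (jc c s).2 with hv
  have hT : ∀ w k, T w k = dv (L.lagC c s₀) (jc c s) (tens k (w.2 - v w.1)) := by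
    intro w k
    have h1 := L.apply_momentum s
      ((EuclideanSpace.proj k).comp (c.blin s.1 h : VM m →L[ℝ] VM m)) ((c.lin s.1 h).symm w)
    refine Eq.trans h1 ?_
    rw [L.fibreDeriv_apply c s h s₀]
    congr 1
    ext1 x
    simp [tens_apply, hv, smul_sub]
  have hlag : L.lagC c s₀ (jc c s) = L.lag s := by
    rw [lagC, ← jetChart_apply c s₀, (jetChart c s₀).left_inv h]
  have hvol : ∀ w : Fin m → VM m, L.volC c b w =
      L.volAt (L.bundle.proj s.1)
        fun i => (c.blin s.1 h).symm (w i) := by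
    intro w
    have e1 : c.base.symm b = L.bundle.proj s.1 := by
      rw [hp1, c.base.left_inv (c.proj_mem _ h)]
    have e2 : ∀ u, tg (VM m) (VM m) c.base.symm b u = (c.blin s.1 h).symm u := by
      intro u
      rw [hp1]
      exact (congrArg (fun L : VM m →L[ℝ] VM m => L u) (c.blin_symm_eq s.1 h)).symm
    change L.volAt (c.base.symm b)
      (fun i => tg (VM m) (VM m) c.base.symm b (w i)) = _
    simp only [e2, e1]
  -- Transport by the chart preserves the shape of the form: volume form, tangent projection and
  -- momentum map are each replaced by their coordinate expressions.
  have hform : ((mpiSystem L.bundle).triv c s.1 h (L.FLt s).2 : MpiModel m N) =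
      .mk (genForm (L.volC c b) (L.lagC c s₀ (jc c s)) T) (genForm_mem _ _ _) := by
    refine Subtype.ext ?_
    ext w
    change (L.FLt s).2.1 (fun i => (c.lin s.1 h).symm (w i)) = genForm (L.volC c b) _ T w
    have hd : ∀ i, L.bundle.dproj s.1 ((c.lin s.1 h).symm (w i)) = (c.blin s.1 h).symm (w i).1 := by
      intro i
      rw [ContinuousLinearEquiv.eq_symm_apply, ← c.fst_lin, ContinuousLinearEquiv.apply_symm_apply]
    rw [genForm_apply, hlag, FLt]
    simp only [ContinuousAlternatingMap.add_apply, ContinuousAlternatingMap.smul_apply,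
      smul_eq_mul, hvol]
    congr 1
    · congr 1
      change L.volAt (L.bundle.proj s.1)
        (fun i => L.bundle.dproj s.1 ((c.lin s.1 h).symm (w i))) = _
      simp only [hd]
    · refine (ContinuousAlternatingMap.fderivCompContinuousLinearMap_apply
        (f := L.volAt (L.bundle.proj s.1)) _ _ _).trans ?_
      refine Finset.sum_congr rfl fun k _ => congrArg (L.volAt (L.bundle.proj s.1)) ?_
      funext j
      by_cases hj : j = k
      · subst hj
        simp [T]
      · simp [Function.update_of_ne hj, hd]
  change toP m N ((mpiSystem L.bundle).triv c s.1 h (L.FLt s).2) = _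
  rw [hform, toP_genForm (π := dv (L.lagC c s₀) (jc c s)) _ _ _ (fun k z => by rw [hT]; simp),
    L.dv_lam c s₀ hp]
  refine Prod.ext ?_ rfl
  simp only [hT, zero_sub]
  -- The trace of the momentum map over the horizontal basis: the vertical part of `(eb k, 0)`
  -- relative to the jet is `-v (eb k)`.
  have h5 : ∑ k, dv (L.lagC c s₀) (jc c s) (tens k (-(v (eb k)))) =
      - dv (L.lagC c s₀) (jc c s) v := by
    rw [← map_sum]
    conv_rhs => rw [← sum_tens v, ← map_neg, ← Finset.sum_neg_distrib]
    congr 1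
    refine Finset.sum_congr rfl fun k _ => ?_
    ext1 x
    simp [tens_apply]
  rw [h5]
  change _ * L.density c b = L.density c b * _ - (L.density c b • dv (L.lagC c s₀) (jc c s)) v
  rw [smul_apply, smul_eq_mul]
  ring

end LagrangianSystem

/-! ### The Legendre map of a function of jets -/

namespace LagrangianSystem

theorem minSmoothness_two_le : minSmoothness ℝ 2 ≤ ∞ := by
  rw [minSmoothness_of_isRCLikeNormedField]
  exact WithTop.coe_le_coe.2 (le_top : (2 : ℕ∞) ≤ ⊤)

/-- The extended Legendre map in coordinates. -/
def leg (f : J1Space m N → ℝ) (p : J1Space m N) : PSpace m N :=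
  (p.1, (f p - dv f p p.2, dv f p))

section localCalculus

variable {f : J1Space m N → ℝ} {p : J1Space m N} (hf : ContDiffAt ℝ ∞ f p)
include hf

theorem contDiffAt_dv : ContDiffAt ℝ ∞ (dv f) p :=
  (hf.fderiv_right (m := ∞) (by simp)).clm_comp contDiffAt_const

theorem contDiffAt_leg : ContDiffAt ℝ ∞ (leg f) p := by
  have h := contDiffAt_dv hf
  exact contDiffAt_fst.prodMk ((hf.sub (h.clm_apply contDiffAt_snd)).prodMk h)

theorem fderiv_leg_fst (w : J1Space m N) : (fderiv ℝ (leg f) p w).1 = w.1 := by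
  have h := ((contDiffAt_leg hf).differentiableAt (by simp)).hasFDerivAt.fst
  have h2 : HasFDerivAt (fun p => (leg f p).1) (ContinuousLinearMap.fst ℝ (VE m N) (J1Model m N)) p :=
    hasFDerivAt_fst
  exact congrArg (fun T : J1Space m N →L[ℝ] VE m N => T w) (h.unique h2)

theorem hasFDerivAt_dv : HasFDerivAt (dv f)
    (((ContinuousLinearMap.compL ℝ (J1Model m N) (J1Space m N) ℝ).flip
      (ContinuousLinearMap.inr ℝ (VE m N) (J1Model m N))).comp (fderiv ℝ (fderiv ℝ f) p)) p := by
  have h1 : HasFDerivAt (fderiv ℝ f) (fderiv ℝ (fderiv ℝ f) p) p :=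
    ((hf.fderiv_right (m := ∞) (by simp)).differentiableAt (by simp)).hasFDerivAt
  exact (((ContinuousLinearMap.compL ℝ (J1Model m N) (J1Space m N) ℝ).flip
      (ContinuousLinearMap.inr ℝ (VE m N) (J1Model m N))).hasFDerivAt).comp p h1

theorem fderiv_leg_momentum (w : J1Space m N) (a : J1Model m N) :
    (fderiv ℝ (leg f) p w).2.2 a = fderiv ℝ (fderiv ℝ f) p w (0, a) := by
  have h := ((contDiffAt_leg hf).differentiableAt (by simp)).hasFDerivAt.snd.snd
  exact congrArg (fun T : J1Space m N →L[ℝ] J1Model m N →L[ℝ] ℝ => T w a)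
    (h.unique (hasFDerivAt_dv hf))

/-- Differentiate `p + π v = f`: the term `π(dv)` cancels the derivative of `f` in the jet
directions. Only the derivative along `E` is left. -/
theorem fderiv_leg_energy (w : J1Space m N) :
    (fderiv ℝ (leg f) p w).2.1 + (fderiv ℝ (leg f) p w).2.2 p.2 = fderiv ℝ f p (w.1, 0) := by
  have h := ((contDiffAt_leg hf).differentiableAt (by simp)).hasFDerivAt.snd.fst
  have h1 : HasFDerivAt (fun p => (leg f p).2.1) _ p :=
    (hf.differentiableAt (by simp)).hasFDerivAt.sub ((hasFDerivAt_dv hf).clm_apply hasFDerivAt_snd)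
  have h2 := congrArg (fun T : J1Space m N →L[ℝ] ℝ => T w) (h.unique h1)
  have h3 : (fderiv ℝ (leg f) p w).2.1 = fderiv ℝ f p w -
      (dv f p w.2 + fderiv ℝ (fderiv ℝ f) p w (0, p.2)) := h2
  have h4 : fderiv ℝ f p (w.1, 0) = fderiv ℝ f p w - dv f p w.2 := by
    have h5 : ((w.1, 0) : J1Space m N) = w - (0, w.2) := Prod.ext (by simp) (by simp)
    rw [dv_apply, h5, map_sub]
  rw [h3, fderiv_leg_momentum hf, h4]
  ring

/-- If base and momentum components vanish, the energy identity makes the energy component vanish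
too. Hence forgetting the energy does not enlarge the tangent kernel. -/
theorem fderiv_leg_eq_zero {w : J1Space m N} (h1 : (fderiv ℝ (leg f) p w).1 = 0)
    (h2 : (fderiv ℝ (leg f) p w).2.2 = 0) : fderiv ℝ (leg f) p w = 0 := by
  have h3 := fderiv_leg_energy hf w
  rw [fderiv_leg_fst hf] at h1
  rw [h2, h1, zero_apply, add_zero, Prod.mk_zero_zero, map_zero] at h3
  refine Prod.ext (by rw [fderiv_leg_fst hf, h1]; rfl) (Prod.ext h3 h2)

/-- On vertical vectors the momentum component is the Hessian in the jet coordinates, and second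
derivatives are symmetric. -/
theorem fderiv_leg_symm (u a : J1Model m N) :
    (fderiv ℝ (leg f) p (0, u)).2.2 a = (fderiv ℝ (leg f) p (0, a)).2.2 u := by
  rw [fderiv_leg_momentum hf, fderiv_leg_momentum hf]
  exact (hf.isSymmSndFDerivAt minSmoothness_two_le) _ _

end localCalculus

section tangentLegendre

variable [IsManifold 𝓘(ℝ, VM m) ∞ M] [IsManifold 𝓘(ℝ, VM N) ∞ F]
  (L : LagrangianSystem m N M E F) (c : AdaptedChart L.bundle)

theorem jc_mem (s : J1 L.bundle) (h : s.1 ∈ c.chart.source) : (jc c s).1 ∈ c.chart.target := by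
  rw [jc_of_mem c s h]; exact c.chart.map_source h

theorem smoothAt_FLt (s : J1 L.bundle) :
    SmoothAt (J1Space m N) (MpiSpace m N) L.FLt s := by
  obtain ⟨c, hc⟩ := exists_adaptedChart L.bundle s.1
  refine (isSmoothChart_mpiChart c (L.FLt s)).smoothAt_of_chart
    (eventually_jet_mem c hc) ?_
  have h1 : SmoothAt (J1Space m N) (PSpace m N) (fun s' => leg (L.lam c s) (jc c s')) s :=
    SmoothAt.comp_of_eq rfl
      (contDiffAt_leg (L.contDiffAt_lam c s (L.jc_mem c s hc))).contMDiffAt (smoothAt_jc c hc)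
  refine ContMDiffAt.congr_of_eventuallyEq h1 ?_
  filter_upwards [eventually_jet_mem c hc] with s' hs' using L.mc_FLt c s' hs' s

theorem tg_mc_FLt (s : J1 L.bundle) (h : s.1 ∈ c.chart.source) (s₀ : J1 L.bundle)
    (w : J1Space m N) : tg (MpiSpace m N) (PSpace m N) (mc c) (L.FLt s)
      (tg (J1Space m N) (MpiSpace m N) L.FLt s w) =
      fderiv ℝ (leg (L.lam c s₀)) (jc c s) (tg (J1Space m N) (J1Space m N) (jc c) s w) := by
  have h' : (L.FLt s).1 ∈ c.chart.source := h
  have h1 := tg_comp (smoothAt_mc c h') (L.smoothAt_FLt s)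
  have h2 := tg_comp (g := leg (L.lam c s₀)) (f := jc c) (x := s)
    (contDiffAt_leg (L.contDiffAt_lam c s₀ (L.jc_mem c s h))).contMDiffAt (smoothAt_jc c h)
  rw [tg_congr (g := fun s' => leg (L.lam c s₀) (jc c s')), h2, tg_eq_fderiv] at h1
  · exact (congrArg (fun L : J1Space m N →L[ℝ] PSpace m N => L w) h1).symm
  · filter_upwards [eventually_jet_mem c h] with s' hs' using L.mc_FLt c s' hs' s₀

end tangentLegendre

/-! ### The multimomentum forms in natural coordinates -/

/-- What remains is `w` followed by `W` without its `k`-th entry; moving `w` into the `k`-th slot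
passes `k` vectors. -/
theorem alternating_cons_removeNth {V : Type*} [NormedAddCommGroup V] [NormedSpace ℝ V]
    (ξ : V [⋀^Fin m]→L[ℝ] ℝ) (w : V) (W : Fin m → V) (k : Fin m) :
    ξ (Fin.removeNth k.succ (Fin.cons w W : Fin (m + 1) → V)) =
      (-1) ^ (k : ℕ) * ξ (Function.update W k w) := by
  cases m with
  | zero => exact k.elim0
  | succ n =>
    have h1 : Fin.removeNth k.succ (Fin.cons w W : Fin (n + 2) → V) =
        Matrix.vecCons w (Fin.removeNth k W) := by
      funext j
      refine Fin.cases ?_ (fun j => ?_) j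
      · simp [Fin.removeNth]
      · simp [Fin.removeNth]
    have h2 := ξ.toAlternatingMap.neg_one_pow_smul_map_insertNth k w (Fin.removeNth k W)
    have h3 : k.insertNth w (Fin.removeNth k W) = Function.update W k w :=
      Fin.insertNth_removeNth k w W
    rw [h1]
    rw [h3] at h2
    refine h2.symm.trans ?_
    simp [zsmul_eq_mul]

/-- The canonical `m`-form in natural coordinates. -/
def theta (m N : ℕ) : PSpace m N →L[ℝ] PSpace m N [⋀^Fin m]→L[ℝ] ℝ :=
  LinearMap.toContinuousLinearMap
    { toFun := fun p => ((toP m N).symm p.2).1.compContinuousLinearMap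
        (ContinuousLinearMap.fst ℝ (VE m N) (PModel m N))
      map_add' := fun p q => by
        have h : ((toP m N).symm (p + q).2).1 = ((toP m N).symm p.2).1 + ((toP m N).symm q.2).1 := by
          rw [Prod.snd_add, map_add]; rfl
        rw [h]; rfl
      map_smul' := fun r q => by
        have h : ((toP m N).symm (r • q).2).1 = r • ((toP m N).symm q.2).1 := by
          rw [Prod.smul_snd, map_smul]; rfl
        rw [h]; rfl }

theorem theta_apply (p : PSpace m N) (W : Fin m → PSpace m N) :
    theta m N p W = ((toP m N).symm p.2).1 (fun i => (W i).1) := rfl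

/-- In these coordinates the canonical form is linear in the point, so its derivative is the form
itself and the exterior derivative has constant coefficients. -/
theorem extDeriv_theta (p : PSpace m N) (W : Fin (m + 1) → PSpace m N) :
    extDeriv (theta m N) p W =
      ∑ i : Fin (m + 1), (-1) ^ (i : ℕ) * theta m N (W i) (Fin.removeNth i W) := by
  rw [extDeriv, ContinuousLinearMap.fderiv, ContinuousAlternatingMap.alternatizeUncurryFin_apply]
  simp

/-- The first term evaluates the momenta of `w₀` on the graph. In the others `w₀` takes the place of
one graph vector, which `toP_slot` evaluates; the signs `(-1)^(i+1)` and `(-1)^i` combine to `-1`.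
-/
theorem extDeriv_theta_graph (p : PSpace m N) {w₀ : PSpace m N} {W : Fin m → PSpace m N}
    {A : J1Model m N} (hW : ∀ i, (W i).1 = graphBasis A i) :
    extDeriv (theta m N) p (Fin.cons w₀ W) = w₀.2.1 + w₀.2.2 A -
      ∑ i, (w₀.1.1 i * ((W i).2.1 + (W i).2.2 A) + (W i).2.2 (tens i (w₀.1.2 - A w₀.1.1))) := by
  rw [extDeriv_theta, Fin.sum_univ_succ]
  have h0 : theta m N w₀ W = w₀.2.1 + w₀.2.2 A := by
    rw [theta_apply]
    simp only [hW]
    have := toP_graph ((toP m N).symm w₀.2) A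
    rw [ContinuousLinearEquiv.apply_symm_apply] at this
    exact this
  have h1 : ∀ i : Fin m, (-1) ^ ((i.succ : Fin (m + 1)) : ℕ) *
      theta m N ((Fin.cons w₀ W : Fin (m + 1) → PSpace m N) i.succ)
        (Fin.removeNth i.succ (Fin.cons w₀ W : Fin (m + 1) → PSpace m N)) =
      -(w₀.1.1 i * ((W i).2.1 + (W i).2.2 A) + (W i).2.2 (tens i (w₀.1.2 - A w₀.1.1))) := by
    intro i
    rw [Fin.cons_succ, alternating_cons_removeNth, theta_apply]
    have h2 : (fun j => (Function.update W i w₀ j).1) =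
        Function.update (graphBasis A) i (w₀.1.1, w₀.1.2) := by
      funext j
      by_cases hj : j = i
      · subst hj; simp
      · simp [Function.update_of_ne hj, hW]
    rw [h2, toP_slot, ContinuousLinearEquiv.apply_symm_apply, ← mul_assoc, Fin.val_succ, ← pow_add,
      show (i : ℕ) + 1 + i = 2 * i + 1 by ring, pow_succ, pow_mul]
    simp
  rw [Finset.sum_congr rfl fun i _ => h1 i, Finset.sum_neg_distrib]
  change (-1) ^ 0 * theta m N w₀ W + _ = _
  rw [h0]
  ring

section omega

variable [IsManifold 𝓘(ℝ, VM m) ∞ M] [IsManifold 𝓘(ℝ, VM N) ∞ F] [IsManifold 𝓘(ℝ, VE m N) ∞ E]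
  (L : LagrangianSystem m N M E F) (c : AdaptedChart L.bundle)

/-- The Liouville form at a point, on the model space. -/
def ΘAt (q : Mpi L.bundle) : MpiSpace m N [⋀^Fin m]→L[ℝ] ℝ := L.Θ q

/-- The multisymplectic form at a point, on the model space. -/
def ΩAt (q : Mpi L.bundle) : MpiSpace m N [⋀^Fin (m + 1)]→L[ℝ] ℝ := L.Ω q

theorem ΘAt_eq (q : Mpi L.bundle) (h : q.1 ∈ c.chart.source) :
    L.ΘAt q = (theta m N (mc c q)).compContinuousLinearMap
      (tg (MpiSpace m N) (PSpace m N) (mc c) q) := by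
  ext V
  change q.2.1 (fun i => tg (MpiSpace m N) (VE m N) (fun q : Mpi L.bundle => q.1) q (V i)) =
    theta m N (mc c q) (fun i => tg (MpiSpace m N) (PSpace m N) (mc c) q (V i))
  rw [theta_apply]
  simp only [tg_mc_fst c q h]
  rw [mc_of_mem c q h, ContinuousLinearEquiv.symm_apply_apply]
  change _ = q.2.1 (fun i => (c.lin q.1 h).symm (c.lin q.1 h _))
  simp only [ContinuousLinearEquiv.symm_apply_apply]

/-- The exterior derivative is defined in the preferred chart at `q`. Its naturality under pullback
by the transition map `g` moves it to natural coordinates, where the form is `theta`. -/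
theorem ΩAt_eq (q : Mpi L.bundle) (h : q.1 ∈ c.chart.source) (V : Fin (m + 1) → MpiSpace m N) :
    L.ΩAt q V = -extDeriv (theta m N) (mc c q)
      (fun i => tg (MpiSpace m N) (PSpace m N) (mc c) q (V i)) := by
  let χ := chartAt (MpiSpace m N) q
  have hχ : IsSmoothChart (MpiSpace m N) χ := .chartAt q
  have hq : q ∈ χ.source := mem_chart_source _ q
  let g : MpiSpace m N → PSpace m N := fun a => mc c (χ.symm a)
  have hg : ContDiffAt ℝ ∞ g (χ q) :=
    contMDiffAt_iff_contDiffAt.1 (hχ.smoothAt_comp_symm hq (smoothAt_mc c h))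
  have hgq : g (χ q) = mc c q := by
    change mc c (χ.symm (χ q)) = _
    rw [χ.left_inv hq]
  have hloc : L.Θ.loc q =ᶠ[𝓝 (χ q)]
      fun a => (theta m N (g a)).compContinuousLinearMap (fderiv ℝ g a) := by
    have hmem : ∀ᶠ a in 𝓝 (χ q), a ∈ χ.target ∧ (χ.symm a).1 ∈ c.chart.source := by
      refine Filter.Eventually.and (χ.open_target.mem_nhds (χ.map_source hq)) ?_
      refine (χ.symm.continuousAt (χ.map_source hq)).eventually
        (p := fun q' : Mpi L.bundle => q'.1 ∈ c.chart.source) ?_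
      change ∀ᶠ q' in 𝓝 (χ.symm (χ q)), q'.1 ∈ c.chart.source
      rw [χ.left_inv hq]
      exact eventually_mpi_mem c h
    filter_upwards [hmem] with a ha
    have h1 : fderiv ℝ g a = (tg (MpiSpace m N) (PSpace m N) (mc c) (χ.symm a)).comp
        (tg (MpiSpace m N) (MpiSpace m N) χ.symm a) := by
      rw [← tg_eq_fderiv]
      exact tg_comp (smoothAt_mc c ha.2) (hχ.at_target ha.1)
    change (L.ΘAt (χ.symm a)).compContinuousLinearMap (tg (MpiSpace m N) (MpiSpace m N) χ.symm a) = _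
    rw [h1, L.ΘAt_eq c _ ha.2]
    rfl
  have hd : extDeriv (L.Θ.loc q) (χ q) =
      (extDeriv (theta m N) (mc c q)).compContinuousLinearMap (fderiv ℝ g (χ q)) := by
    rw [Filter.EventuallyEq.extDeriv_eq hloc, ← hgq]
    exact extDeriv_pullback (f := g) (theta m N).differentiableAt hg minSmoothness_two_le
  have hΩ : L.ΩAt q = -((extDeriv (L.Θ.loc q) (χ q)).compContinuousLinearMap
      (tg (MpiSpace m N) (MpiSpace m N) χ q)) := rfl
  have h2 : tg (MpiSpace m N) (PSpace m N) (mc c) q = (fderiv ℝ g (χ q)).comp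
      (tg (MpiSpace m N) (MpiSpace m N) χ q) := by
    rw [← tg_eq_fderiv]
    have h3 := tg_comp (g := g) (f := χ) (x := q) hg.contMDiffAt (hχ.at_source hq)
    rw [← h3]
    refine tg_congr ?_
    filter_upwards [χ.open_source.mem_nhds hq] with q' hq'
    change _ = mc c (χ.symm (χ q'))
    rw [χ.left_inv hq']
  rw [hΩ, hd, h2]
  rfl

/-- The multisymplectic form on a vector and a basis of an `m`-plane transverse to the fibres. -/
theorem ΩAt_graph (q : Mpi L.bundle) (h : q.1 ∈ c.chart.source) (w₀ : MpiSpace m N)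
    (W : Fin m → MpiSpace m N) (A : J1Model m N)
    (hW : ∀ i, (tg (MpiSpace m N) (PSpace m N) (mc c) q (W i)).1 = graphBasis A i)
    {v₀ : PSpace m N} {V : Fin m → PSpace m N}
    (hv₀ : tg (MpiSpace m N) (PSpace m N) (mc c) q w₀ = v₀)
    (hV : ∀ i, tg (MpiSpace m N) (PSpace m N) (mc c) q (W i) = V i) :
    L.ΩAt q (Fin.cons w₀ W) = (∑ i, (v₀.1.1 i * ((V i).2.1 + (V i).2.2 A) +
        (V i).2.2 (tens i (v₀.1.2 - A v₀.1.1)))) - (v₀.2.1 + v₀.2.2 A) := by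
  rw [L.ΩAt_eq c q h]
  have h1 : (fun i => tg (MpiSpace m N) (PSpace m N) (mc c) q
      ((Fin.cons w₀ W : Fin (m + 1) → MpiSpace m N) i)) = Fin.cons v₀ V := by
    funext i
    refine Fin.cases ?_ (fun i => ?_) i
    · exact hv₀
    · exact hV i
  rw [h1, extDeriv_theta_graph (A := A) _ fun i => by rw [← hV, hW]]
  ring

end omega

end LagrangianSystem

/-! ### Multivectors -/

section multivectors

open exteriorPower

variable {V W Z : Type*} [NormedAddCommGroup V] [NormedSpace ℝ V]
  [NormedAddCommGroup W] [NormedSpace ℝ W] [NormedAddCommGroup Z] [NormedSpace ℝ Z]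

/-- The map induced on `m`-vectors by a continuous linear map. -/
def wmap (m : ℕ) (f : V →L[ℝ] W) : ⋀[ℝ]^m V →ₗ[ℝ] ⋀[ℝ]^m W := exteriorPower.map m f.toLinearMap

theorem wmap_ιMulti (f : V →L[ℝ] W) (v : Fin m → V) :
    wmap m f (ιMulti ℝ m v) = ιMulti ℝ m (fun i => f (v i)) := map_apply_ιMulti _ _

theorem wmap_comp (g : W →L[ℝ] Z) (f : V →L[ℝ] W) (u : ⋀[ℝ]^m V) :
    wmap m (g.comp f) u = wmap m g (wmap m f u) :=
  congrArg (fun L : ⋀[ℝ]^m V →ₗ[ℝ] ⋀[ℝ]^m Z => L u)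
    (exteriorPower.map_comp f.toLinearMap g.toLinearMap (n := m))

theorem wmap_id (u : ⋀[ℝ]^m V) : wmap m (.id ℝ V) u = u :=
  congrArg (fun L : ⋀[ℝ]^m V →ₗ[ℝ] ⋀[ℝ]^m V => L u) exteriorPower.map_id

theorem wmap_injective {f : V →L[ℝ] W} (hf : Function.Injective f) :
    Function.Injective (wmap m f) := map_injective_field hf

theorem pair_ιMulti (η : V [⋀^Fin m]→L[ℝ] ℝ) (v : Fin m → V) : pair η (ιMulti ℝ m v) = η v :=
  alternatingMapLinearEquiv_apply_ιMulti _ _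

/-- The `m`-vectors of an `m`-dimensional space form a line, on which a nonzero volume form is onto.
-/
theorem pair_injective {ν : VM m [⋀^Fin m]→L[ℝ] ℝ} (hν : ν ≠ 0) :
    Function.Injective (pair ν : ⋀[ℝ]^m (VM m) →ₗ[ℝ] ℝ) := by
  have h1 : ν eb ≠ 0 := fun h => hν (LagrangianSystem.eq_zero_of_apply_eb h)
  have h2 : Function.Surjective (pair ν : ⋀[ℝ]^m (VM m) →ₗ[ℝ] ℝ) := by
    intro r
    refine ⟨(r / ν eb) • ιMulti ℝ m eb, ?_⟩
    rw [map_smul, pair_ιMulti, smul_eq_mul, div_mul_cancel₀ _ h1]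
  have h3 : Module.finrank ℝ (⋀[ℝ]^m (VM m)) = Module.finrank ℝ ℝ := by
    rw [exteriorPower.finrank_eq]; simp
  exact (LinearMap.injective_iff_surjective_of_finrank_eq_finrank h3).2 h2

theorem eq_smul_of_pair_eq_one {ν : VM m [⋀^Fin m]→L[ℝ] ℝ} {u : ⋀[ℝ]^m (VM m)}
    (hu : pair ν u = 1) (u' : ⋀[ℝ]^m (VM m)) : u' = pair ν u' • u := by
  have hν : ν ≠ 0 := by
    rintro rfl
    have : (pair (0 : VM m [⋀^Fin m]→L[ℝ] ℝ) : ⋀[ℝ]^m (VM m) →ₗ[ℝ] ℝ) = 0 :=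
      alternatingMapLinearEquiv.map_zero
    rw [this] at hu
    exact zero_ne_one hu
  apply pair_injective hν
  rw [map_smul, hu, smul_eq_mul, mul_one]

theorem ne_zero_of_pair_eq_one {ν : V [⋀^Fin m]→L[ℝ] ℝ} {u : ⋀[ℝ]^m V}
    (hu : pair ν u = 1) : u ≠ 0 := by
  rintro rfl
  rw [map_zero] at hu
  exact zero_ne_one hu

theorem exists_eq_smul_ιMulti {u : ⋀[ℝ]^m (VM m)} (hu : u ≠ 0) :
    ∃ r : ℝ, r ≠ 0 ∧ u = r • ιMulti ℝ m eb := by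
  obtain ⟨ν, hν⟩ := exists_stdVol m
  have h : pair ν (ιMulti ℝ m (eb : Fin m → VM m)) = 1 := by rw [pair_ιMulti, hν]
  have h2 := eq_smul_of_pair_eq_one h u
  exact ⟨pair ν u, fun h0 => hu (by rw [h2, h0, zero_smul]), h2⟩

/-- Sections of a linear map are determined by the induced maps on `m`-vectors. -/
theorem section_eq_of_wmap_eq {A A' : VM m →L[ℝ] W} {P : W →L[ℝ] VM m}
    (hA : P.comp A = .id ℝ _) (hA' : P.comp A' = .id ℝ _) {u : ⋀[ℝ]^m (VM m)} (hu : u ≠ 0)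
    (h : wmap m A u = wmap m A' u) : A = A' := by
  obtain ⟨r, hr, rfl⟩ := exists_eq_smul_ιMulti hu
  obtain ⟨ν, hν⟩ := exists_stdVol m
  -- The form is the pullback of `ν` along `P` with the covector `dxᵏ` replaced by `β`. On the basis
  -- vectors `C (eb i)` only the `k`-th slot contributes, so it reads off `β (C (eb k))` from `ΛᵐC`
  -- alone.
  have key : ∀ (C : VM m →L[ℝ] W) (_ : P.comp C = .id ℝ _) (β : W →L[ℝ] ℝ) (k : Fin m),
      ν.fderivCompContinuousLinearMap P (β.smulRight (eb k)) (fun i => C (eb i)) = β (C (eb k)) := by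
    intro C hC β k
    have hC' : ∀ x, P (C x) = x := fun x => congrArg (fun L : VM m →L[ℝ] VM m => L x) hC
    rw [ContinuousAlternatingMap.fderivCompContinuousLinearMap_apply, Finset.sum_eq_single k]
    · have : (fun j => Function.update (fun _ => P) k (β.smulRight (eb k)) j (C (eb j))) =
          Function.update eb k (β (C (eb k)) • eb k) := by
        funext j
        by_cases hj : j = k
        · subst hj; simp
        · simp [Function.update_of_ne hj, hC']
      rw [this, contAlt_update_smul, Function.update_eq_self, hν, mul_one]
    · intro l _ hl
      have : (fun j => Function.update (fun _ => P) l (β.smulRight (eb k)) j (C (eb j))) =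
          Function.update eb l (β (C (eb l)) • eb k) := by
        funext j
        by_cases hj : j = l
        · subst hj; simp
        · simp [Function.update_of_ne hj, hC']
      rw [this, contAlt_update_smul, vol_update, eb_apply, if_neg hl, zero_mul, mul_zero]
    · simp
  rw [map_smul, map_smul, wmap_ιMulti, wmap_ιMulti] at h
  have h' := smul_right_injective _ hr h
  have h1 : ∀ (β : W →L[ℝ] ℝ) (k : Fin m), β (A (eb k)) = β (A' (eb k)) := by
    intro β k
    rw [← key A hA, ← key A' hA', ← pair_ιMulti, ← pair_ιMulti, h']
  have h2 : ∀ k, A (eb k) = A' (eb k) := fun k => by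
    by_contra hne
    obtain ⟨β, hβ⟩ := SeparatingDual.exists_ne_zero (R := ℝ) (sub_ne_zero.2 hne)
    exact hβ (by rw [map_sub, h1, sub_self])
  ext1 x
  rw [← sum_eb x, map_sum, map_sum]
  refine Finset.sum_congr rfl fun k _ => ?_
  rw [map_smul, map_smul, h2]

/-- A decomposable `m`-vector that is transverse to `P` comes from a section of `P`. -/
theorem exists_section_of_transverse {X : Fin m → W} {P : W →L[ℝ] VM m}
    {ν : VM m [⋀^Fin m]→L[ℝ] ℝ} (h : ν (fun i => P (X i)) ≠ 0) {u : ⋀[ℝ]^m (VM m)}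
    (hu : pair ν u = 1) :
    ∃ D : VM m →L[ℝ] W, P.comp D = .id ℝ _ ∧ ∃ r : ℝ, ιMulti ℝ m X = r • wmap m D u := by
  have hli : LinearIndependent ℝ (fun i => P (X i)) := by
    by_contra hli
    exact h (ν.toAlternatingMap.map_linearDependent _ hli)
  -- Transversality makes the projected factors a basis of the base, and `D` sends each projected
  -- factor back to the factor.
  let b : Module.Basis (Fin m) ℝ (VM m) :=
    basisOfLinearIndependentOfCardEqFinrank' (fun i => P (X i)) hli (by simp)
  have hb : ∀ i, b i = P (X i) := fun i => by simp [b]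
  let D : VM m →L[ℝ] W := LinearMap.toContinuousLinearMap (b.constr ℝ X)
  have hD : ∀ i, D (b i) = X i := fun i => b.constr_basis ℝ X i
  refine ⟨D, ?_, pair ν (ιMulti ℝ m b), ?_⟩
  · have : (P.comp D).toLinearMap = LinearMap.id := by
      refine b.ext fun i => ?_
      change P (D (b i)) = b i
      rw [hD, hb]
    ext1 x
    exact congrArg (fun L : VM m →ₗ[ℝ] VM m => L x) this
  · rw [← map_smul, ← eq_smul_of_pair_eq_one hu, wmap_ιMulti]
    simp only [hD]

theorem contractMV_smul (r : ℝ) (K : ⋀[ℝ]^m W) (η : W [⋀^Fin (m + 1)]→L[ℝ] ℝ) (w : W) :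
    contractMV (r • K) η w = r * contractMV K η w := by
  rw [contractMV, contractMV, map_smul, smul_eq_mul]
  ring

theorem contractMV_ιMulti (X : Fin m → W) (η : W [⋀^Fin (m + 1)]→L[ℝ] ℝ) (w : W) :
    contractMV (ιMulti ℝ m X) η w = (-1) ^ m * η (Fin.cons w X) := by
  rw [contractMV, alternatingMapLinearEquiv_apply_ιMulti]
  rfl

/-- All `m`-vectors of the base are proportional, so vanishing of the contraction can be tested on
the basis of any coordinate system `b`. -/
theorem contractMV_wmap_eq_zero_iff (D : VM m →L[ℝ] W) (b : VM m ≃L[ℝ] VM m) {u : ⋀[ℝ]^m (VM m)}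
    (hu : u ≠ 0) (η : W [⋀^Fin (m + 1)]→L[ℝ] ℝ) (w : W) :
    contractMV (wmap m D u) η w = 0 ↔ η (Fin.cons w fun i => D (b.symm (eb i))) = 0 := by
  have hu' : wmap m (b : VM m →L[ℝ] VM m) u ≠ 0 := fun h =>
    hu (wmap_injective b.injective (by rw [h, map_zero]))
  obtain ⟨r, hr, h⟩ := exists_eq_smul_ιMulti hu'
  have h1 : wmap m D u = r • ιMulti ℝ m (fun i => D (b.symm (eb i))) := by
    have h2 : D = (D.comp (b.symm : VM m →L[ℝ] VM m)).comp (b : VM m →L[ℝ] VM m) := by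
      ext1 x; simp
    conv_lhs => rw [h2, wmap_comp, h, map_smul, wmap_ιMulti]
    rfl
  rw [h1, contractMV_smul, contractMV_ιMulti]
  simp [hr]

end multivectors

/-! ### Submersions -/

/-- The map `f`, completed by a projection to the kernel of its derivative, is a local
diffeomorphism. Here `σ` is its inverse and `κ` the kernel coordinate. -/
theorem submersion_normal_form {X Y : Type*} [NormedAddCommGroup X] [NormedSpace ℝ X]
    [FiniteDimensional ℝ X] [NormedAddCommGroup Y] [NormedSpace ℝ Y] [FiniteDimensional ℝ Y]
    {f : X → Y} {a : X} (hf : ContDiffAt ℝ ∞ f a) (hs : Function.Surjective (fderiv ℝ f a)) :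
    ∃ (K : Submodule ℝ X) (σ : Y × K → X) (κ : X → K),
      ContDiffAt ℝ ∞ σ (f a, 0) ∧ σ (f a, 0) = a ∧ (∀ᶠ p in 𝓝 (f a, 0), f (σ p) = p.1) ∧
      ContinuousAt κ a ∧ κ a = 0 ∧ ∀ᶠ x in 𝓝 a, σ (f x, κ x) = x := by
  have : CompleteSpace X := FiniteDimensional.complete ℝ X
  have : CompleteSpace Y := FiniteDimensional.complete ℝ Y
  set K := (fderiv ℝ f a).ker with hK
  have : CompleteSpace K := FiniteDimensional.complete ℝ K
  obtain ⟨π₀, hπ₀⟩ := LinearMap.exists_leftInverse_of_injective K.subtype K.ker_subtype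
  let π : X →L[ℝ] K := LinearMap.toContinuousLinearMap π₀
  have hπ : ∀ k : K, π k = k := fun k => congrArg (fun L : K →ₗ[ℝ] K => L k) hπ₀
  let Φ : X → Y × K := fun x => (f x, π (x - a))
  have hΦ : ContDiffAt ℝ ∞ Φ a :=
    hf.prodMk (π.contDiff.contDiffAt.comp a (contDiffAt_id.sub contDiffAt_const))
  let D : X →L[ℝ] Y × K := (fderiv ℝ f a).prod π
  have hinj : D.ker = ⊥ := by
    rw [LinearMap.ker_eq_bot']
    intro x hx
    have h1 : fderiv ℝ f a x = 0 := congrArg Prod.fst hx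
    have h2 : π x = 0 := congrArg Prod.snd hx
    have h3 := hπ ⟨x, h1⟩
    rw [h2] at h3
    exact (congrArg Subtype.val h3).symm
  have hsurj : D.range = ⊤ := by
    rw [LinearMap.range_eq_top]
    rintro ⟨y, k⟩
    obtain ⟨x, hx⟩ := hs y
    -- Correcting `x` within the kernel changes its projection to `k` without changing its image
    -- under the derivative.
    refine ⟨x + (k - π x : K), Prod.ext ?_ ?_⟩
    · change fderiv ℝ f a (x + (k - π x : K)) = y
      have : fderiv ℝ f a ((k - π x : K) : X) = 0 := (k - π x).2
      rw [map_add, hx, this, add_zero]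
    · change π (x + (k - π x : K)) = k
      rw [map_add, hπ]; simp
  let D' : X ≃L[ℝ] Y × K := ContinuousLinearEquiv.ofBijective D hinj hsurj
  have hD : HasFDerivAt Φ (D' : X →L[ℝ] Y × K) a := by
    have h1 : HasFDerivAt f (fderiv ℝ f a) a := (hf.differentiableAt (by simp)).hasFDerivAt
    have h2 : HasFDerivAt (fun x => π (x - a)) π a := by
      have h := (hasFDerivAt_id (𝕜 := ℝ) a).sub_const a
      exact HasFDerivAt.comp (f := fun x => id x - a) (g := π) a π.hasFDerivAt h
    exact h1.prodMk h2
  have hst := hΦ.hasStrictFDerivAt' hD (by simp)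
  have hΦa : Φ a = (f a, 0) := by simp [Φ]
  refine ⟨K, hΦ.localInverse hD (by simp), fun x => π (x - a), ?_, ?_, ?_, ?_, by simp, ?_⟩
  · rw [← hΦa]; exact hΦ.to_localInverse hD (by simp)
  · rw [← hΦa]; exact hst.eventually_left_inverse.self_of_nhds
  · rw [← hΦa]
    filter_upwards [hst.eventually_right_inverse] with p hp
    exact congrArg Prod.fst hp
  · exact (π.continuous.comp (continuous_id.sub continuous_const)).continuousAt
  · exact hst.eventually_left_inverse

/-- A function whose derivative vanishes on the kernels of the derivative of a submersion is locally
constant along the fibres. -/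
theorem eventually_eq_of_submersion {X Y Z : Type*} [NormedAddCommGroup X] [NormedSpace ℝ X]
    [FiniteDimensional ℝ X] [NormedAddCommGroup Y] [NormedSpace ℝ Y] [FiniteDimensional ℝ Y]
    [NormedAddCommGroup Z] [NormedSpace ℝ Z]
    {f : X → Y} {g : X → Z} {a : X} (hf : ContDiffAt ℝ ∞ f a)
    (hs : Function.Surjective (fderiv ℝ f a))
    (hg : ∀ᶠ p in 𝓝 a, DifferentiableAt ℝ f p ∧ DifferentiableAt ℝ g p ∧
      ∀ w, fderiv ℝ f p w = 0 → fderiv ℝ g p w = 0) :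
    ∀ᶠ p in 𝓝 a, f p = f a → g p = g a := by
  obtain ⟨K, σ, κ, hσ, hσa, hfσ, hκ, hκa, hσκ⟩ := submersion_normal_form hf hs
  have hgood2 : ∀ᶠ q in 𝓝 (f a, (0 : K)),
      (DifferentiableAt ℝ f (σ q) ∧ DifferentiableAt ℝ g (σ q) ∧
        ∀ w, fderiv ℝ f (σ q) w = 0 → fderiv ℝ g (σ q) w = 0) ∧
      DifferentiableAt ℝ σ q ∧ ∀ᶠ q' in 𝓝 q, f (σ q') = q'.1 := by
    have h1 : ContinuousAt σ (f a, 0) := hσ.continuousAt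
    rw [ContinuousAt, hσa] at h1
    have h2 : ∀ᶠ q in 𝓝 (f a, (0 : K)), ContDiffAt ℝ 1 σ q :=
      (hσ.of_le (by simp)).eventually (by simp)
    filter_upwards [h1.eventually hg, h2, hfσ.eventually_nhds] with q hq1 hq2 hq3
    exact ⟨hq1, hq2.differentiableAt (by simp), hq3⟩
  have hcont : ∀ k : K, ContinuousAt (fun k : K => (f a, k)) k := fun k =>
    (Continuous.prodMk_right (f a)).continuousAt
  obtain ⟨r, hr, hball⟩ := Metric.eventually_nhds_iff_ball.1 ((hcont 0).eventually hgood2)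
  let ι : K →L[ℝ] Y × K := ContinuousLinearMap.inr ℝ Y K
  -- Along the slice `k ↦ σ (f a, k)` the function `f` is constant, so the slice has velocities in
  -- the kernel of `fderiv ℝ f`, which `fderiv ℝ g` kills by hypothesis.
  have hGd : ∀ k ∈ Metric.ball (0 : K) r,
      HasFDerivAt (fun k : K => g (σ (f a, k))) (0 : K →L[ℝ] Z) k := by
    intro k hk
    obtain ⟨⟨h1, h2, h5⟩, h3, h4⟩ := hball k hk
    have hι : HasFDerivAt (fun k : K => (f a, k)) ι k := by
      have : HasFDerivAt (fun k : K => (f a, (0 : K)) + ι k) ι k := ι.hasFDerivAt.const_add _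
      refine this.congr_of_eventuallyEq (Filter.Eventually.of_forall fun k => ?_)
      simp [ι]
    have hσk : HasFDerivAt (fun k : K => σ (f a, k)) ((fderiv ℝ σ (f a, k)).comp ι) k :=
      HasFDerivAt.comp (g := σ) k h3.hasFDerivAt hι
    have hG := HasFDerivAt.comp (g := g) k h2.hasFDerivAt hσk
    have hF := HasFDerivAt.comp (g := f) k h1.hasFDerivAt hσk
    have hF0 : HasFDerivAt (f ∘ fun k : K => σ (f a, k)) (0 : K →L[ℝ] Y) k :=
      (hasFDerivAt_const (f a) k).congr_of_eventuallyEq ((hcont k).eventually h4)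
    have hzero : (fderiv ℝ g (σ (f a, k))).comp ((fderiv ℝ σ (f a, k)).comp ι) = 0 := by
      ext1 x
      exact h5 _ (congrArg (fun T : K →L[ℝ] Y => T x) (hF.unique hF0))
    rw [hzero] at hG
    exact hG
  have hconst : ∀ k ∈ Metric.ball (0 : K) r, g (σ (f a, k)) = g (σ (f a, 0)) := by
    intro k hk
    exact Metric.isOpen_ball.is_const_of_fderiv_eq_zero (𝕜 := ℝ)
      (convex_ball (0 : K) r).isPreconnected
      (fun k hk => (hGd k hk).differentiableAt.differentiableWithinAt)
      (fun k hk => (hGd k hk).fderiv) hk (Metric.mem_ball_self hr)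
  have hκs : ∀ᶠ p in 𝓝 a, κ p ∈ Metric.ball (0 : K) r := by
    refine hκ.preimage_mem_nhds ?_
    rw [hκa]
    exact Metric.ball_mem_nhds _ hr
  filter_upwards [hκs, hσκ] with p h1 h2 h3
  have h4 := hconst _ h1
  rw [hσa, ← h3, h2] at h4
  exact h4

/-! ### The fibres of the Legendre map and the lift of its image. -/

namespace LagrangianSystem.AlmostRegular

variable [IsManifold 𝓘(ℝ, VM m) ∞ M] [IsManifold 𝓘(ℝ, VM N) ∞ F] [IsManifold 𝓘(ℝ, VE m N) ∞ E]
  {L : LagrangianSystem m N M E F}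
  {VP P : Type*} [NormedAddCommGroup VP] [NormedSpace ℝ VP] [FiniteDimensional ℝ VP]
  [TopologicalSpace P] [ChartedSpace VP P] [IsManifold 𝓘(ℝ, VP) ∞ P] (A : L.AlmostRegular VP P)

theorem tg_incl_FL₀ (s : J1 L.bundle) (w : J1Space m N) :
    tg VP (J1sSpace m N) A.incl (A.FL₀ s) (tg (J1Space m N) VP A.FL₀ s w) =
      tg (MpiSpace m N) (J1sSpace m N) (mu L.bundle) (L.FLt s)
        (tg (J1Space m N) (MpiSpace m N) L.FLt s w) := by
  have h1 := tg_comp (x := s) (A.incl_smooth (A.FL₀ s)) (A.FL₀_smooth s)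
  have h2 := tg_comp (x := s) (smoothAt_mu (L.FLt s)) (L.smoothAt_FLt s)
  have h3 : (fun s => A.incl (A.FL₀ s)) = fun s => mu L.bundle (L.FLt s) :=
    funext fun s => A.incl_FL₀ s
  rw [h3, h2] at h1
  exact congrArg (fun T : J1Space m N →L[ℝ] J1sSpace m N => T w) h1.symm

/-- The Legendre maps have the same tangent kernels. -/
theorem tg_FLt_eq_zero {s : J1 L.bundle} {w : J1Space m N}
    (h : tg (J1Space m N) VP A.FL₀ s w = 0) : tg (J1Space m N) (MpiSpace m N) L.FLt s w = 0 := by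
  obtain ⟨c, hc⟩ := exists_adaptedChart L.bundle s.1
  have hc' : (L.FLt s).1 ∈ c.chart.source := hc
  have h1 := A.tg_incl_FL₀ s w
  rw [h, map_zero] at h1
  have h2 := tg_rc_mu c (L.FLt s) hc' (tg (J1Space m N) (MpiSpace m N) L.FLt s w)
  rw [← h1, map_zero, L.tg_mc_FLt c s hc s] at h2
  apply tg_mc_injective c hc'
  rw [map_zero, L.tg_mc_FLt c s hc s]
  exact fderiv_leg_eq_zero (L.contDiffAt_lam c s (L.jc_mem c s hc)) (congrArg Prod.fst h2).symm
    (congrArg Prod.snd h2).symm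

theorem tg_FL₀_eq_zero {s : J1 L.bundle} {w : J1Space m N}
    (h : tg (J1Space m N) (MpiSpace m N) L.FLt s w = 0) : tg (J1Space m N) VP A.FL₀ s w = 0 := by
  refine A.incl_immersion (A.FL₀ s) ?_
  refine (A.tg_incl_FL₀ s w).trans ?_
  rw [h, map_zero]
  exact (map_zero (tg VP (J1sSpace m N) A.incl (A.FL₀ s))).symm

/-- The expression of `FL₀` in charts. -/
def FL₀C (c : AdaptedChart L.bundle) (s : J1 L.bundle) (p : J1Space m N) : VP :=
  chartAt VP (A.FL₀ s) (A.FL₀ ((jetChart c s).symm p))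

theorem contDiffAt_FL₀C {c : AdaptedChart L.bundle} {s : J1 L.bundle} {p : J1Space m N}
    (hp : p ∈ (jetChart c s).target)
    (hp' : A.FL₀ ((jetChart c s).symm p) ∈ (chartAt VP (A.FL₀ s)).source) :
    ContDiffAt ℝ ∞ (A.FL₀C c s) p :=
  contMDiffAt_iff_contDiffAt.1 (SmoothAt.comp_of_eq (g := chartAt VP (A.FL₀ s))
    (f := fun p => A.FL₀ ((jetChart c s).symm p)) rfl
    ((IsSmoothChart.chartAt (A.FL₀ s)).at_source hp')
    (SmoothAt.comp_of_eq (g := A.FL₀) rfl (A.FL₀_smooth _)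
      ((isSmoothChart_jetChart c s).at_target hp)))

theorem fderiv_FL₀C {c : AdaptedChart L.bundle} {s : J1 L.bundle} {p : J1Space m N}
    (hp : p ∈ (jetChart c s).target)
    (hp' : A.FL₀ ((jetChart c s).symm p) ∈ (chartAt VP (A.FL₀ s)).source) (w : J1Space m N) :
    fderiv ℝ (A.FL₀C c s) p w =
      tg VP VP (chartAt VP (A.FL₀ s)) (A.FL₀ ((jetChart c s).symm p))
        (tg (J1Space m N) VP A.FL₀ ((jetChart c s).symm p)
          (tg (J1Space m N) (J1Space m N) (jetChart c s).symm p w)) := by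
  have h1 : SmoothAt (J1Space m N) VP (fun p => A.FL₀ ((jetChart c s).symm p)) p :=
    SmoothAt.comp_of_eq rfl (A.FL₀_smooth _) ((isSmoothChart_jetChart c s).at_target hp)
  have h2 := tg_comp (x := p) ((IsSmoothChart.chartAt (V := VP) (A.FL₀ s)).at_source hp') h1
  have h3 := tg_comp (x := p) (A.FL₀_smooth ((jetChart c s).symm p))
    ((isSmoothChart_jetChart c s).at_target hp)
  rw [h3, tg_eq_fderiv] at h2
  exact congrArg (fun T : J1Space m N →L[ℝ] VP => T w) h2

/-- Charts are diffeomorphisms, so the coordinate expression inherits the submersion property of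
`FL₀`. -/
theorem surjective_fderiv_FL₀C {c : AdaptedChart L.bundle} {s : J1 L.bundle}
    (h : s.1 ∈ c.chart.source) : Function.Surjective (fderiv ℝ (A.FL₀C c s) (jc c s)) := by
  intro y
  have hs : s ∈ (jetChart c s).source := h
  have hp : jc c s ∈ (jetChart c s).target := (jetChart c s).map_source hs
  have e : (jetChart c s).symm (jc c s) = s := (jetChart c s).left_inv hs
  have hp' : A.FL₀ ((jetChart c s).symm (jc c s)) ∈ (chartAt VP (A.FL₀ s)).source := by
    rw [e]; exact mem_chart_source _ _
  obtain ⟨w, hw⟩ := A.FL₀_submersion s y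
  have hw : tg (J1Space m N) VP A.FL₀ s w = y := hw
  refine ⟨tg (J1Space m N) (J1Space m N) (jetChart c s) s w, ?_⟩
  rw [A.fderiv_FL₀C hp hp']
  have h1 := (isSmoothChart_jetChart c s).tg_symm_tg hs w
  rw [jetChart_apply] at h1
  rw [h1, e, hw, tg_chartAt_self]
  rfl

/-- The extended Legendre map is locally constant along the fibres of the Legendre map. -/
theorem eventually_FLt_eq (s : J1 L.bundle) :
    ∀ᶠ s' in 𝓝 s, A.FL₀ s' = A.FL₀ s → L.FLt s' = L.FLt s := by
  obtain ⟨c, hc⟩ := exists_adaptedChart L.bundle s.1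
  set e := jetChart c s with he
  have hs : s ∈ e.source := hc
  set a := jc c s with ha
  have hat : a ∈ e.target := e.map_source hs
  have hsa : e.symm a = s := e.left_inv hs
  have hpa : A.FL₀ (e.symm a) ∈ (chartAt VP (A.FL₀ s)).source := by
    rw [hsa]; exact mem_chart_source _ _
  have hgood : ∀ᶠ p in 𝓝 a, p ∈ e.target ∧ A.FL₀ (e.symm p) ∈ (chartAt VP (A.FL₀ s)).source := by
    refine Filter.Eventually.and (e.open_target.mem_nhds hat) ?_
    have hcont : ContinuousAt (fun p => A.FL₀ (e.symm p)) a :=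
      A.FL₀_smooth.continuous.continuousAt.comp (e.symm.continuousAt hat)
    exact hcont.preimage_mem_nhds ((chartAt VP (A.FL₀ s)).open_source.mem_nhds hpa)
  have key : ∀ᶠ p in 𝓝 a, DifferentiableAt ℝ (A.FL₀C c s) p ∧
      DifferentiableAt ℝ (leg (L.lam c s)) p ∧
      ∀ w, fderiv ℝ (A.FL₀C c s) p w = 0 → fderiv ℝ (leg (L.lam c s)) p w = 0 := by
    filter_upwards [hgood] with p hp
    refine ⟨(A.contDiffAt_FL₀C hp.1 hp.2).differentiableAt (by simp),
      (contDiffAt_leg (L.contDiffAt_lam c s hp.1)).differentiableAt (by simp), fun w hw => ?_⟩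
    rw [A.fderiv_FL₀C hp.1 hp.2] at hw
    have h8 := (IsSmoothChart.chartAt (V := VP) (A.FL₀ s)).tg_injective hp.2
      (hw.trans (map_zero _).symm)
    have h9 := A.tg_FLt_eq_zero h8
    have hcs : (e.symm p).1 ∈ c.chart.source := e.map_target hp.1
    have h10 := L.tg_mc_FLt c (e.symm p) hcs s (tg (J1Space m N) (J1Space m N) e.symm p w)
    have h11 : jc c (e.symm p) = p := e.right_inv hp.1
    have h12 : tg (J1Space m N) (J1Space m N) (jc c) (e.symm p)
        (tg (J1Space m N) (J1Space m N) e.symm p w) = w :=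
      (isSmoothChart_jetChart c s).tg_tg_symm hp.1 w
    rw [h9, map_zero, h12, h11] at h10
    exact h10.symm
  have hloc := eventually_eq_of_submersion (A.contDiffAt_FL₀C hat hpa)
    (A.surjective_fderiv_FL₀C hc) key
  have hcont : ContinuousAt (fun s' => jc c s') s := (smoothAt_jc c hc).continuousAt
  filter_upwards [hcont.eventually hloc, eventually_jet_mem c hc] with s' h1 h3 h4
  have h3' : s' ∈ e.source := h3
  have hf' : A.FL₀C c s (jc c s') = A.FL₀C c s a := by
    change chartAt VP (A.FL₀ s) (A.FL₀ (e.symm (e s'))) = chartAt VP (A.FL₀ s) (A.FL₀ (e.symm a))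
    rw [e.left_inv h3', h4, hsa]
  have h8 : mc c (L.FLt s') = mc c (L.FLt s) := by
    rw [L.mc_FLt c s' h3 s, L.mc_FLt c s hc s]
    exact h1 hf'
  exact (mpiChart c (L.FLt s)).injOn (show L.FLt s' ∈ (mpiChart c (L.FLt s)).source from h3)
    (show L.FLt s ∈ (mpiChart c (L.FLt s)).source from hc) h8

/-- A locally constant function on a connected fibre is constant; this is where connectedness of the
fibres enters, and it makes the choice in `lift` immaterial. -/
theorem FLt_eq_of_FL₀_eq {s s' : J1 L.bundle} (h : A.FL₀ s = A.FL₀ s') : L.FLt s = L.FLt s' := by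
  have : PreconnectedSpace (A.FL₀ ⁻¹' {A.FL₀ s'}) :=
    isPreconnected_iff_preconnectedSpace.1 (A.FL₀_connected _).isPreconnected
  have hloc : IsLocallyConstant (fun t : A.FL₀ ⁻¹' {A.FL₀ s'} => L.FLt t.1) := by
    rw [IsLocallyConstant.iff_eventually_eq]
    intro t
    have h1 := continuous_subtype_val.continuousAt.eventually (A.eventually_FLt_eq t.1)
    filter_upwards [h1] with t' ht'
    refine ht' ?_
    have e1 : A.FL₀ t.1 = _ := t.2
    have e2 : A.FL₀ t'.1 = _ := t'.2
    rw [e1, e2]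
  exact hloc.apply_eq_of_preconnectedSpace ⟨s, h⟩ ⟨s', rfl⟩

theorem lift_FL₀ (s : J1 L.bundle) : A.lift (A.FL₀ s) = L.FLt s :=
  A.FLt_eq_of_FL₀_eq (Function.surjInv_eq A.FL₀_surjective (A.FL₀ s))

theorem mu_lift (p : P) : mu L.bundle (A.lift p) = A.incl p := by
  obtain ⟨s, rfl⟩ := A.FL₀_surjective p
  rw [A.lift_FL₀, A.incl_FL₀]; rfl

/-- The section is the slice of the submersion normal form on which the kernel coordinate is zero.
It gives smoothness of the lift. -/
theorem exists_local_section (s : J1 L.bundle) : ∃ τ : P → J1 L.bundle,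
    SmoothAt VP (J1Space m N) τ (A.FL₀ s) ∧ τ (A.FL₀ s) = s ∧
      ∀ᶠ p in 𝓝 (A.FL₀ s), A.FL₀ (τ p) = p := by
  obtain ⟨c, hc⟩ := exists_adaptedChart L.bundle s.1
  set e := jetChart c s with he
  have hs : s ∈ e.source := hc
  set a := jc c s with ha
  have hat : a ∈ e.target := e.map_source hs
  have hsa : e.symm a = s := e.left_inv hs
  have hpa : A.FL₀ (e.symm a) ∈ (chartAt VP (A.FL₀ s)).source := by
    rw [hsa]; exact mem_chart_source _ _
  obtain ⟨K, σ, κ, hσ, hσa, hfσ, -, -, -⟩ :=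
    submersion_normal_form (A.contDiffAt_FL₀C hat hpa) (A.surjective_fderiv_FL₀C hc)
  let χ := chartAt VP (A.FL₀ s)
  have hp : A.FL₀ s ∈ χ.source := mem_chart_source _ _
  have hfa : A.FL₀C c s a = χ (A.FL₀ s) := by
    change χ (A.FL₀ (e.symm a)) = _
    rw [hsa]
  let ρ : P → VP × K := fun p => (χ p, 0)
  have hρs : ρ (A.FL₀ s) = (A.FL₀C c s a, 0) := by rw [hfa]
  have hρ : SmoothAt VP (VP × K) ρ (A.FL₀ s) :=
    ((IsSmoothChart.chartAt (A.FL₀ s)).at_source hp).prodMk_space contMDiffAt_const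
  have hσρ : SmoothAt VP (J1Space m N) (fun p => σ (ρ p)) (A.FL₀ s) :=
    SmoothAt.comp_of_eq hρs hσ.contMDiffAt hρ
  have hval : σ (ρ (A.FL₀ s)) = a := by rw [hρs, hσa]
  refine ⟨fun p => e.symm (σ (ρ p)), SmoothAt.comp_of_eq hval
    ((isSmoothChart_jetChart c s).at_target hat) hσρ, by
      change e.symm (σ (ρ (A.FL₀ s))) = s
      rw [hval, hsa], ?_⟩
  have h1 : ∀ᶠ p in 𝓝 (A.FL₀ s), A.FL₀C c s (σ (ρ p)) = (ρ p).1 := by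
    have := hρ.continuousAt
    rw [ContinuousAt, hρs] at this
    exact this.eventually hfσ
  have h2 : ∀ᶠ p in 𝓝 (A.FL₀ s), A.FL₀ (e.symm (σ (ρ p))) ∈ χ.source := by
    have h3 : ContinuousAt (fun p => A.FL₀ (e.symm (σ (ρ p)))) (A.FL₀ s) := by
      refine ContinuousAt.comp (f := fun p => e.symm (σ (ρ p))) A.FL₀_smooth.continuous.continuousAt ?_
      refine ContinuousAt.comp (f := fun p => σ (ρ p)) ?_ hσρ.continuousAt
      rw [hval]
      exact e.symm.continuousAt hat
    refine h3.preimage_mem_nhds (χ.open_source.mem_nhds ?_)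
    rw [hval, hsa]
    exact hp
  filter_upwards [h1, h2, χ.open_source.mem_nhds hp] with p hp1 hp2 hp3
  exact χ.injOn hp2 hp3 hp1

theorem smoothAt_lift (p : P) : SmoothAt VP (MpiSpace m N) A.lift p := by
  obtain ⟨s, rfl⟩ := A.FL₀_surjective p
  obtain ⟨τ, hτ, hτs, hτ'⟩ := A.exists_local_section s
  have h1 : SmoothAt VP (MpiSpace m N) (fun p => L.FLt (τ p)) (A.FL₀ s) :=
    SmoothAt.comp_of_eq hτs (L.smoothAt_FLt s) hτ
  refine ContMDiffAt.congr_of_eventuallyEq h1 ?_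
  filter_upwards [hτ'] with p hp
  rw [← A.lift_FL₀, hp]

theorem tg_lift_FL₀ (s : J1 L.bundle) (w : J1Space m N) :
    tg VP (MpiSpace m N) A.lift (A.FL₀ s) (tg (J1Space m N) VP A.FL₀ s w) =
      tg (J1Space m N) (MpiSpace m N) L.FLt s w := by
  have h1 := tg_comp (x := s) (A.smoothAt_lift (A.FL₀ s)) (A.FL₀_smooth s)
  have h2 : (fun s => A.lift (A.FL₀ s)) = L.FLt := funext A.lift_FL₀
  rw [h2] at h1
  exact congrArg (fun T : J1Space m N →L[ℝ] MpiSpace m N => T w) h1.symm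

theorem incl_injective : Function.Injective A.incl := A.incl_closed.injective

theorem tg_incl_injective (p : P) : Function.Injective (tg VP (J1sSpace m N) A.incl p) :=
  A.incl_immersion p

end LagrangianSystem.AlmostRegular

/-! ### Multivectors at a point of a manifold -/

section tangentMultivectors

open exteriorPower

variable {V W : Type*} [NormedAddCommGroup V] [NormedSpace ℝ V]
  [NormedAddCommGroup W] [NormedSpace ℝ W] {X Y : Type*} [TopologicalSpace X] [ChartedSpace V X]
  [TopologicalSpace Y] [ChartedSpace W Y]

/-- The `m`-vectors of a normed space. -/
abbrev ModelMultivector (m : ℕ) (V : Type*) [NormedAddCommGroup V] [NormedSpace ℝ V] := ⋀[ℝ]^m V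

/-- The identification of a tangent space with the model space. -/
def tangentId (V : Type*) [NormedAddCommGroup V] [NormedSpace ℝ V] {X : Type*} [TopologicalSpace X]
    [ChartedSpace V X] (x : X) : TangentSpace 𝓘(ℝ, V) x ≃ₗ[ℝ] V where
  toFun v := v
  invFun v := v
  map_add' _ _ := rfl
  map_smul' _ _ := rfl
  left_inv _ := rfl
  right_inv _ := rfl

/-- Multivectors at a point, as multivectors of the model space. -/
def mv {x : X} : MVector m V x →ₗ[ℝ] ⋀[ℝ]^m V := exteriorPower.map m (tangentId V x).toLinearMap

/-- Multivectors of the model space, as multivectors at a point. -/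
def mvAt (x : X) : ⋀[ℝ]^m V →ₗ[ℝ] MVector m V x :=
  exteriorPower.map m (tangentId V x).symm.toLinearMap

theorem mv_ιMulti {x : X} (v : Fin m → TangentSpace 𝓘(ℝ, V) x) :
    mv (ιMulti ℝ m v) = ιMulti ℝ m (fun i => tangentId V x (v i)) := map_apply_ιMulti _ _

theorem mv_mvAt (x : X) (k : ⋀[ℝ]^m V) : mv (mvAt x k) = k := by
  have h := exteriorPower.map_comp (n := m) (tangentId V x).symm.toLinearMap
    (tangentId V x).toLinearMap
  rw [show (tangentId V x).toLinearMap ∘ₗ (tangentId V x).symm.toLinearMap = LinearMap.id by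
    ext; simp, exteriorPower.map_id] at h
  exact (congrArg (fun L : ⋀[ℝ]^m V →ₗ[ℝ] ⋀[ℝ]^m V => L k) h).symm

theorem mv_injective {x : X} : Function.Injective (mv : MVector m V x →ₗ[ℝ] ⋀[ℝ]^m V) :=
  map_injective_field (tangentId V x).injective

theorem mv_wedgeT {f : X → Y} {x : X} (k : MVector m V x) :
    mv (wedgeT m V W f x k) = wmap m (tg V W f x) (mv k) := by
  have h : mv.comp (wedgeT m V W f x) = (wmap m (tg V W f x)).comp mv := by
    refine exteriorPower.linearMap_ext (AlternatingMap.ext fun v => ?_)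
    change mv (wedgeT m V W f x (ιMulti ℝ m v)) = wmap m (tg V W f x) (mv (ιMulti ℝ m v))
    rw [wedgeT, map_apply_ιMulti, mv_ιMulti, mv_ιMulti, wmap_ιMulti]
    rfl
  exact congrArg (fun L : MVector m V x →ₗ[ℝ] ⋀[ℝ]^m W => L k) h

/-- The identification of multivectors commutes with linear maps; the two sides may be formed with
different, but equal, algebraic structures. -/
theorem mv_eq_wmap {y : Y} (k : MVector m W y) (g : V →L[ℝ] W) (i₁ : AddCommGroup V)
    (m₁ : @Module ℝ V _ i₁.toAddCommMonoid) (i₂ : AddCommGroup W)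
    (m₂ : @Module ℝ W _ i₂.toAddCommMonoid)
    (f : @LinearMap ℝ ℝ _ _ (RingHom.id ℝ) V W i₁.toAddCommMonoid i₂.toAddCommMonoid m₁ m₂)
    (e : @ExteriorAlgebra.exteriorPower ℝ _ m V i₁ m₁)
    (hk : HEq k (@exteriorPower.map ℝ _ m V W i₁ m₁ i₂ m₂ f e))
    (h₁ : i₁ = NormedAddCommGroup.toAddCommGroup) (h₁' : HEq m₁ (@NormedSpace.toModule ℝ V _ _ _))
    (h₂ : i₂ = NormedAddCommGroup.toAddCommGroup) (h₂' : HEq m₂ (@NormedSpace.toModule ℝ W _ _ _))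
    (hfg : ∀ v, f v = g v) : ∃ e' : ModelMultivector m V, mv k = wmap m g e' := by
  subst h₁ h₂
  cases h₁'
  cases h₂'
  have hf : f = g.toLinearMap := LinearMap.ext hfg
  subst hf
  refine ⟨e, ?_⟩
  -- The identification of a tangent space with the model is the identity function, so its effect on
  -- multivectors is trivial once the two algebraic structures are identified.
  have key : ∀ (T : Type _) (i₁ i₂ : AddCommGroup T) (m₁ : @Module ℝ T _ i₁.toAddCommMonoid)
      (m₂ : @Module ℝ T _ i₂.toAddCommMonoid) (_ : i₁ = i₂) (_ : HEq m₁ m₂)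
      (f : @LinearMap ℝ ℝ _ _ (RingHom.id ℝ) T T i₁.toAddCommMonoid i₂.toAddCommMonoid m₁ m₂)
      (_ : ∀ v, f v = v) (k : @ExteriorAlgebra.exteriorPower ℝ _ m T i₁ m₁),
      HEq (@exteriorPower.map ℝ _ m T T i₁ m₁ i₂ m₂ f k) k := by
    rintro T i₁ _ m₁ _ rfl h f hf k
    cases h
    have : f = LinearMap.id := LinearMap.ext hf
    rw [this, exteriorPower.map_id]
    rfl
  exact eq_of_heq ((key W _ _ _ _ rfl HEq.rfl (tangentId W y).toLinearMap (fun _ => rfl) k).trans hk)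

theorem pair_mv {x : X} (η : V [⋀^Fin m]→L[ℝ] ℝ) (k : MVector m V x) :
    pair (show TangentSpace 𝓘(ℝ, V) x [⋀^Fin m]→L[ℝ] ℝ from η) k = pair η (mv k) := by
  have h : pair (show TangentSpace 𝓘(ℝ, V) x [⋀^Fin m]→L[ℝ] ℝ from η) = (pair η).comp mv := by
    refine exteriorPower.linearMap_ext (AlternatingMap.ext fun v => ?_)
    change pair (show TangentSpace 𝓘(ℝ, V) x [⋀^Fin m]→L[ℝ] ℝ from η) (ιMulti ℝ m v) =
      pair η (mv (ιMulti ℝ m v))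
    rw [mv_ιMulti, pair_ιMulti, pair, alternatingMapLinearEquiv_apply_ιMulti]
    rfl
  exact congrArg (fun L : MVector m V x →ₗ[ℝ] ℝ => L k) h

theorem contractMV_mv {x : X} (k : MVector m V x) (η : V [⋀^Fin (m + 1)]→L[ℝ] ℝ) (w : V) :
    contractMV k (show TangentSpace 𝓘(ℝ, V) x [⋀^Fin (m + 1)]→L[ℝ] ℝ from η)
      (show TangentSpace 𝓘(ℝ, V) x from w) = contractMV (mv k) η w := by
  have h : alternatingMapLinearEquiv (contract (show TangentSpace 𝓘(ℝ, V) x from w)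
      (show TangentSpace 𝓘(ℝ, V) x [⋀^Fin (m + 1)]→L[ℝ] ℝ from η)) =
      (alternatingMapLinearEquiv (contract w η)).comp mv := by
    refine exteriorPower.linearMap_ext (AlternatingMap.ext fun v => ?_)
    change alternatingMapLinearEquiv _ (ιMulti ℝ m v) =
      alternatingMapLinearEquiv (contract w η) (mv (ιMulti ℝ m v))
    rw [mv_ιMulti, alternatingMapLinearEquiv_apply_ιMulti, alternatingMapLinearEquiv_apply_ιMulti]
    rfl
  rw [contractMV, contractMV, h]
  rfl

theorem mvector_eq_iff {y y' : Y} (k : MVector m W y) (k' : MVector m W y') :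
    (⟨y, k⟩ : Σ y : Y, MVector m W y) = ⟨y', k'⟩ ↔ y = y' ∧ mv k = mv k' := by
  constructor
  · intro h
    cases h
    exact ⟨rfl, rfl⟩
  · rintro ⟨rfl, h⟩
    exact congrArg (Sigma.mk y) (mv_injective h)

end tangentMultivectors

-- Transversality turns the factors of `k` into a section `D` of `P ∘ T`, with `k` a nonzero
-- multiple of `ΛᵐD`. Since `T ∘ D` and `γ` are both sections of `P` and agree on a nonzero
-- `m`-vector, they coincide. The field equation passes from `k` to `D` because all `m`-vectors of
-- the base are proportional.
open exteriorPower in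
theorem exists_section_of_multivector {W Z : Type*} [NormedAddCommGroup W] [NormedSpace ℝ W]
    [NormedAddCommGroup Z] [NormedSpace ℝ Z] {P : Z →L[ℝ] VM m} {T : W →L[ℝ] Z} {γ : VM m →L[ℝ] Z}
    (hγ : P.comp γ = .id ℝ _) {k : ⋀[ℝ]^m W} {Y : Fin m → W} (hk : k = ιMulti ℝ m Y)
    {ν : VM m [⋀^Fin m]→L[ℝ] ℝ} (htr : pair ν (wmap m (P.comp T) k) ≠ 0)
    {e : ⋀[ℝ]^m (VM m)} (he : wmap m T k = wmap m γ e) :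
    ∃ D : VM m →L[ℝ] W, T.comp D = γ ∧ ∃ u : ⋀[ℝ]^m (VM m), k = wmap m D u ∧
      ∀ (η : W [⋀^Fin (m + 1)]→L[ℝ] ℝ) (w : W), contractMV k η w = 0 →
        ∀ u : ⋀[ℝ]^m (VM m), contractMV (wmap m D u) η w = 0 := by
  have hν : ν ≠ 0 := by
    rintro rfl
    have : (pair (0 : VM m [⋀^Fin m]→L[ℝ] ℝ) : ⋀[ℝ]^m (VM m) →ₗ[ℝ] ℝ) = 0 :=
      alternatingMapLinearEquiv.map_zero
    exact htr (by rw [this]; rfl)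
  obtain ⟨u, hu⟩ : ∃ u : ⋀[ℝ]^m (VM m), pair ν u = 1 := by
    refine ⟨(pair ν (wmap m (P.comp T) k))⁻¹ • wmap m (P.comp T) k, ?_⟩
    rw [map_smul, smul_eq_mul, inv_mul_cancel₀ htr]
  have hu0 := ne_zero_of_pair_eq_one hu
  have htr' := htr
  rw [hk, wmap_ιMulti, pair_ιMulti] at htr'
  obtain ⟨D, hD, r, hr⟩ := exists_section_of_transverse htr' hu
  rw [← hk] at hr
  have hr0 : r ≠ 0 := by
    rintro rfl
    exact htr (by rw [hr, zero_smul, map_zero, map_zero])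
  refine ⟨D, ?_, r • u, by rw [hr, map_smul], fun η w h1 u' => ?_⟩
  · have h1 := eq_smul_of_pair_eq_one hu e
    rw [hr, map_smul, ← wmap_comp, h1, map_smul] at he
    -- Both sides lie over the base, so applying `P` compares the two scalar factors.
    have h2 := congrArg (wmap m P) he
    rw [map_smul, map_smul, ← wmap_comp, ← wmap_comp, ← ContinuousLinearMap.comp_assoc, hD,
      hγ, wmap_id] at h2
    have h3 : r = _ := smul_left_injective ℝ hu0 h2
    rw [← h3] at he
    exact section_eq_of_wmap_eq (P := P)
      (by rw [← ContinuousLinearMap.comp_assoc, hD]) hγ hu0 (smul_right_injective _ hr0 he)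
  · rw [hr, contractMV_smul] at h1
    rw [eq_smul_of_pair_eq_one hu u', map_smul, contractMV_smul,
      (mul_eq_zero.1 h1).resolve_left hr0, mul_zero]

namespace LagrangianSystem

open exteriorPower

variable [IsManifold 𝓘(ℝ, VM m) ∞ M] [IsManifold 𝓘(ℝ, VM N) ∞ F] [IsManifold 𝓘(ℝ, VE m N) ∞ E]
  (L : LagrangianSystem m N M E F)

/-! ### Linear sections that satisfy the field equation -/

/-- Linear maps into the tangent spaces of the extended multimomentum bundle that lift a jet and
satisfy the field equation. -/
structure IsFieldSection (s : J1 L.bundle) (D : VM m →L[ℝ] MpiSpace m N) : Prop where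
  comp_fst : (tg (MpiSpace m N) (VE m N) (fun q : Mpi L.bundle => q.1) (L.FLt s)).comp D = s.2.1
  field : ∀ (u : ⋀[ℝ]^m (VM m)) (w : J1Space m N), contractMV (wmap m D u) (L.ΩAt (L.FLt s))
    (tg (J1Space m N) (MpiSpace m N) L.FLt s w) = 0

/-- The expression of a linear section in natural coordinates. -/
def secC (c : AdaptedChart L.bundle) (s : J1 L.bundle) (D : VM m →L[ℝ] MpiSpace m N) :
    VM m →L[ℝ] PSpace m N :=
  (tg (MpiSpace m N) (PSpace m N) (mc c) (L.FLt s)).comp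
    (D.comp (tg (VM m) (VM m) c.base.symm (c.base (L.bundle.proj s.1))))

variable {L}

theorem secC_apply (c : AdaptedChart L.bundle) (s : J1 L.bundle) (h : s.1 ∈ c.chart.source)
    (D : VM m →L[ℝ] MpiSpace m N) (x : VM m) :
    L.secC c s D x = tg (MpiSpace m N) (PSpace m N) (mc c) (L.FLt s) (D ((c.blin s.1 h).symm x)) := by
  have := c.blin_symm_eq s.1 h
  change _ = tg (MpiSpace m N) (PSpace m N) (mc c) (L.FLt s)
    (D (((c.blin s.1 h).symm : VM m →L[ℝ] VM m) x))
  rw [this]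
  rfl

theorem secC_injective (c : AdaptedChart L.bundle) (s : J1 L.bundle) (h : s.1 ∈ c.chart.source)
    {D D' : VM m →L[ℝ] MpiSpace m N} (hD : L.secC c s D = L.secC c s D') : D = D' := by
  ext1 x
  have hs : (L.FLt s).1 ∈ c.chart.source := h
  apply tg_mc_injective c hs
  have h1 := congrArg (fun T : VM m →L[ℝ] PSpace m N => T (c.blin s.1 h x)) hD
  simpa only [secC_apply c s h, ContinuousLinearEquiv.symm_apply_apply] using h1

theorem comp_fst_iff (c : AdaptedChart L.bundle) (s : J1 L.bundle) (h : s.1 ∈ c.chart.source)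
    (D : VM m →L[ℝ] MpiSpace m N) :
    (tg (MpiSpace m N) (VE m N) (fun q : Mpi L.bundle => q.1) (L.FLt s)).comp D = s.2.1 ↔
      ∀ x, (L.secC c s D x).1 = (x, (jc c s).2 x) := by
  have hs : (L.FLt s).1 ∈ c.chart.source := h
  have key : ∀ x, (L.secC c s D (c.blin s.1 h x)).1 = c.lin s.1 h
      (tg (MpiSpace m N) (VE m N) (fun q : Mpi L.bundle => q.1) (L.FLt s) (D x)) := by
    intro x
    rw [secC_apply c s h, ContinuousLinearEquiv.symm_apply_apply]
    exact tg_mc_fst c (L.FLt s) hs (D x)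
  constructor
  · intro h1 x
    obtain ⟨y, rfl⟩ := (c.blin s.1 h).surjective x
    rw [key, ← lin_jet c s h, ← h1]
    rfl
  · intro h1
    ext1 x
    apply (c.lin s.1 h).injective
    rw [lin_jet c s h, ← h1, key]
    rfl

/-- A test vector from the image of `T FLt` enters the contraction through its momenta only in the
combination `dp + dπ(v)`, which `fderiv_leg_energy` expresses by its `E`-component `(a, z)`. Taking
`a = 0` gives the divergence of the momenta, taking `z = v a` gives the energy component. -/
theorem isFieldSection_iff (c : AdaptedChart L.bundle) (s s₀ : J1 L.bundle)
    (h : s.1 ∈ c.chart.source) (D : VM m →L[ℝ] MpiSpace m N) :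
    L.IsFieldSection s D ↔ (∀ x, (L.secC c s D x).1 = (x, (jc c s).2 x)) ∧
      ∀ (a : VM m) (z : VM N), (L.secC c s D a).2.1 + (L.secC c s D a).2.2 (jc c s).2 +
        ∑ i, (L.secC c s D (eb i)).2.2 (tens i (z - (jc c s).2 a)) =
          fderiv ℝ (L.lam c s₀) (jc c s) ((a, z), 0) := by
  have hs : (L.FLt s).1 ∈ c.chart.source := h
  have hlam := L.contDiffAt_lam c s₀ (L.jc_mem c s h)
  rw [show L.IsFieldSection s D ↔ _ ∧ _ from ⟨fun h => ⟨h.1, h.2⟩, fun h => ⟨h.1, h.2⟩⟩,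
    comp_fst_iff c s h]
  refine and_congr_right fun hfst => ?_
  have key : ∀ w : J1Space m N, L.ΩAt (L.FLt s) (Fin.cons
      (tg (J1Space m N) (MpiSpace m N) L.FLt s w) fun i => D ((c.blin s.1 h).symm (eb i))) =
      ((L.secC c s D (tg (J1Space m N) (J1Space m N) (jc c) s w).1.1).2.1 +
        (L.secC c s D (tg (J1Space m N) (J1Space m N) (jc c) s w).1.1).2.2 (jc c s).2 +
        ∑ i, (L.secC c s D (eb i)).2.2 (tens i ((tg (J1Space m N) (J1Space m N) (jc c) s w).1.2 -
          (jc c s).2 (tg (J1Space m N) (J1Space m N) (jc c) s w).1.1))) -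
          fderiv ℝ (L.lam c s₀) (jc c s) ((tg (J1Space m N) (J1Space m N) (jc c) s w).1, 0) := by
    intro w
    set p := tg (J1Space m N) (J1Space m N) (jc c) s w with hp
    have hW : ∀ i, tg (MpiSpace m N) (PSpace m N) (mc c) (L.FLt s)
        (D ((c.blin s.1 h).symm (eb i))) = L.secC c s D (eb i) := fun i =>
      (secC_apply c s h D (eb i)).symm
    rw [L.ΩAt_graph c (L.FLt s) hs _ _ (jc c s).2 (fun i => by rw [hW, hfst]; rfl)
      (L.tg_mc_FLt c s h s₀ w) hW, fderiv_leg_energy hlam, fderiv_leg_fst hlam, ← hp,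
      Finset.sum_add_distrib]
    congr 2
    -- The sum over the basis is the value at the base component of the test vector of this linear
    -- functional, the energy combination of the section.
    let T : VM m →L[ℝ] ℝ := ((ContinuousLinearMap.fst ℝ ℝ (J1Model m N →L[ℝ] ℝ)) +
      (ContinuousLinearMap.apply ℝ ℝ (jc c s).2).comp
        (ContinuousLinearMap.snd ℝ ℝ (J1Model m N →L[ℝ] ℝ))).comp
      ((ContinuousLinearMap.snd ℝ (VE m N) (ℝ × (J1Model m N →L[ℝ] ℝ))).comp (L.secC c s D))
    have hT : ∀ a, T a = (L.secC c s D a).2.1 + (L.secC c s D a).2.2 (jc c s).2 := fun a => rfl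
    rw [← hT]
    conv_rhs => rw [← sum_eb p.1.1, map_sum]
    refine Finset.sum_congr rfl fun i _ => ?_
    rw [map_smul, smul_eq_mul, hT]
  have hu : (ιMulti ℝ m (eb : Fin m → VM m)) ≠ 0 := by
    obtain ⟨ν, hν⟩ := exists_stdVol m
    exact ne_zero_of_pair_eq_one (ν := ν) (by rw [pair_ιMulti, hν])
  constructor
  · intro h1 a z
    -- The jet component of the test vector does not affect the equation, so it is taken to be zero.
    have h2 := (contractMV_wmap_eq_zero_iff D (c.blin s.1 h) hu _ _).1 (h1 _
      (tg (J1Space m N) (J1Space m N) (jetChart c s).symm (jc c s) ((a, z), 0)))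
    rw [key] at h2
    have h3 : tg (J1Space m N) (J1Space m N) (jc c) s
        (tg (J1Space m N) (J1Space m N) (jetChart c s).symm (jc c s) ((a, z), 0)) = ((a, z), 0) :=
      (isSmoothChart_jetChart c s).tg_tg_symm' (x := s) h _
    rw [h3] at h2
    exact sub_eq_zero.1 h2
  · intro h1 u w
    by_cases hu0 : u = 0
    · rw [hu0, map_zero, contractMV, map_zero, mul_zero]
    · rw [contractMV_wmap_eq_zero_iff D (c.blin s.1 h) hu0, key]
      exact sub_eq_zero.2 (h1 _ _)

/-- A section that satisfies the field equation is determined by its restricted momenta. -/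
theorem IsFieldSection.eq_of_comp_mu {s : J1 L.bundle} {D D' : VM m →L[ℝ] MpiSpace m N}
    (hD : (tg (MpiSpace m N) (VE m N) (fun q : Mpi L.bundle => q.1) (L.FLt s)).comp D = s.2.1)
    (hD' : L.IsFieldSection s D')
    (h : (tg (MpiSpace m N) (J1sSpace m N) (mu L.bundle) (L.FLt s)).comp D =
      (tg (MpiSpace m N) (J1sSpace m N) (mu L.bundle) (L.FLt s)).comp D')
    (hw : ∀ x, ∃ w, D x = tg (J1Space m N) (MpiSpace m N) L.FLt s w) : D = D' := by
  obtain ⟨c, hc⟩ := exists_adaptedChart L.bundle s.1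
  have hs : (L.FLt s).1 ∈ c.chart.source := hc
  have hlam := L.contDiffAt_lam c s (L.jc_mem c s hc)
  have h1 := (comp_fst_iff c s hc D).1 hD
  have h2 := (isFieldSection_iff c s s hc D').1 hD'
  have h3 : ∀ x, (L.secC c s D x).2.2 = (L.secC c s D' x).2.2 := by
    intro x
    have h4 := congrArg (fun T : VM m →L[ℝ] J1sSpace m N =>
      tg (J1sSpace m N) (VE m N × (J1Model m N →L[ℝ] ℝ)) (rc c) (mu L.bundle (L.FLt s))
        (T ((c.blin s.1 hc).symm x))) h
    have h5 : ∀ C : VM m →L[ℝ] MpiSpace m N,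
        (tg (J1sSpace m N) (VE m N × (J1Model m N →L[ℝ] ℝ)) (rc c) (mu L.bundle (L.FLt s))
        (((tg (MpiSpace m N) (J1sSpace m N) (mu L.bundle) (L.FLt s)).comp C)
          ((c.blin s.1 hc).symm x))).2 = (L.secC c s C x).2.2 := by
      intro C
      rw [secC_apply c s hc]
      exact congrArg Prod.snd (tg_rc_mu c (L.FLt s) hs _)
    rw [← h5, ← h5]
    exact congrArg Prod.snd h4
  refine secC_injective c s hc ?_
  ext1 x
  refine Prod.ext ?_ (Prod.ext ?_ (h3 x))
  · rw [h1, h2.1]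
  -- The energy component of `D` is fixed by tangency to the image of `FLt`, that of `D'` by the
  -- field equation with `z = v x`. Both rules give the same value because the momenta agree.
  · obtain ⟨w, hw⟩ := hw ((c.blin s.1 hc).symm x)
    have h4 : L.secC c s D x = fderiv ℝ (leg (L.lam c s)) (jc c s)
        (tg (J1Space m N) (J1Space m N) (jc c) s w) := by
      rw [secC_apply c s hc, hw, L.tg_mc_FLt c s hc s]
    have h5 := fderiv_leg_energy hlam (tg (J1Space m N) (J1Space m N) (jc c) s w)
    have h6 := h1 x
    rw [← h4] at h5
    rw [h4, fderiv_leg_fst hlam] at h6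
    rw [h6] at h5
    have h7 := h2.2 x ((jc c s).2 x)
    simp only [sub_self, tens_zero, map_zero, Finset.sum_const_zero, add_zero] at h7
    rw [h3 x] at h5
    exact add_right_cancel (h5.trans h7.symm)

set_option maxHeartbeats 1000000 in
/-- The values of extended operators come from sections that satisfy the field equation. -/
theorem IsExtendedOperator.exists_section {K : ∀ s : J1 L.bundle, MVector m (MpiSpace m N) (L.FLt s)}
    (hK : L.IsExtendedOperator K) (s : J1 L.bundle) :
    ∃ D, L.IsFieldSection s D ∧ ∃ u : ⋀[ℝ]^m (VM m), mv (K s) = wmap m D u := by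
  obtain ⟨U, hU, X, -, hX⟩ := hK.decomposable s
  obtain ⟨e, he⟩ := hK.semiholonomic s
  have hk := (congrArg mv (hX s (mem_of_mem_nhds hU))).trans (mv_ιMulti (V := MpiSpace m N) _)
  have hcomp : tg (MpiSpace m N) (VM m) (fun q : Mpi L.bundle => L.bundle.proj q.1) (L.FLt s) =
      (L.bundle.dproj s.1).comp (tg (MpiSpace m N) (VE m N)
        (fun q : Mpi L.bundle => q.1) (L.FLt s)) :=
    tg_comp (g := L.bundle.proj) (L.bundle.contMDiff_proj _) (smoothAt_mpi_fst (L.FLt s))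
  have htr : pair (L.volAt (L.bundle.proj s.1)) (wmap m ((L.bundle.dproj s.1).comp
      (tg (MpiSpace m N) (VE m N) (fun q : Mpi L.bundle => q.1) (L.FLt s))) (mv (K s))) ≠ 0 := by
    intro h
    rw [← hcomp] at h
    refine hK.transverse s ((pair_mv (L.volAt (L.bundle.proj s.1)) _).trans ?_)
    exact (congrArg (pair (L.volAt (L.bundle.proj s.1)))
      (mv_wedgeT (f := fun q : Mpi L.bundle => L.bundle.proj q.1) (K s))).trans h
  -- The semi-holonomy condition is formed with the algebraic structures of tangent spaces; here it
  -- is moved to the model spaces.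
  have h1 := mv_eq_wmap (W := VE m N) (wedgeT m (MpiSpace m N) (VE m N)
    (fun q : Mpi L.bundle => tau1 L.bundle (mu L.bundle q)) (L.FLt s) (K s)) s.2.1 _ _ _ _
    (show VM m →L[ℝ] VE m N from s.2.1).toLinearMap e (heq_of_eq he) rfl HEq.rfl rfl HEq.rfl fun _ => rfl
  refine h1.elim fun e' he' => ?_
  have h2 := (mv_wedgeT (W := VE m N) (f := fun q : Mpi L.bundle => q.1) (K s)).symm.trans he'
  refine (exists_section_of_multivector s.2.2 hk htr h2).elim fun D hD => hD.2.elim fun u hu => ?_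
  refine ⟨D, ⟨hD.1, fun u' w => hu.2 _ _ ?_ u'⟩, u, hu.1⟩
  exact (contractMV_mv (K s) (L.ΩAt (L.FLt s)) _).symm.trans (hK.field_eq s w)

/-! ### Prolongations -/

/-- Tangent maps, expressed in charts, depend smoothly on the point. -/
theorem smoothAt_tg_chart {V W V' W' X Y : Type*} [NormedAddCommGroup V] [NormedSpace ℝ V]
    [NormedAddCommGroup W] [NormedSpace ℝ W] [NormedAddCommGroup V'] [NormedSpace ℝ V']
    [NormedAddCommGroup W'] [NormedSpace ℝ W'] [TopologicalSpace X] [ChartedSpace V X]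
    [TopologicalSpace Y] [ChartedSpace W Y] {e : OpenPartialHomeomorph X V'} {g : Y → W'}
    (he : IsSmoothChart V e) {f : X → Y} {x : X} (hx : x ∈ e.source)
    (hf : ∀ᶠ x' in 𝓝 x, SmoothAt V W f x') (hg : ∀ᶠ x' in 𝓝 x, SmoothAt W W' g (f x')) :
    SmoothAt V (V' →L[ℝ] W') (fun x' => (tg W W' g (f x')).comp
      ((tg V W f x').comp (tg V' V e.symm (e x')))) x := by
  have h1 : ∀ᶠ x' in 𝓝 x, SmoothAt V' W' (fun p => g (f (e.symm p))) (e x') ∧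
      (tg W W' g (f x')).comp ((tg V W f x').comp (tg V' V e.symm (e x'))) =
        fderiv ℝ (fun p => g (f (e.symm p))) (e x') := by
    filter_upwards [hf, hg, e.open_source.mem_nhds hx] with x' h1 h2 h3
    have h4 := he.smoothAt_comp_symm h3 h1
    have h5 : f (e.symm (e x')) = f x' := by rw [e.left_inv h3]
    refine ⟨SmoothAt.comp_of_eq (g := g) (f := fun p => f (e.symm p)) h5 h2 h4, ?_⟩
    rw [← tg_eq_fderiv, tg_comp_of_eq (g := g) (f := fun p => f (e.symm p)) h5 h2 h4,
      tg_comp_of_eq (g := f) (e.left_inv h3) h1 (he.at_target (e.map_source h3))]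
  have h2 : SmoothAt V' (V' →L[ℝ] W') (fderiv ℝ (fun p => g (f (e.symm p)))) (e x) :=
    ((contMDiffAt_iff_contDiffAt.1 h1.self_of_nhds.1).fderiv_right (m := ∞) (by simp)).contMDiffAt
  have h3 : SmoothAt V (V' →L[ℝ] W') (fun x' => fderiv ℝ (fun p => g (f (e.symm p))) (e x')) x :=
    SmoothAt.comp_of_eq rfl h2 (he.at_source hx)
  refine ContMDiffAt.congr_of_eventuallyEq h3 ?_
  filter_upwards [h1] with x' hx' using hx'.2

/-- In natural coordinates the jet coordinates of a prolongation are derivatives of the coordinate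
expression of the section. -/
theorem contMDiff_j1 {φ : M → E} (hφ : IsSmoothSection (VM m) (VE m N) L.bundle.proj φ) :
    ContMDiff 𝓘(ℝ, VM m) 𝓘(ℝ, J1Space m N) ∞ (j1 L.bundle φ hφ) := by
  intro x
  obtain ⟨c, hc⟩ := exists_adaptedChart L.bundle (φ x)
  have hmem : ∀ᶠ x' in 𝓝 x, φ x' ∈ c.chart.source :=
    hφ.1.continuous.continuousAt.preimage_mem_nhds (c.chart.open_source.mem_nhds hc)
  have hx : x ∈ c.base.source := by
    have := c.proj_mem _ hc
    rwa [hφ.2] at this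
  refine (isSmoothChart_jetChart c (j1 L.bundle φ hφ x)).smoothAt_of_chart hmem ?_
  have h1 := smoothAt_tg_chart (W := VE m N) (g := c.chart) (f := φ) c.isSmoothChart_base hx
    (Filter.Eventually.of_forall fun x' => hφ.1 x')
    (hmem.mono fun x' h => c.isSmoothChart.at_source h)
  have h2 : SmoothAt (VM m) (VE m N) (fun x' => c.chart (φ x')) x :=
    SmoothAt.comp_of_eq rfl (c.isSmoothChart.at_source hc) (hφ.1 x)
  have h3 : SmoothAt (VM m) (J1Model m N) (fun x' => (ContinuousLinearMap.snd ℝ (VM m) (VM N)).comp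
      ((tg (VE m N) (VE m N) c.chart (φ x')).comp ((tg (VM m) (VE m N) φ x').comp
        (tg (VM m) (VM m) c.base.symm (c.base x'))))) x :=
    SmoothAt.comp_of_eq (g := fun T : VM m →L[ℝ] VE m N =>
      (ContinuousLinearMap.snd ℝ (VM m) (VM N)).comp T) rfl
      (contDiff_const.clm_comp contDiff_id).contMDiff.contMDiffAt h1
  refine ContMDiffAt.congr_of_eventuallyEq (h2.prodMk_space h3) ?_
  filter_upwards [hmem] with x' hx'
  have hx'' : (j1 L.bundle φ hφ x').1 ∈ c.chart.source := hx'
  rw [jetChart_apply, jc_of_mem c _ hx'']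
  refine Prod.ext rfl ?_
  have h4 := c.blin_symm_eq (φ x') hx'
  rw [hφ.2] at h4
  change ((ContinuousLinearMap.snd ℝ (VM m) (VM N)).comp
    (c.lin (φ x') hx' : VE m N →L[ℝ] VE m N)).comp ((tg (VM m) (VE m N) φ x').comp
      ((c.blin (φ x') hx').symm : VM m →L[ℝ] VM m)) = _
  rw [h4]
  rfl

theorem j1_congr {φ φ' : M → E} (h : φ = φ')
    (hφ : IsSmoothSection (VM m) (VE m N) L.bundle.proj φ)
    (hφ' : IsSmoothSection (VM m) (VE m N) L.bundle.proj φ') :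
    j1 L.bundle φ hφ = j1 L.bundle φ' hφ' := by
  subst h; rfl

end LagrangianSystem

/-! ### Sections of the Legendre image that are related to an extended operator. -/

namespace LagrangianSystem

open exteriorPower

variable [IsManifold 𝓘(ℝ, VM m) ∞ M] [IsManifold 𝓘(ℝ, VM N) ∞ F]
  {L : LagrangianSystem m N M E F}

section relations

variable {W Y : Type*} [NormedAddCommGroup W] [NormedSpace ℝ W] [TopologicalSpace Y]
  [ChartedSpace W Y]

/-- Multiples of multivectors of a normed space. -/
def scale (r : ℝ) (k : ModelMultivector m W) : ModelMultivector m W := r • k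

theorem scale_wmap {V : Type*} [NormedAddCommGroup V] [NormedSpace ℝ V] (r : ℝ) (D : V →L[ℝ] W)
    (u : ModelMultivector m V) : scale r (wmap m D u) = wmap m D (r • u) := (map_smul _ _ _).symm

theorem wmap_scale {V : Type*} [NormedAddCommGroup V] [NormedSpace ℝ V] (r : ℝ) (D : V →L[ℝ] W)
    (k : ModelMultivector m V) : wmap m D (scale r k) = scale r (wmap m D k) := map_smul _ _ _

theorem mv_smul {y : Y} (r : ℝ) (k : MVector m W y) : mv (r • k) = scale r (mv k) := map_smul _ _ _

variable (L) in
theorem exists_pair_eq_one (x : M) : ∃ u : ⋀[ℝ]^m (VM m), pair (L.volAt x) u = 1 := by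
  have h : L.volAt x eb ≠ 0 := fun h => L.vol_ne_zero x (eq_zero_of_apply_eb h)
  refine ⟨(L.volAt x eb)⁻¹ • ιMulti ℝ m eb, ?_⟩
  rw [map_smul, pair_ιMulti, smul_eq_mul, inv_mul_cancel₀ h]

theorem forall_pair_eq_one {x : M} {p : ⋀[ℝ]^m (VM m) → Prop} :
    (∀ u : MVector m (VM m) x, pair (L.vol x) u = 1 → p (mv u)) ↔
      ∀ u : ⋀[ℝ]^m (VM m), pair (L.volAt x) u = 1 → p u := by
  constructor
  · intro h u hu
    have h1 := h (mvAt x u) ((pair_mv (L.volAt x) (mvAt x u)).trans (by rw [mv_mvAt]; exact hu))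
    rwa [mv_mvAt] at h1
  · intro h u hu
    exact h _ ((pair_mv (L.volAt x) u).symm.trans hu)

theorem relation_iff {Φ : J1 L.bundle → Y} {K : ∀ s, MVector m W (Φ s)} {f : J1 L.bundle → ℝ}
    {ψ : M → Y} {j : M → J1 L.bundle} : L.Relation Φ K f ψ j ↔
      ∀ (x : M) (u : ⋀[ℝ]^m (VM m)), pair (L.volAt x) u = 1 →
        ψ x = Φ (j x) ∧ wmap m (tg (VM m) W ψ x) u = scale (f (j x)) (mv (K (j x))) := by
  refine forall_congr' fun x => ?_
  rw [← forall_pair_eq_one]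
  refine forall_congr' fun u => imp_congr_right fun _ => ?_
  rw [mvector_eq_iff, mv_wedgeT, mv_smul]

theorem isIntegralSection_iff {X : ∀ y : Y, MVector m W y} {ψ : M → Y} :
    L.IsIntegralSection X ψ ↔ ∃ f : Y → ℝ, IsNonvanishing W f ∧
      ∀ (x : M) (u : ⋀[ℝ]^m (VM m)), pair (L.volAt x) u = 1 →
        wmap m (tg (VM m) W ψ x) u = scale (f (ψ x)) (mv (X (ψ x))) := by
  refine exists_congr fun f => and_congr_right fun _ => forall_congr' fun x => ?_
  rw [← forall_pair_eq_one]
  refine forall_congr' fun u => imp_congr_right fun _ => ?_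
  rw [← mv_wedgeT, ← mv_smul, mv_injective.eq_iff]

end relations

theorem mv_restrict (K : ∀ s : J1 L.bundle, MVector m (MpiSpace m N) (L.FLt s)) (s : J1 L.bundle) :
    mv (L.restrict K s) = wmap m (tg (MpiSpace m N) (J1sSpace m N) (mu L.bundle) (L.FLt s))
      (mv (K s)) := by
  unfold restrict FL
  exact mv_wedgeT _

theorem jet_ext {s s' : J1 L.bundle} (h1 : s.1 = s'.1) (h2 : s.2.1 = s'.2.1) : s = s' := by
  obtain ⟨y, γ⟩ := s
  obtain ⟨y', γ'⟩ := s'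
  cases h1
  exact congrArg (Sigma.mk y) (Subtype.ext h2)

namespace AlmostRegular

variable [IsManifold 𝓘(ℝ, VE m N) ∞ E]
  {VP P : Type*} [NormedAddCommGroup VP] [NormedSpace ℝ VP] [FiniteDimensional ℝ VP]
  [TopologicalSpace P] [ChartedSpace VP P] [IsManifold 𝓘(ℝ, VP) ∞ P] {A : L.AlmostRegular VP P}

variable (A) in
theorem exists_tg_FL₀ (s : J1 L.bundle) (y : VP) :
    ∃ w : J1Space m N, tg (J1Space m N) VP A.FL₀ s w = y := A.FL₀_submersion s y

variable {ψ₀ : M → P} (hψ₀ : IsSmoothSection (VM m) VP A.toBase ψ₀)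
include hψ₀

/-- The section of the configuration bundle under a section of the Legendre image. -/
abbrev jet : M → J1 L.bundle := j1 L.bundle _ (isSmoothSection_phi hψ₀)

theorem tg_lift_comp (x : M) : tg (VM m) (MpiSpace m N) (fun x => A.lift (ψ₀ x)) x =
    (tg VP (MpiSpace m N) A.lift (ψ₀ x)).comp (tg (VM m) VP ψ₀ x) :=
  tg_comp (A.smoothAt_lift _) (hψ₀.1 x)

theorem smoothAt_lift_comp (x : M) : SmoothAt (VM m) (MpiSpace m N) (fun x => A.lift (ψ₀ x)) x :=
  SmoothAt.comp_of_eq rfl (A.smoothAt_lift _) (hψ₀.1 x)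

theorem tg_incl_comp (x : M) : tg (VM m) (J1sSpace m N) (fun x => A.incl (ψ₀ x)) x =
    (tg (MpiSpace m N) (J1sSpace m N) (mu L.bundle) (A.lift (ψ₀ x))).comp
      (tg (VM m) (MpiSpace m N) (fun x => A.lift (ψ₀ x)) x) := by
  have h := tg_comp (g := mu L.bundle) (f := fun x => A.lift (ψ₀ x)) (smoothAt_mu (A.lift (ψ₀ x))) (smoothAt_lift_comp hψ₀ x)
  have h2 : (fun x => mu L.bundle (A.lift (ψ₀ x))) = fun x => A.incl (ψ₀ x) :=
    funext fun x => A.mu_lift _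
  rw [h2] at h
  exact h

theorem tg_incl_comp' (x : M) : tg (VM m) (J1sSpace m N) (fun x => A.incl (ψ₀ x)) x =
    (tg VP (J1sSpace m N) A.incl (ψ₀ x)).comp (tg (VM m) VP ψ₀ x) :=
  tg_comp (A.incl_smooth _) (hψ₀.1 x)

theorem fst_comp_tg_lift (x : M) :
    (tg (MpiSpace m N) (VE m N) (fun q : Mpi L.bundle => q.1) (A.lift (ψ₀ x))).comp
      (tg (VM m) (MpiSpace m N) (fun x => A.lift (ψ₀ x)) x) = (jet hψ₀ x).2.1 := by
  have h := tg_comp (g := fun q : Mpi L.bundle => q.1) (f := fun x => A.lift (ψ₀ x))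
    (smoothAt_mpi_fst (A.lift (ψ₀ x))) (smoothAt_lift_comp hψ₀ x)
  have h2 : (fun x => (A.lift (ψ₀ x)).1) = fun x => tau1 L.bundle (A.incl (ψ₀ x)) :=
    funext fun x => tau1_mu_lift _
  rw [h2] at h
  exact h.symm

/-- `T FL₀` is onto, so every tangent vector of the lifted section comes from a vector at the jet.
This is the tangency hypothesis of `IsFieldSection.eq_of_comp_mu`. -/
theorem exists_tg_FLt (x : M) {s : J1 L.bundle} (hs : ψ₀ x = A.FL₀ s) (y : VM m) :
    ∃ w, tg (VM m) (MpiSpace m N) (fun x => A.lift (ψ₀ x)) x y =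
      tg (J1Space m N) (MpiSpace m N) L.FLt s w := by
  obtain ⟨w, hw⟩ := A.exists_tg_FL₀ s (tg (VM m) VP ψ₀ x y)
  refine ⟨w, ?_⟩
  rw [tg_lift_comp hψ₀, ← A.tg_lift_FL₀, hw, ← hs]
  rfl

theorem eq_FL₀_of_incl_eq {x : M} {s : J1 L.bundle} (h : A.incl (ψ₀ x) = L.FL s) :
    ψ₀ x = A.FL₀ s := A.incl_injective (h.trans (A.incl_FL₀ s).symm)

/-- The relation for the restricted operator determines the lifted section. -/
theorem relation_lift {K : ∀ s : J1 L.bundle, MVector m (MpiSpace m N) (L.FLt s)}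
    (hK : L.IsExtendedOperator K) {x : M} {u : ⋀[ℝ]^m (VM m)} (hu : pair (L.volAt x) u = 1) {r : ℝ}
    (h1 : A.incl (ψ₀ x) = L.FL (jet hψ₀ x))
    (h2 : wmap m (tg (VM m) (J1sSpace m N) (fun x => A.incl (ψ₀ x)) x) u =
      scale r (mv (L.restrict K (jet hψ₀ x)))) :
    A.lift (ψ₀ x) = L.FLt (jet hψ₀ x) ∧
      L.IsFieldSection (jet hψ₀ x) (tg (VM m) (MpiSpace m N) (fun x => A.lift (ψ₀ x)) x) ∧
      wmap m (tg (VM m) (MpiSpace m N) (fun x => A.lift (ψ₀ x)) x) u =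
        scale r (mv (K (jet hψ₀ x))) := by
  have hu0 := ne_zero_of_pair_eq_one hu
  set s := jet hψ₀ x with hs
  have h3 : ψ₀ x = A.FL₀ s := eq_FL₀_of_incl_eq hψ₀ h1
  have h4 : A.lift (ψ₀ x) = L.FLt s := by rw [h3, A.lift_FL₀]
  obtain ⟨D', hD', u', hu'⟩ := hK.exists_section s
  have hfst := fst_comp_tg_lift hψ₀ x
  rw [tg_incl_comp hψ₀, mv_restrict, hu', ← wmap_comp, scale_wmap] at h2
  rw [h4] at h2 hfst
  rw [← hs] at hfst
  set D := tg (VM m) (MpiSpace m N) (fun x => A.lift (ψ₀ x)) x with hD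
  have hQ : tg (MpiSpace m N) (VM m) (fun q : Mpi L.bundle => L.bundle.proj q.1) (L.FLt s) =
      (tg (J1sSpace m N) (VM m) (fun r : J1s L.bundle => L.bundle.proj (tau1 L.bundle r))
        (mu L.bundle (L.FLt s))).comp
        (tg (MpiSpace m N) (J1sSpace m N) (mu L.bundle) (L.FLt s)) :=
    tg_comp (g := fun r : J1s L.bundle => L.bundle.proj (tau1 L.bundle r))
      ((L.bundle.contMDiff_proj.comp (contMDiff_tau1 L.bundle)) _) (smoothAt_mu (L.FLt s))
  have hQ' : tg (MpiSpace m N) (VM m) (fun q : Mpi L.bundle => L.bundle.proj q.1) (L.FLt s) =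
      (L.bundle.dproj s.1).comp (tg (MpiSpace m N) (VE m N)
        (fun q : Mpi L.bundle => q.1) (L.FLt s)) :=
    tg_comp (g := L.bundle.proj) (L.bundle.contMDiff_proj _) (smoothAt_mpi_fst (L.FLt s))
  set T := tg (MpiSpace m N) (J1sSpace m N) (mu L.bundle) (L.FLt s) with hT
  set Q := tg (J1sSpace m N) (VM m) (fun r : J1s L.bundle => L.bundle.proj (tau1 L.bundle r))
        (mu L.bundle (L.FLt s)) with hQdef
  -- Any lift of the jet stays, after applying `Tμ`, a section of the projection to the base. This
  -- holds for the tangent map of the lifted section and for the section behind `K`.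
  have hid : ∀ C : VM m →L[ℝ] MpiSpace m N, (tg (MpiSpace m N) (VE m N)
      (fun q : Mpi L.bundle => q.1) (L.FLt s)).comp C = s.2.1 → Q.comp (T.comp C) = .id ℝ _ := by
    intro C hC
    rw [← ContinuousLinearMap.comp_assoc, ← hQ, hQ', ContinuousLinearMap.comp_assoc, hC]
    exact s.2.2
  -- Projecting the relation to the base identifies the two `m`-vectors of the base.
  have h5 : u = r • u' := by
    have h6 := congrArg (wmap m Q) h2
    rwa [← wmap_comp, ← wmap_comp, hid D hfst, hid D' hD'.comp_fst, wmap_id, wmap_id] at h6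
  rw [← h5] at h2
  have h7 : D = D' := IsFieldSection.eq_of_comp_mu hfst hD'
    (section_eq_of_wmap_eq (hid D hfst) (hid D' hD'.comp_fst) hu0 h2)
    (exists_tg_FLt hψ₀ x h3)
  refine ⟨h4, by rw [h7]; exact hD', ?_⟩
  rw [h7, hu', scale_wmap, ← h5]

theorem relation_iff_relation_lift {K : ∀ s : J1 L.bundle, MVector m (MpiSpace m N) (L.FLt s)}
    (hK : L.IsExtendedOperator K) (f : J1 L.bundle → ℝ) :
    L.Relation L.FL (L.restrict K) f (A.incl ∘ ψ₀) (jet hψ₀) ↔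
      L.Relation L.FLt K f (A.lift ∘ ψ₀) (jet hψ₀) := by
  rw [relation_iff, relation_iff]
  refine forall_congr' fun x => forall_congr' fun u => imp_congr_right fun hu =>
    ⟨fun h => ?_, fun h => ?_⟩
  · have h1 := relation_lift hψ₀ hK hu h.1 h.2
    exact ⟨h1.1, h1.2.2⟩
  · have h1 : A.lift (ψ₀ x) = L.FLt (jet hψ₀ x) := h.1
    have h2 : wmap m (tg (VM m) (MpiSpace m N) (fun x => A.lift (ψ₀ x)) x) u =
        scale (f (jet hψ₀ x)) (mv (K (jet hψ₀ x))) := h.2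
    refine ⟨?_, ?_⟩
    · change A.incl (ψ₀ x) = mu L.bundle (L.FLt (jet hψ₀ x))
      rw [← h1, A.mu_lift]
    · have h3 := tg_incl_comp hψ₀ x
      rw [h1] at h3
      change wmap m (tg (VM m) (J1sSpace m N) (fun x => A.incl (ψ₀ x)) x) u = _
      rw [h3, wmap_comp, h2, wmap_scale, mv_restrict]

/-- Sections that are related to an extended operator solve the Hamiltonian problem. -/
theorem solvesHamilton_of_relation {K : ∀ s : J1 L.bundle, MVector m (MpiSpace m N) (L.FLt s)}
    (hK : L.IsExtendedOperator K) {f : J1 L.bundle → ℝ}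
    (h : L.Relation L.FL (L.restrict K) f (A.incl ∘ ψ₀) (jet hψ₀)) : A.SolvesHamilton ψ₀ := by
  intro X _ x v
  obtain ⟨u, hu⟩ := L.exists_pair_eq_one x
  have h1 := relation_iff.1 h x u hu
  obtain ⟨h2, h3, -⟩ := relation_lift hψ₀ hK hu h1.1 h1.2
  have h4 : ψ₀ x = A.FL₀ (jet hψ₀ x) := eq_FL₀_of_incl_eq hψ₀ h1.1
  set s := jet hψ₀ x with hs
  -- The field equation is known only on the image of `T FLt`, which contains the image of `T lift`
  -- at this point.
  obtain ⟨w, hw⟩ : ∃ w : J1Space m N, tg (J1Space m N) (MpiSpace m N) L.FLt s w =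
      tg VP (MpiSpace m N) A.lift (ψ₀ x) (X (ψ₀ x)) := by
    have h5 : ∀ y : VP, ∃ w : J1Space m N, tg (J1Space m N) (MpiSpace m N) L.FLt s w =
        tg VP (MpiSpace m N) A.lift (ψ₀ x) y := by
      intro y
      obtain ⟨w, hw⟩ := A.exists_tg_FL₀ s y
      exact ⟨w, by rw [← A.tg_lift_FL₀, hw, ← h4]⟩
    exact h5 (X (ψ₀ x))
  let v' : Fin m → VM m := v
  have h6 := h3.field (ιMulti ℝ m v') w
  rw [wmap_ιMulti, contractMV_ιMulti, hw, ← h2, tg_lift_comp hψ₀] at h6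
  have h7 := (mul_eq_zero.1 h6).resolve_left (by simp)
  refine Eq.trans ?_ h7
  change L.ΩAt (A.lift (ψ₀ x)) _ = _
  congr 1
  funext i
  refine Fin.cases ?_ (fun i => ?_) i <;> rfl

/-- The restricted relation determines the jet. -/
theorem jet_eq_of_relation {K : ∀ s : J1 L.bundle, MVector m (MpiSpace m N) (L.FLt s)}
    (hK : L.IsExtendedOperator K) {x : M} {u : ⋀[ℝ]^m (VM m)} (hu : pair (L.volAt x) u = 1) {r : ℝ}
    {s : J1 L.bundle} (h1 : ψ₀ x = A.FL₀ s)
    (h2 : wmap m (tg (VM m) (J1sSpace m N) (fun x => A.incl (ψ₀ x)) x) u =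
      scale r (mv (L.restrict K s))) : s = jet hψ₀ x := by
  have hu0 := ne_zero_of_pair_eq_one hu
  have h3 : A.incl (ψ₀ x) = mu L.bundle (L.FLt s) := by rw [h1, A.incl_FL₀]; rfl
  have h4 : (jet hψ₀ x).1 = s.1 := congrArg (tau1 L.bundle) h3
  obtain ⟨D', hD', u', hu'⟩ := hK.exists_section s
  have h5 : tg (VM m) (VE m N) (fun x => tau1 L.bundle (A.incl (ψ₀ x))) x =
      (tg (J1sSpace m N) (VE m N) (tau1 L.bundle) (mu L.bundle (L.FLt s))).comp
        (tg (VM m) (J1sSpace m N) (fun x => A.incl (ψ₀ x)) x) :=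
    tg_comp_of_eq (g := tau1 L.bundle) (f := fun x => A.incl (ψ₀ x)) h3
      (contMDiff_tau1 L.bundle _) (SmoothAt.comp_of_eq rfl (A.incl_smooth _) (hψ₀.1 x))
  have h6 : tg (MpiSpace m N) (VE m N) (fun q : Mpi L.bundle => q.1) (L.FLt s) =
      (tg (J1sSpace m N) (VE m N) (tau1 L.bundle) (mu L.bundle (L.FLt s))).comp
        (tg (MpiSpace m N) (J1sSpace m N) (mu L.bundle) (L.FLt s)) :=
    tg_comp (g := tau1 L.bundle) (f := mu L.bundle) (contMDiff_tau1 L.bundle _)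
      (smoothAt_mu (L.FLt s))
  have h7 : (jet hψ₀ x).2.1 = tg (VM m) (VE m N) (fun x => tau1 L.bundle (A.incl (ψ₀ x))) x := rfl
  -- After projection to `E` the relation compares the plane of the jet of the section with the
  -- plane of `s`, by semi-holonomy.
  have h8 : wmap m (jet hψ₀ x).2.1 u = wmap m s.2.1 (r • u') := by
    rw [h7, h5, wmap_comp, h2, mv_restrict, hu', ← wmap_comp, scale_wmap, ← wmap_comp,
      ← hD'.comp_fst, ← ContinuousLinearMap.comp_assoc, ← h6]
  have h9 : (L.bundle.dproj s.1).comp (jet hψ₀ x).2.1 = .id ℝ (VM m) := by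
    rw [← h4]; exact (jet hψ₀ x).2.2
  have h10 : u = r • u' := by
    have h11 := congrArg (wmap m (L.bundle.dproj s.1)) h8
    rwa [← wmap_comp, ← wmap_comp, h9, s.2.2, wmap_id, wmap_id] at h11
  rw [← h10] at h8
  exact jet_ext h4.symm (section_eq_of_wmap_eq h9 s.2.2 hu0 h8).symm

/-- If `ψ₀ x = FL₀ s` with `s ∈ S`, the hypothesis on `X` turns the integral relation into the
restricted relation at `s`, and semi-holonomy then forces `s` to be the jet. Conversely, the
relation on `P` follows from the one on `J¹*E` because the inclusion is an immersion. -/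
theorem integral_iff {K : ∀ s : J1 L.bundle, MVector m (MpiSpace m N) (L.FLt s)}
    (hK : L.IsExtendedOperator K) (S : Set (J1 L.bundle)) (X : ∀ p : P, MVector m VP p)
    (hX : ∀ s ∈ S, (⟨A.incl (A.FL₀ s), wedgeT m VP (J1sSpace m N) A.incl (A.FL₀ s) (X (A.FL₀ s))⟩ :
        Σ q : J1s L.bundle, MVector m (J1sSpace m N) q) = ⟨L.FL s, L.restrict K s⟩) :
    ((∀ x, ψ₀ x ∈ A.FL₀ '' S) ∧ L.IsIntegralSection X ψ₀) ↔
      ((∀ x, jet hψ₀ x ∈ S) ∧ ∃ f, IsNonvanishing (J1Space m N) f ∧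
        L.Relation L.FL (L.restrict K) f (A.incl ∘ ψ₀) (jet hψ₀)) := by
  have hX' : ∀ s ∈ S, wmap m (tg VP (J1sSpace m N) A.incl (A.FL₀ s)) (mv (X (A.FL₀ s))) =
      mv (L.restrict K s) := by
    intro s hs
    have h := ((mvector_eq_iff _ _).1 (hX s hs)).2
    rwa [mv_wedgeT] at h
  rw [isIntegralSection_iff]
  simp only [relation_iff]
  constructor
  · rintro ⟨h1, f, hf, h2⟩
    have key : ∀ x, jet hψ₀ x ∈ S ∧ ψ₀ x = A.FL₀ (jet hψ₀ x) := by
      intro x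
      obtain ⟨s, hs, hsx⟩ := h1 x
      obtain ⟨u, hu⟩ := L.exists_pair_eq_one x
      have h3 := h2 x u hu
      have h4 : s = jet hψ₀ x := by
        refine jet_eq_of_relation hψ₀ hK hu hsx.symm (r := f (ψ₀ x)) ?_
        rw [tg_incl_comp' hψ₀, wmap_comp, h3, wmap_scale, ← hX' s hs, ← hsx]
      rw [← h4]
      exact ⟨hs, hsx.symm⟩
    -- The factor on jets is the pullback along `FL₀` of the factor on `P`.
    refine ⟨fun x => (key x).1, fun s => f (A.FL₀ s), ⟨hf.1.comp A.FL₀_smooth, fun s => hf.2 _⟩,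
      fun x u hu => ⟨?_, ?_⟩⟩
    · change A.incl (ψ₀ x) = _
      rw [(key x).2, A.incl_FL₀]
    · change wmap m (tg (VM m) (J1sSpace m N) (fun x => A.incl (ψ₀ x)) x) u = _
      rw [tg_incl_comp' hψ₀, wmap_comp, h2 x u hu, wmap_scale, ← hX' _ (key x).1, ← (key x).2]
      exact congrArg (fun p => scale (f p) _) (key x).2
  · rintro ⟨h1, f, hf, h2⟩
    have key : ∀ x, ψ₀ x = A.FL₀ (jet hψ₀ x) := by
      intro x
      obtain ⟨u, hu⟩ := L.exists_pair_eq_one x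
      exact eq_FL₀_of_incl_eq hψ₀ (h2 x u hu).1
    -- The factor on `P` is constant along the fibres over `M`: its value at `p` is that of `f` at
    -- the jet of the section over the base point of `p`. So smoothness needs no descent along
    -- `FL₀`.
    refine ⟨fun x => ⟨_, h1 x, (key x).symm⟩, fun p => f (jet hψ₀ (A.toBase p)), ⟨?_, fun p => hf.2 _⟩,
      fun x u hu => ?_⟩
    · have h3 : ContMDiff 𝓘(ℝ, VP) 𝓘(ℝ, VM m) ∞ A.toBase :=
        L.bundle.contMDiff_proj.comp ((contMDiff_tau1 L.bundle).comp A.incl_smooth)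
      exact hf.1.comp ((contMDiff_j1 _).comp h3)
    · apply wmap_injective (A.tg_incl_injective (ψ₀ x))
      change _ = wmap m _ (scale (f (jet hψ₀ (A.toBase (ψ₀ x)))) _)
      rw [← wmap_comp, ← tg_incl_comp' hψ₀, hψ₀.2, wmap_scale]
      refine (h2 x u hu).2.trans (congrArg (scale _) ?_)
      rw [← hX' _ (h1 x), ← key x]

end AlmostRegular

end LagrangianSystem

/-! ### Solutions of the Hamiltonian problem are the Legendre images of their jets. -/

theorem exists_smoothVectorField {V X : Type*} [NormedAddCommGroup V] [NormedSpace ℝ V]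
    [FiniteDimensional ℝ V] [TopologicalSpace X] [ChartedSpace V X] [IsManifold 𝓘(ℝ, V) ∞ X]
    [T2Space X] (x : X) (v : TangentSpace 𝓘(ℝ, V) x) :
    ∃ Z : (∀ x : X, TangentSpace 𝓘(ℝ, V) x), IsSmoothVectorField Z ∧ Z x = v := by
  obtain ⟨s, hs, hv⟩ := FiberBundle.exists_contMDiffOn_extend (k := ∞) 𝓘(ℝ, V) V v
  -- A bump function supported where the local extension is smooth makes the extension global
  -- without changing its value at `x`.
  obtain ⟨f, -, hf⟩ := (SmoothBumpFunction.nhds_basis_tsupport (I := 𝓘(ℝ, V)) (c := x)).mem_iff.1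
    (interior_mem_nhds.2 hs)
  refine ⟨fun y => f y • FiberBundle.extend V v y, ?_, ?_⟩
  · exact ContMDiffOn.smul_section_of_tsupport (f.contMDiff.contMDiffOn) isOpen_interior hf
      (hv.mono interior_subset)
  · simp [FiberBundle.extend_apply_self]

/-- At a nearest point the differential of the squared distance is a multiple of constraints that
vanish on the kernel of `f'`. The residual `T p - z` is itself the image of a kernel vector, hence
orthogonal to itself. Surjectivity of `f'` excludes a degenerate multiplier. -/
theorem eq_of_lagrange_multiplier {X Y Z : Type*} [NormedAddCommGroup X] [NormedSpace ℝ X]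
    [CompleteSpace X] [NormedAddCommGroup Y] [NormedSpace ℝ Y] [CompleteSpace Y]
    [NormedAddCommGroup Z] [InnerProductSpace ℝ Z] {f : X → Y} {p u : X}
    {f' : X →L[ℝ] Y} (hf : HasStrictFDerivAt f f' p) (hs : Function.Surjective f')
    (T : X →L[ℝ] Z) (z : Z)
    (hmin : IsLocalMinOn (fun q => ‖T q - z‖ ^ 2) {q | f q = f p} p)
    (hu : f' u = 0) (hTu : T u = T p - z) : T p = z := by
  have h1 : HasStrictFDerivAt (fun q => ‖T q - z‖ ^ 2)
      (2 • (innerSL ℝ (T p - z)).comp T) p :=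
    (hasStrictFDerivAt_norm_sq (T p - z)).comp p (T.hasStrictFDerivAt.sub_const z)
  obtain ⟨Λ, Λ₀, hne, h⟩ := IsLocalExtrOn.exists_linear_map_of_hasStrictFDerivAt
    (Or.inl hmin) hf h1
  have h2 := h u
  rw [hu, map_zero, zero_add] at h2
  have h3 : Λ₀ ≠ 0 := by
    rintro rfl
    refine hne (Prod.ext ?_ rfl)
    refine LinearMap.ext fun y => ?_
    obtain ⟨w, rfl⟩ := hs y
    have := h w
    rwa [zero_smul, add_zero] at this
  have h4 := (smul_eq_zero.1 h2).resolve_left h3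
  have h5 : (2 : ℝ) * inner ℝ (T p - z) (T u) = 0 := by
    rw [← h4]; simp [inner_sub_left]
  rw [hTu, real_inner_self_eq_norm_sq] at h5
  exact sub_eq_zero.1 (norm_eq_zero.1 (by nlinarith [norm_nonneg (T p - z)]))

namespace LagrangianSystem.AlmostRegular

variable [IsManifold 𝓘(ℝ, VM m) ∞ M] [IsManifold 𝓘(ℝ, VM N) ∞ F] [IsManifold 𝓘(ℝ, VE m N) ∞ E]
  {L : LagrangianSystem m N M E F}
  {VP P : Type*} [NormedAddCommGroup VP] [NormedSpace ℝ VP] [FiniteDimensional ℝ VP]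
  [TopologicalSpace P] [ChartedSpace VP P] [IsManifold 𝓘(ℝ, VP) ∞ P] {A : L.AlmostRegular VP P}

theorem t2Space [T2Space E] (A : L.AlmostRegular VP P) : T2Space P :=
  A.incl_closed.isEmbedding.t2Space

variable {ψ₀ : M → P} (hψ₀ : IsSmoothSection (VM m) VP A.toBase ψ₀)
include hψ₀

/-- Every tangent vector of `P` extends to a smooth vector field, so the Hamiltonian problem is a
pointwise condition. -/
theorem ΩAt_eq_zero_of_solvesHamilton [T2Space E] (h : A.SolvesHamilton ψ₀) (x : M) (y : VP)
    (v : Fin m → VM m) : L.ΩAt (A.lift (ψ₀ x)) (Fin.cons (tg VP (MpiSpace m N) A.lift (ψ₀ x) y)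
      (fun i => tg (VM m) (MpiSpace m N) (fun x => A.lift (ψ₀ x)) x (v i))) = 0 := by
  have := A.t2Space
  obtain ⟨Z, hZ, hZx⟩ := exists_smoothVectorField (V := VP) (ψ₀ x) y
  have h1 := h Z hZ x v
  rw [hZx] at h1
  rw [tg_lift_comp hψ₀]
  refine Eq.trans ?_ h1
  symm
  change L.ΩAt (A.lift (ψ₀ x)) _ = _
  congr 1
  funext i
  refine Fin.cases ?_ (fun i => ?_) i <;> rfl

theorem jet_fst {x : M} {s : J1 L.bundle} (hs : A.FL₀ s = ψ₀ x) : (jet hψ₀ x).1 = s.1 := by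
  have h : A.incl (ψ₀ x) = L.FL s := by rw [← hs, A.incl_FL₀]
  exact congrArg (tau1 L.bundle) h

/-- For solutions of the Hamiltonian problem, the difference of the jet and a point of the fibre of
the Legendre map is tangent to the fibre. -/
theorem fderiv_FL₀C_sub [T2Space E] (h : A.SolvesHamilton ψ₀) {x : M} {s : J1 L.bundle}
    (hs : A.FL₀ s = ψ₀ x) {c : AdaptedChart L.bundle} (hc : s.1 ∈ c.chart.source) :
    fderiv ℝ (A.FL₀C c s) (jc c s) (0, (jc c (jet hψ₀ x)).2 - (jc c s).2) = 0 := by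
  have hq : A.lift (ψ₀ x) = L.FLt s := by rw [← hs, A.lift_FL₀]
  have hq' : (L.FLt s).1 ∈ c.chart.source := hc
  have hlam := L.contDiffAt_lam c s (L.jc_mem c s hc)
  have hfst := fst_comp_tg_lift hψ₀ x
  set j := jet hψ₀ x with hj
  have hjs : j.1 = s.1 := jet_fst hψ₀ hs
  set D := tg (VM m) (MpiSpace m N) (fun x => A.lift (ψ₀ x)) x with hD
  rw [hq] at hfst
  have hlin : ∀ (y : E) (hy : y ∈ c.chart.source) (_ : j.1 = y) (a : VM m),
      c.lin y hy (j.2.1 a) = (c.blin y hy a, (jc c j).2 (c.blin y hy a)) := by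
    rintro y hy rfl a
    exact lin_jet c j hy a
  -- The tangent planes of the lifted section are graphs with the slope of `j`, although they sit
  -- over the value of the Legendre map at `s`.
  have hW : ∀ i, (tg (MpiSpace m N) (PSpace m N) (mc c) (L.FLt s)
      (D ((c.blin s.1 hc).symm (eb i)))).1 = graphBasis (jc c j).2 i := by
    intro i
    rw [tg_mc_fst c (L.FLt s) hq']
    have h1 : tg (MpiSpace m N) (VE m N) (fun q : Mpi L.bundle => q.1) (L.FLt s)
      (D ((c.blin s.1 hc).symm (eb i))) = j.2.1 ((c.blin s.1 hc).symm (eb i)) := by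
      rw [← hfst]; rfl
    rw [h1]
    refine (hlin s.1 hc hjs _).trans ?_
    rw [ContinuousLinearEquiv.apply_symm_apply]
    rfl
  set e := jetChart c s with he
  have hse : s ∈ e.source := hc
  set T := tg (J1Space m N) (J1Space m N) e.symm (jc c s) with hT
  have hTT : ∀ w, tg (J1Space m N) (J1Space m N) (jc c) s (T w) = w := fun w =>
    (isSmoothChart_jetChart c s).tg_tg_symm' hse w
  -- For the image of a vertical vector the Hamiltonian equation gives `dp + dπ(v_j) = 0`, while the
  -- energy identity at `s` gives `dp + dπ(v_s) = 0`. The difference is the Hessian at `s` applied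
  -- to `a` and `v_j - v_s`.
  have key : ∀ a : J1Model m N, (fderiv ℝ (leg (L.lam c s)) (jc c s)
      (0, a)).2.2 ((jc c j).2 - (jc c s).2) = 0 := by
    intro a
    have h1 := ΩAt_eq_zero_of_solvesHamilton hψ₀ h x (tg (J1Space m N) VP A.FL₀ s (T (0, a)))
      (fun i => (c.blin s.1 hc).symm (eb i))
    have h2 := A.tg_lift_FL₀ s (T (0, a))
    rw [hs] at h2
    have h3 : L.ΩAt (L.FLt s) (Fin.cons (tg (J1Space m N) (MpiSpace m N) L.FLt s (T (0, a)))
        fun i => D ((c.blin s.1 hc).symm (eb i))) = 0 := by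
      rw [← hq, ← h2]
      exact h1
    have h4 := L.tg_mc_FLt c s hc s (T (0, a))
    rw [hTT] at h4
    rw [L.ΩAt_graph c (L.FLt s) hq' _ _ (jc c j).2 hW h4 (fun i => rfl), fderiv_leg_fst hlam] at h3
    have h5 := fderiv_leg_energy hlam ((0, a) : J1Space m N)
    have h6 : fderiv ℝ (L.lam c s) (jc c s) (((0, a) : J1Space m N).1, 0) = 0 := map_zero _
    rw [h6] at h5
    simp only [Prod.fst_zero, Prod.snd_zero, PiLp.zero_apply, zero_mul, map_zero, sub_zero,
      tens_zero, add_zero, Finset.sum_const_zero, zero_sub, neg_eq_zero] at h3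
    rw [map_sub]
    linarith
  set u := (jc c j).2 - (jc c s).2 with hu
  -- By symmetry of the Hessian, `u` lies in its kernel. Hence `T FLt` kills the vertical vector
  -- `u`, and so does `T FL₀`.
  have h1 : fderiv ℝ (leg (L.lam c s)) (jc c s) ((0, u) : J1Space m N) = 0 := by
    refine fderiv_leg_eq_zero hlam (by rw [fderiv_leg_fst hlam]) ?_
    ext1 a
    rw [fderiv_leg_symm hlam]
    exact key a
  have h2 : tg (J1Space m N) (MpiSpace m N) L.FLt s (T (0, u)) = 0 := by
    apply tg_mc_injective c hq'
    rw [L.tg_mc_FLt c s hc s, hTT, map_zero]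
    exact h1
  have hp : jc c s ∈ e.target := e.map_source hse
  have hes : e.symm (jc c s) = s := e.left_inv hse
  have hp' : A.FL₀ (e.symm (jc c s)) ∈ (chartAt VP (A.FL₀ s)).source := by
    rw [hes]; exact mem_chart_source _ _
  rw [A.fderiv_FL₀C hp hp']
  have h3 : tg (J1Space m N) VP A.FL₀ (e.symm (jc c s)) (T (0, u)) = 0 := by
    rw [hes]; exact A.tg_FL₀_eq_zero h2
  refine (congrArg _ h3).trans (map_zero _)

/-- Solutions of the Hamiltonian problem are the images of their jets. -/
theorem eq_FL₀_jet_of_solvesHamilton [T2Space E] (h : A.SolvesHamilton ψ₀) (x : M) :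
    ψ₀ x = A.FL₀ (jet hψ₀ x) := by
  have := A.t2Space
  obtain ⟨s₁, hs₁⟩ := A.FL₀_surjective (ψ₀ x)
  set j := jet hψ₀ x with hj
  obtain ⟨c, hc⟩ := exists_adaptedChart L.bundle j.1
  set e := jetChart c j with he
  have hje : j ∈ e.source := hc
  have hfib : ∀ {s : J1 L.bundle}, A.FL₀ s = ψ₀ x → s.1 = j.1 := fun hs => (jet_fst hψ₀ hs).symm
  have hjc : ∀ s : J1 L.bundle, s.1 = j.1 → (jc c s).1 = c.chart j.1 := by
    intro s hs
    have hs' : s.1 ∈ c.chart.source := by rw [hs]; exact hc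
    rw [jc_of_mem c s hs']
    exact congrArg c.chart hs
  have htgt : ∀ a : J1Model m N, (c.chart j.1, a) ∈ e.target := fun a => c.chart.map_source hc
  -- Jet coordinates are passed to a Euclidean space so that the squared distance is differentiable.
  let τ : J1Model m N ≃L[ℝ] EuclideanSpace ℝ (Fin (Module.finrank ℝ (J1Model m N))) := toEuclidean
  let γ : EuclideanSpace ℝ (Fin (Module.finrank ℝ (J1Model m N))) → P := fun z =>
    A.FL₀ (e.symm (c.chart j.1, τ.symm z))
  have hγ : Continuous γ := by
    refine A.FL₀_smooth.continuous.comp (e.continuousOn_symm.comp_continuous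
      (continuous_const.prodMk τ.symm.continuous) fun z => htgt _)
  have hmemγ : ∀ s : J1 L.bundle, s.1 = j.1 → γ (τ (jc c s).2) = A.FL₀ s := by
    intro s hs
    have hs' : s ∈ e.source := show s.1 ∈ c.chart.source by rw [hs]; exact hc
    have h1 : (c.chart j.1, (jc c s).2) = e s := Prod.ext (hjc s hs).symm rfl
    change A.FL₀ (e.symm (c.chart j.1, τ.symm (τ (jc c s).2))) = _
    rw [ContinuousLinearEquiv.symm_apply_apply, h1, e.left_inv hs']
  -- The fibre over `ψ₀ x` is a nonempty closed subset of the space of jet coordinates over one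
  -- point of `E`; the point nearest to `j` in it is taken.
  obtain ⟨z, hz, hmin⟩ := (isClosed_singleton.preimage hγ : IsClosed (γ ⁻¹' {ψ₀ x})).exists_infDist_eq_dist
    ⟨τ (jc c s₁).2, (hmemγ s₁ (hfib hs₁)).trans hs₁⟩ (τ (jc c j).2)
  set s := e.symm (c.chart j.1, τ.symm z) with hs
  have hsx : A.FL₀ s = ψ₀ x := hz
  have hsc : s.1 ∈ c.chart.source := e.map_target (htgt _)
  have hse : s ∈ (jetChart c s).source := hsc
  have hjs : jc c s = (c.chart j.1, τ.symm z) := e.right_inv (htgt _)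
  have hz' : τ (jc c s).2 = z := by rw [hjs]; exact τ.apply_symm_apply z
  have hes : (jetChart c s).symm (jc c s) = s := (jetChart c s).left_inv hse
  have hpt : jc c s ∈ (jetChart c s).target := (jetChart c s).map_source hse
  have hps : A.FL₀ ((jetChart c s).symm (jc c s)) ∈ (chartAt VP (A.FL₀ s)).source := by
    rw [hes]; exact mem_chart_source _ _
  have hgood : ∀ᶠ p in 𝓝 (jc c s), p ∈ (jetChart c s).target ∧
      A.FL₀ ((jetChart c s).symm p) ∈ (chartAt VP (A.FL₀ s)).source := by
    refine Filter.Eventually.and ((jetChart c s).open_target.mem_nhds hpt) ?_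
    have hcont : ContinuousAt (fun p => A.FL₀ ((jetChart c s).symm p)) (jc c s) :=
      A.FL₀_smooth.continuous.continuousAt.comp ((jetChart c s).symm.continuousAt hpt)
    exact hcont.preimage_mem_nhds ((chartAt VP (A.FL₀ s)).open_source.mem_nhds hps)
  let T : J1Space m N →L[ℝ] EuclideanSpace ℝ (Fin (Module.finrank ℝ (J1Model m N))) :=
    (τ : J1Model m N →L[ℝ] _).comp (ContinuousLinearMap.snd ℝ (VE m N) (J1Model m N))
  -- Every nearby point of the level set is a jet over the same point of `E`, so minimality in the
  -- fibre gives a constrained minimum in the full coordinate space.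
  have hloc : IsLocalMinOn (fun q => ‖T q - T (jc c j)‖ ^ 2)
      {q | A.FL₀C c s q = A.FL₀C c s (jc c s)} (jc c s) := by
    rw [IsLocalMinOn, IsMinFilter]
    filter_upwards [mem_nhdsWithin_of_mem_nhds hgood, self_mem_nhdsWithin] with q hq hq'
    have h1 : A.FL₀ ((jetChart c s).symm q) = ψ₀ x := by
      rw [← hsx]
      refine (chartAt VP (A.FL₀ s)).injOn hq.2 (mem_chart_source _ _) ?_
      refine Eq.trans hq' ?_
      change chartAt VP (A.FL₀ s) (A.FL₀ ((jetChart c s).symm (jc c s))) = _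
      rw [hes]
    have h2 : jc c ((jetChart c s).symm q) = q := (jetChart c s).right_inv hq.1
    have h3 := (hmemγ _ (hfib h1)).trans h1
    rw [h2] at h3
    have h4 := Metric.infDist_le_dist_of_mem (x := τ (jc c j).2) (show τ q.2 ∈ γ ⁻¹' {ψ₀ x} from h3)
    rw [hmin, dist_comm, dist_comm _ (τ q.2), dist_eq_norm, dist_eq_norm] at h4
    have h5 : ‖T (jc c s) - T (jc c j)‖ ≤ ‖T q - T (jc c j)‖ := by
      change ‖τ (jc c s).2 - τ (jc c j).2‖ ≤ ‖τ q.2 - τ (jc c j).2‖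
      rwa [hz']
    gcongr
  have hstrict : HasStrictFDerivAt (A.FL₀C c s) (fderiv ℝ (A.FL₀C c s) (jc c s)) (jc c s) :=
    (A.contDiffAt_FL₀C hpt hps).hasStrictFDerivAt (by simp)
  have : CompleteSpace VP := FiniteDimensional.complete ℝ VP
  -- The difference of `s` and `j` is tangent to the level set, as the multiplier argument requires.
  have h0 := fderiv_FL₀C_sub hψ₀ h hsx hsc
  have h1 : fderiv ℝ (A.FL₀C c s) (jc c s) (0, (jc c s).2 - (jc c j).2) = 0 := by
    have h2 : ((0, (jc c s).2 - (jc c j).2) : J1Space m N) =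
        -(0, (jc c (jet hψ₀ x)).2 - (jc c s).2) := by
      rw [Prod.neg_mk, neg_sub, neg_zero]
    rw [h2, map_neg, h0, neg_zero]
  have h2 := eq_of_lagrange_multiplier hstrict (A.surjective_fderiv_FL₀C hsc) T (T (jc c j)) hloc h1
    (map_sub τ _ _)
  have h3 : (jc c s).2 = (jc c j).2 := τ.injective h2
  have h4 : jc c s = jc c j := Prod.ext (by rw [hjc s (hfib hsx), hjc j rfl]) h3
  have h5 : s = j := e.injOn (show s ∈ e.source from hsc) hje h4
  rw [← h5, hsx]

/-- The lifts of solutions of the Hamiltonian problem are tangent to field sections. -/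
theorem isFieldSection_of_solvesHamilton [T2Space E] (h : A.SolvesHamilton ψ₀) (x : M) :
    A.lift (ψ₀ x) = L.FLt (jet hψ₀ x) ∧
      L.IsFieldSection (jet hψ₀ x) (tg (VM m) (MpiSpace m N) (fun x => A.lift (ψ₀ x)) x) := by
  have h1 := eq_FL₀_jet_of_solvesHamilton hψ₀ h x
  have hfst := fst_comp_tg_lift hψ₀ x
  have hΩ := ΩAt_eq_zero_of_solvesHamilton hψ₀ h x
  set j := jet hψ₀ x with hj
  have h2 : A.lift (ψ₀ x) = L.FLt j := by rw [h1, A.lift_FL₀]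
  refine ⟨h2, by rw [← hfst, h2], fun u w => ?_⟩
  by_cases hu0 : u = 0
  · rw [hu0, map_zero, contractMV, map_zero, mul_zero]
  · rw [contractMV_wmap_eq_zero_iff _ (.refl ℝ (VM m)) hu0]
    have h3 := hΩ (tg (J1Space m N) VP A.FL₀ j w) fun i =>
      (ContinuousLinearEquiv.refl ℝ (VM m)).symm (eb i)
    have h4 := A.tg_lift_FL₀ j w
    rw [← h1] at h4
    rw [h4, h2] at h3
    exact h3

end LagrangianSystem.AlmostRegular

/-! ### Smoothness of fields along a map. -/

instance (m N : ℕ) : NormedAddCommGroup (VM m →L[ℝ] PSpace m N) :=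
  ContinuousLinearMap.toNormedAddCommGroup

instance (m N : ℕ) : @NormedSpace ℝ (VM m →L[ℝ] PSpace m N) _
    NormedAddCommGroup.toSeminormedAddCommGroup := ContinuousLinearMap.toNormedSpace

instance (m N : ℕ) : AddCommMonoid (VM m →L[ℝ] PSpace m N) := ContinuousLinearMap.addCommMonoid

/-- Vector fields along a map are smooth if their expressions in a chart are. -/
theorem contMDiffAt_tangentBundle_mk {V W W' X Y : Type*} [NormedAddCommGroup V] [NormedSpace ℝ V]
    [NormedAddCommGroup W] [NormedSpace ℝ W] [NormedAddCommGroup W'] [NormedSpace ℝ W']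
    [TopologicalSpace X] [ChartedSpace V X]
    [TopologicalSpace Y] [ChartedSpace W Y] [IsManifold 𝓘(ℝ, W) ∞ Y]
    {e : OpenPartialHomeomorph Y W'} (he : IsSmoothChart W e) {f : X → Y} {x : X}
    (hf : SmoothAt V W f x) (hx : f x ∈ e.source) {w : X → W'} (hw : SmoothAt V W' w x)
    {ξ : ∀ x, TangentSpace 𝓘(ℝ, W) (f x)}
    (hξ : ∀ᶠ x' in 𝓝 x, ξ x' = tg W' W e.symm (e (f x')) (w x')) :
    ContMDiffAt 𝓘(ℝ, V) 𝓘(ℝ, W).tangent ∞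
      (fun x => (⟨f x, ξ x⟩ : TangentBundle 𝓘(ℝ, W) Y)) x := by
  rw [ModelWithCorners.tangent, Bundle.contMDiffAt_totalSpace]
  refine ⟨hf, ?_⟩
  set χ := chartAt W (f x) with hχ
  have hfx : f x ∈ χ.source := mem_chart_source _ _
  have h1 := LagrangianSystem.smoothAt_tg_chart (V := W) (W := W) (W' := W) (g := χ) (f := fun y : Y => y) he hx
    (Filter.Eventually.of_forall fun y => contMDiffAt_id)
    (Filter.Eventually.mono (χ.open_source.mem_nhds hfx) fun y hy => (IsSmoothChart.chartAt (V := W) (f x)).at_source hy)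
  -- The component in the trivialization at `f x` is the derivative of the transition from `e` to
  -- the preferred chart, applied to `w`.
  have h2 : SmoothAt V (W' →L[ℝ] W) (fun x' => (tg W W χ (f x')).comp
      ((tg W W (fun y : Y => y) (f x')).comp (tg W' W e.symm (e (f x'))))) x :=
    SmoothAt.comp_of_eq rfl h1 hf
  have h3 := ContMDiffAt.clm_apply h2 hw
  refine ContMDiffAt.congr_of_eventuallyEq h3 ?_
  filter_upwards [hξ, hf.continuousAt.preimage_mem_nhds (χ.open_source.mem_nhds hfx)] with x' hx' hx''
  have h4 := mfderiv_chartAt_eq_tangentCoordChange (I := 𝓘(ℝ, W)) (x := f x') (y := f x) hx''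
  have h5 : tg W W χ (f x') = tangentCoordChange 𝓘(ℝ, W) (f x') (f x) (f x') := h4
  rw [tg_id, h5]
  change tangentCoordChange 𝓘(ℝ, W) (f x') (f x) (f x') (ξ x') = _
  rw [hx']
  rfl

open exteriorPower in
/-- Multivectors that are images under linear maps; the images may be formed with different, but
equal, algebraic structures. -/
theorem exists_map_of_mv_eq_wmap {V W Y : Type*} [NormedAddCommGroup V] [NormedSpace ℝ V]
    [NormedAddCommGroup W] [NormedSpace ℝ W] [TopologicalSpace Y] [ChartedSpace W Y]
    {y : Y} (k : MVector m W y) (g : V →L[ℝ] W) (i₁ : AddCommGroup V)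
    (m₁ : @Module ℝ V _ i₁.toAddCommMonoid) (i₂ : AddCommGroup W)
    (m₂ : @Module ℝ W _ i₂.toAddCommMonoid)
    (f : @LinearMap ℝ ℝ _ _ (RingHom.id ℝ) V W i₁.toAddCommMonoid i₂.toAddCommMonoid m₁ m₂)
    {u : ModelMultivector m V} (hk : mv k = wmap m g u)
    (h₁ : i₁ = NormedAddCommGroup.toAddCommGroup) (h₁' : HEq m₁ (@NormedSpace.toModule ℝ V _ _ _))
    (h₂ : i₂ = NormedAddCommGroup.toAddCommGroup) (h₂' : HEq m₂ (@NormedSpace.toModule ℝ W _ _ _))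
    (hfg : ∀ v, f v = g v) : ∃ e : @ExteriorAlgebra.exteriorPower ℝ _ m V i₁ m₁,
      HEq k (@exteriorPower.map ℝ _ m V W i₁ m₁ i₂ m₂ f e) := by
  subst h₁ h₂
  cases h₁'
  cases h₂'
  have hf : f = g.toLinearMap := LinearMap.ext hfg
  subst hf
  refine ⟨u, ?_⟩
  have key : ∀ (T : Type _) (i₁ i₂ : AddCommGroup T) (m₁ : @Module ℝ T _ i₁.toAddCommMonoid)
      (m₂ : @Module ℝ T _ i₂.toAddCommMonoid) (_ : i₁ = i₂) (_ : HEq m₁ m₂)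
      (f : @LinearMap ℝ ℝ _ _ (RingHom.id ℝ) T T i₁.toAddCommMonoid i₂.toAddCommMonoid m₁ m₂)
      (_ : ∀ v, f v = v) (k : @ExteriorAlgebra.exteriorPower ℝ _ m T i₁ m₁),
      HEq (@exteriorPower.map ℝ _ m T T i₁ m₁ i₂ m₂ f k) k := by
    rintro T i₁ _ m₁ _ rfl h f hf k
    cases h
    have : f = LinearMap.id := LinearMap.ext hf
    rw [this, exteriorPower.map_id]
    rfl
  exact (key W _ _ _ _ rfl HEq.rfl (tangentId W y).toLinearMap (fun _ => rfl) k).symm.trans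
    (heq_of_eq hk)


namespace LagrangianSystem

variable [IsManifold 𝓘(ℝ, VM m) ∞ M] [IsManifold 𝓘(ℝ, VM N) ∞ F] [IsManifold 𝓘(ℝ, VE m N) ∞ E]
  {L : LagrangianSystem m N M E F}

/-! ### Smooth families of linear sections -/

theorem secC_comb (c : AdaptedChart L.bundle) (s : J1 L.bundle) (a b : ℝ)
    (D D' : VM m →L[ℝ] MpiSpace m N) :
    L.secC c s (a • D + b • D') = a • L.secC c s D + b • L.secC c s D' := by
  simp only [secC, ContinuousLinearMap.add_comp, ContinuousLinearMap.smul_comp,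
    ContinuousLinearMap.comp_add, ContinuousLinearMap.comp_smul]

variable (L) in
/-- The expression of linear sections in natural coordinates, as a linear map. -/
def secCₗ (c : AdaptedChart L.bundle) (s : J1 L.bundle) :
    (VM m →L[ℝ] MpiSpace m N) →ₗ[ℝ] (VM m →L[ℝ] PSpace m N) where
  toFun := L.secC c s
  map_add' D D' := by simpa using secC_comb c s 1 1 D D'
  map_smul' a D := by simpa using secC_comb c s a 0 D 0

/-- In coordinates the field equation is an affine condition on the section, so it survives the
averaging in a partition of unity. -/
theorem convex_isFieldSection (s : J1 L.bundle) : Convex ℝ {D | L.IsFieldSection s D} := by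
  intro D hD D' hD' a b _ _ hab
  obtain ⟨c, hc⟩ := exists_adaptedChart L.bundle s.1
  have h1 := (isFieldSection_iff c s s hc D).1 hD
  have h2 := (isFieldSection_iff c s s hc D').1 hD'
  refine (isFieldSection_iff c s s hc _).2 ?_
  rw [secC_comb]
  have e : ∀ x, (a • L.secC c s D + b • L.secC c s D') x =
      a • L.secC c s D x + b • L.secC c s D' x := fun x => rfl
  refine ⟨fun x => ?_, fun x z => ?_⟩
  · rw [e, Prod.fst_add, Prod.smul_fst, Prod.smul_fst, h1.1, h2.1, ← add_smul, hab, one_smul]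
  · simp only [e, Prod.fst_add, Prod.smul_fst, Prod.snd_add, Prod.smul_snd, add_apply, smul_apply,
      smul_eq_mul, Finset.sum_add_distrib, ← Finset.mul_sum]
    have h3 := h1.2 x z
    have h4 := h2.2 x z
    linear_combination a * h3 + b * h4 + (fderiv ℝ (L.lam c s) (jc c s) ((x, z), 0)) * hab

/-- Smoothness of families of linear sections. -/
def IsSmoothSectionAt (D : J1 L.bundle → VM m →L[ℝ] MpiSpace m N) (s₀ : J1 L.bundle) : Prop :=
  ∀ c : AdaptedChart L.bundle, s₀.1 ∈ c.chart.source →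
    SmoothAt (J1Space m N) (VM m →L[ℝ] PSpace m N) (fun s => L.secC c s (D s)) s₀

theorem smoothAt_proj_fst (s₀ : J1 L.bundle) :
    SmoothAt (J1Space m N) (VM m) (fun s : J1 L.bundle => L.bundle.proj s.1) s₀ :=
  SmoothAt.comp_of_eq (g := L.bundle.proj) rfl (L.bundle.contMDiff_proj _) (smoothAt_jet_fst s₀)

/-- Smoothness can be tested in one chart. -/
theorem isSmoothSectionAt_of_chart {D : J1 L.bundle → VM m →L[ℝ] MpiSpace m N} {s₀ : J1 L.bundle}
    {c : AdaptedChart L.bundle} (hc : s₀.1 ∈ c.chart.source)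
    (h : SmoothAt (J1Space m N) (VM m →L[ℝ] PSpace m N) (fun s => L.secC c s (D s)) s₀) :
    IsSmoothSectionAt D s₀ := by
  intro c' hc'
  have hq : (L.FLt s₀).1 ∈ c.chart.source := hc
  have hq' : (L.FLt s₀).1 ∈ c'.chart.source := hc'
  have h1 := smoothAt_tg_chart (W := MpiSpace m N) (g := mc c') (f := fun q : Mpi L.bundle => q)
    (isSmoothChart_mpiChart c (L.FLt s₀)) hq
    (Filter.Eventually.of_forall fun y => contMDiffAt_id)
    ((eventually_mpi_mem c' hq').mono fun q hq => smoothAt_mc c' hq)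
  have h1' := SmoothAt.comp_of_eq (f := L.FLt) rfl h1 (L.smoothAt_FLt s₀)
  have hb' : L.bundle.proj s₀.1 ∈ c'.base.source := c'.proj_mem _ hc'
  have hb : L.bundle.proj s₀.1 ∈ c.base.source := c.proj_mem _ hc
  have h2 := smoothAt_tg_chart (W := VM m) (g := c.base) (f := fun x : M => x)
    c'.isSmoothChart_base hb' (Filter.Eventually.of_forall fun y => contMDiffAt_id)
    (Filter.Eventually.mono (c.base.open_source.mem_nhds hb) fun q hq => c.isSmoothChart_base.at_source hq)
  have h2' := SmoothAt.comp_of_eq (f := fun s : J1 L.bundle => L.bundle.proj s.1) rfl h2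
    (smoothAt_proj_fst s₀)
  -- A change of adapted chart composes the coordinate section with the derivative of the transition
  -- on the multimomenta and the inverse one on the base, both smooth.
  have h3 := ContMDiffAt.clm_comp h1' (ContMDiffAt.clm_comp h h2')
  refine ContMDiffAt.congr_of_eventuallyEq h3 ?_
  filter_upwards [eventually_jet_mem c hc, eventually_jet_mem c' hc'] with s hs hs'
  have hsq : L.FLt s ∈ (mpiChart c (L.FLt s₀)).source := hs
  ext1 x
  simp only [tg_id, ContinuousLinearMap.id_comp, ContinuousLinearMap.comp_apply, secC]
  have h4 := c.isSmoothChart_base.tg_symm_tg (c.proj_mem _ hs)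
    (tg (VM m) (VM m) c'.base.symm (c'.base (L.bundle.proj s.1)) x)
  rw [h4]
  have h5 := (isSmoothChart_mpiChart c (L.FLt s₀)).tg_symm_tg hsq
    (D s (tg (VM m) (VM m) c'.base.symm (c'.base (L.bundle.proj s.1)) x))
  exact (congrArg _ h5).symm

/-- Families of linear sections that satisfy convex conditions can be glued. -/
theorem exists_smoothSection [T2Space E] [SigmaCompactSpace E]
    {t : J1 L.bundle → Set (VM m →L[ℝ] MpiSpace m N)} (ht : ∀ s, Convex ℝ (t s))
    (hloc : ∀ s₀ : J1 L.bundle, ∃ U : Set (J1 L.bundle), IsOpen U ∧ s₀ ∈ U ∧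
      ∃ D : J1 L.bundle → VM m →L[ℝ] MpiSpace m N, ∀ s ∈ U, D s ∈ t s ∧ IsSmoothSectionAt D s) :
    ∃ D : J1 L.bundle → VM m →L[ℝ] MpiSpace m N, ∀ s, D s ∈ t s ∧ IsSmoothSectionAt D s := by
  choose U hU hmem D hD using hloc
  obtain ⟨ρ, hρ⟩ := SmoothPartitionOfUnity.exists_isSubordinate 𝓘(ℝ, J1Space m N)
    isClosed_univ U hU fun s _ => mem_iUnion.2 ⟨s, hmem s⟩
  refine ⟨fun s => ∑ᶠ i, ρ i s • D i s, fun s => ⟨?_, fun c hc => ?_⟩⟩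
  · exact ρ.finsum_smul_mem_convex (mem_univ s)
      (fun i hi => (hD i s (hρ i (subset_closure hi))).1) (ht s)
  · have h1 := ρ.contMDiffAt_finsum (n := ⊤) (x₀ := s) (g := fun i s => L.secC c s (D i s))
      fun i hi => (hD i s (hρ i hi)).2 c hc
    refine ContMDiffAt.congr_of_eventuallyEq h1 (Filter.Eventually.of_forall fun s' => ?_)
    -- Coordinates of sections at a fixed jet are linear, so they pass through the locally finite
    -- sum.
    change L.secCₗ c s' (∑ᶠ i, ρ i s' • D i s') = _
    rw [map_finsum]
    · refine finsum_congr fun i => ?_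
      rw [map_smul]
      rfl
    · exact (ρ.locallyFinite.point_finite s').subset fun i hi h0 => hi (by
        change ρ i s' • D i s' = 0
        rw [h0, zero_smul])

end LagrangianSystem

namespace LagrangianSystem

open exteriorPower

variable [IsManifold 𝓘(ℝ, VM m) ∞ M] [IsManifold 𝓘(ℝ, VM N) ∞ F] [IsManifold 𝓘(ℝ, VE m N) ∞ E]
  {L : LagrangianSystem m N M E F}

/-! ### Local solutions of the field equation -/

/-- The linear section with given slope and restricted momenta whose energy component is determined
by the field equation. -/
def fieldC (f : J1Space m N → ℝ) (p : J1Space m N) (G : VM m →L[ℝ] J1Model m N →L[ℝ] ℝ) :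
    VM m →L[ℝ] PSpace m N :=
  (ContinuousLinearMap.inl ℝ (VE m N) (PModel m N)).comp
    (ContinuousLinearMap.inl ℝ (VM m) (VM N) + (ContinuousLinearMap.inr ℝ (VM m) (VM N)).comp p.2) +
  (ContinuousLinearMap.inr ℝ (VE m N) (PModel m N)).comp
    ((ContinuousLinearMap.inl ℝ ℝ (J1Model m N →L[ℝ] ℝ)).comp
      ((fderiv ℝ f p).comp ((ContinuousLinearMap.inl ℝ (VE m N) (J1Model m N)).comp
        (ContinuousLinearMap.inl ℝ (VM m) (VM N) +
          (ContinuousLinearMap.inr ℝ (VM m) (VM N)).comp p.2)) -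
        (ContinuousLinearMap.apply ℝ ℝ p.2).comp G) +
      (ContinuousLinearMap.inr ℝ ℝ (J1Model m N →L[ℝ] ℝ)).comp G)

theorem fieldC_apply (f : J1Space m N → ℝ) (p : J1Space m N)
    (G : VM m →L[ℝ] J1Model m N →L[ℝ] ℝ) (a : VM m) :
    fieldC f p G a = ((a, p.2 a), (fderiv ℝ f p ((a, p.2 a), 0) - G a p.2, G a)) := by
  refine Prod.ext (Prod.ext ?_ ?_) (Prod.ext ?_ ?_)
  · simp [fieldC]
  · simp [fieldC]
  · have h : (((a, p.2 a), 0) : J1Space m N) = ((a, 0), 0) + ((0, p.2 a), 0) := by simp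
    rw [h, map_add]
    simp [fieldC]
  · simp [fieldC]

theorem contDiffAt_fieldC {X : Type*} [NormedAddCommGroup X] [NormedSpace ℝ X]
    {f : J1Space m N → ℝ} {p : X → J1Space m N} {G : X → VM m →L[ℝ] J1Model m N →L[ℝ] ℝ} {x : X}
    (hf : ContDiffAt ℝ ∞ f (p x)) (hp : ContDiffAt ℝ ∞ p x) (hG : ContDiffAt ℝ ∞ G x) :
    ContDiffAt ℝ ∞ (fun x => fieldC f (p x) (G x)) x := by
  have h1 : ContDiffAt ℝ ∞ (fun x => fderiv ℝ f (p x)) x :=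
    ContDiffAt.comp x (hf.fderiv_right (m := ∞) (by simp)) hp
  have h2 : ContDiffAt ℝ ∞ (fun x => ContinuousLinearMap.inl ℝ (VM m) (VM N) +
      (ContinuousLinearMap.inr ℝ (VM m) (VM N)).comp (p x).2) x :=
    contDiffAt_const.add (contDiffAt_const.clm_comp hp.snd)
  have h3 : ContDiffAt ℝ ∞ (fun x => (ContinuousLinearMap.apply ℝ ℝ (p x).2 :
      (J1Model m N →L[ℝ] ℝ) →L[ℝ] ℝ)) x :=
    ((ContinuousLinearMap.apply ℝ ℝ : J1Model m N →L[ℝ] _).contDiff.contDiffAt).comp x hp.snd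
  exact (contDiffAt_const.clm_comp h2).add (contDiffAt_const.clm_comp
    ((contDiffAt_const.clm_comp ((h1.clm_comp (contDiffAt_const.clm_comp h2)).sub
      (h3.clm_comp hG))).add (contDiffAt_const.clm_comp hG)))

/-- Restricted momenta with prescribed divergence. -/
def divC (f : J1Space m N → ℝ) (p : J1Space m N) : VM m →L[ℝ] J1Model m N →L[ℝ] ℝ :=
  (m : ℝ)⁻¹ • ((ContinuousLinearMap.compL ℝ (J1Model m N) (VM N) ℝ)
    ((fderiv ℝ f p).comp ((ContinuousLinearMap.inl ℝ (VE m N) (J1Model m N)).comp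
      (ContinuousLinearMap.inr ℝ (VM m) (VM N))))).comp (ContinuousLinearMap.apply ℝ (VM N))

theorem divC_apply (f : J1Space m N → ℝ) (p : J1Space m N) (a : VM m) (w : J1Model m N) :
    divC f p a w = (m : ℝ)⁻¹ * fderiv ℝ f p ((0, w a), 0) := by
  simp [divC]

/-- Each of the `m` base directions carries an equal share of the required divergence; `1 ≤ m` makes
the share meaningful. -/
theorem sum_divC (hm : 1 ≤ m) (f : J1Space m N → ℝ) (p : J1Space m N) (z : VM N) :
    ∑ i, divC f p (eb i) (tens i z) = fderiv ℝ f p ((0, z), 0) := by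
  have h : ∀ i : Fin m, divC f p (eb i) (tens i z) = (m : ℝ)⁻¹ * fderiv ℝ f p ((0, z), 0) := by
    intro i
    rw [divC_apply, tens_apply, eb_apply, if_pos rfl, one_smul]
  rw [Finset.sum_congr rfl fun i _ => h i, Finset.sum_const, Finset.card_univ, Fintype.card_fin,
    nsmul_eq_mul, mul_inv_cancel_left₀ (by exact_mod_cast (by omega : m ≠ 0))]

theorem contDiffAt_divC {f : J1Space m N → ℝ} {p : J1Space m N} (hf : ContDiffAt ℝ ∞ f p) :
    ContDiffAt ℝ ∞ (divC f) p := by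
  have h1 : ContDiffAt ℝ ∞ (fun p => (fderiv ℝ f p).comp
      ((ContinuousLinearMap.inl ℝ (VE m N) (J1Model m N)).comp
        (ContinuousLinearMap.inr ℝ (VM m) (VM N)))) p :=
    (hf.fderiv_right (m := ∞) (by simp)).clm_comp contDiffAt_const
  have h2 : ContDiffAt ℝ ∞ (fun p => ContinuousLinearMap.compL ℝ (J1Model m N) (VM N) ℝ
      ((fderiv ℝ f p).comp ((ContinuousLinearMap.inl ℝ (VE m N) (J1Model m N)).comp
        (ContinuousLinearMap.inr ℝ (VM m) (VM N))))) p :=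
    (ContinuousLinearMap.compL ℝ (J1Model m N) (VM N) ℝ).contDiff.contDiffAt.comp p h1
  have h3 : ContDiffAt ℝ ∞ (fun _ : J1Space m N =>
      (ContinuousLinearMap.apply ℝ (VM N) : VM m →L[ℝ] J1Model m N →L[ℝ] VM N)) p := contDiffAt_const
  exact (h2.clm_comp h3).const_smul (m : ℝ)⁻¹

/-- The linear section with given natural coordinates. -/
def ofSecC (c : AdaptedChart L.bundle) (s : J1 L.bundle) (C : VM m →L[ℝ] PSpace m N) :
    VM m →L[ℝ] MpiSpace m N :=
  (tg (PSpace m N) (MpiSpace m N) (mpiChart c (L.FLt s)).symm (mc c (L.FLt s))).comp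
    (C.comp (tg (VM m) (VM m) c.base (L.bundle.proj s.1)))

theorem secC_ofSecC (c : AdaptedChart L.bundle) (s : J1 L.bundle) (h : s.1 ∈ c.chart.source)
    (C : VM m →L[ℝ] PSpace m N) : L.secC c s (ofSecC c s C) = C := by
  have hs : L.FLt s ∈ (mpiChart c (L.FLt s)).source := h
  ext1 x
  have h1 := c.isSmoothChart_base.tg_tg_symm' (c.proj_mem _ h) x
  have h2 := (isSmoothChart_mpiChart c (L.FLt s)).tg_tg_symm' hs
    (C (tg (VM m) (VM m) c.base (L.bundle.proj s.1)
      (tg (VM m) (VM m) c.base.symm (c.base (L.bundle.proj s.1)) x)))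
  refine Eq.trans h2 ?_
  rw [h1]

/-- Once slope and energy are fixed as in `fieldC`, the divergence of the momenta is the only
remaining condition. -/
theorem isFieldSection_ofSecC (c : AdaptedChart L.bundle) (s s₀ : J1 L.bundle)
    (h : s.1 ∈ c.chart.source) {G : VM m →L[ℝ] J1Model m N →L[ℝ] ℝ}
    (hG : ∀ z, ∑ i, G (eb i) (tens i z) = fderiv ℝ (L.lam c s₀) (jc c s) ((0, z), 0)) :
    L.IsFieldSection s (ofSecC c s (fieldC (L.lam c s₀) (jc c s) G)) := by
  rw [isFieldSection_iff c s s₀ h, secC_ofSecC c s h]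
  simp only [fieldC_apply]
  refine ⟨fun x => trivial, fun a z => ?_⟩
  rw [hG, sub_add_cancel, ← map_add]
  congr 1
  refine Prod.ext (Prod.ext ?_ ?_) ?_ <;> simp

/-- The case `z = v a` of the field equation gives the energy component, so the momenta carry all
the freedom. -/
theorem IsFieldSection.secC_eq {c : AdaptedChart L.bundle} {s : J1 L.bundle} (s₀ : J1 L.bundle)
    (h : s.1 ∈ c.chart.source) {D : VM m →L[ℝ] MpiSpace m N} (hD : L.IsFieldSection s D) :
    L.secC c s D = fieldC (L.lam c s₀) (jc c s)
      ((ContinuousLinearMap.snd ℝ ℝ (J1Model m N →L[ℝ] ℝ)).comp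
        ((ContinuousLinearMap.snd ℝ (VE m N) (PModel m N)).comp (L.secC c s D))) := by
  obtain ⟨h1, h2⟩ := (isFieldSection_iff c s s₀ h D).1 hD
  ext1 a
  rw [fieldC_apply]
  refine Prod.ext (h1 a) (Prod.ext ?_ rfl)
  have h3 := h2 a ((jc c s).2 a)
  simp only [sub_self, tens_zero, map_zero, Finset.sum_const_zero, add_zero] at h3
  exact eq_sub_of_add_eq h3

theorem IsFieldSection.sum_eq {c : AdaptedChart L.bundle} {s : J1 L.bundle} (s₀ : J1 L.bundle)
    (h : s.1 ∈ c.chart.source) {D : VM m →L[ℝ] MpiSpace m N} (hD : L.IsFieldSection s D)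
    (z : VM N) : ∑ i, (L.secC c s D (eb i)).2.2 (tens i z) =
      fderiv ℝ (L.lam c s₀) (jc c s) ((0, z), 0) := by
  have h1 := ((isFieldSection_iff c s s₀ h D).1 hD).2 0 z
  simpa using h1

theorem smoothAt_fieldC {c : AdaptedChart L.bundle} {s : J1 L.bundle} (s₀ : J1 L.bundle)
    (h : s.1 ∈ c.chart.source) {G : J1 L.bundle → VM m →L[ℝ] J1Model m N →L[ℝ] ℝ}
    (hG : SmoothAt (J1Space m N) (VM m →L[ℝ] J1Model m N →L[ℝ] ℝ) G s) :
    SmoothAt (J1Space m N) (VM m →L[ℝ] PSpace m N)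
      (fun s => fieldC (L.lam c s₀) (jc c s) (G s)) s := by
  have h1 : ContDiffAt ℝ ∞ (fun q : J1Space m N × (VM m →L[ℝ] J1Model m N →L[ℝ] ℝ) =>
      fieldC (L.lam c s₀) q.1 q.2) (jc c s, G s) :=
    contDiffAt_fieldC (L.contDiffAt_lam c s₀ (L.jc_mem c s h)) contDiffAt_fst contDiffAt_snd
  exact SmoothAt.comp_of_eq (f := fun s => (jc c s, G s)) rfl h1.contMDiffAt
    ((smoothAt_jc c h).prodMk_space hG)

theorem smoothAt_divC {c : AdaptedChart L.bundle} {s : J1 L.bundle} (s₀ : J1 L.bundle)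
    (h : s.1 ∈ c.chart.source) :
    SmoothAt (J1Space m N) (VM m →L[ℝ] J1Model m N →L[ℝ] ℝ)
      (fun s => divC (L.lam c s₀) (jc c s)) s :=
  SmoothAt.comp_of_eq rfl
    (contDiffAt_divC (L.contDiffAt_lam c s₀ (L.jc_mem c s h))).contMDiffAt (smoothAt_jc c h)

theorem isSmoothSectionAt_ofSecC {c : AdaptedChart L.bundle} {s : J1 L.bundle}
    (h : s.1 ∈ c.chart.source) {C : J1 L.bundle → VM m →L[ℝ] PSpace m N}
    (hC : SmoothAt (J1Space m N) (VM m →L[ℝ] PSpace m N) C s) :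
    IsSmoothSectionAt (fun s => ofSecC c s (C s)) s := by
  refine isSmoothSectionAt_of_chart h (ContMDiffAt.congr_of_eventuallyEq hC ?_)
  filter_upwards [eventually_jet_mem c h] with s' hs' using secC_ofSecC c s' hs' _

/-- Field sections along the jets of a section of the configuration bundle extend smoothly. -/
theorem exists_smooth_fieldSection [T2Space E] [SigmaCompactSpace E] (hm : 1 ≤ m)
    {j : M → J1 L.bundle} (hj : ContMDiff 𝓘(ℝ, VM m) 𝓘(ℝ, J1Space m N) ∞ j)
    (hjx : ∀ x, L.bundle.proj (j x).1 = x) {D₀ : M → VM m →L[ℝ] MpiSpace m N}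
    (hD₀ : ∀ x, L.IsFieldSection (j x) (D₀ x))
    (hsm : ∀ (c : AdaptedChart L.bundle) (x : M), (j x).1 ∈ c.chart.source →
      SmoothAt (VM m) (VM m →L[ℝ] PSpace m N) (fun x => L.secC c (j x) (D₀ x)) x) :
    ∃ D : J1 L.bundle → VM m →L[ℝ] MpiSpace m N,
      (∀ s, L.IsFieldSection s (D s) ∧ IsSmoothSectionAt D s) ∧ ∀ x, D (j x) = D₀ x := by
  suffices h : ∀ s₀ : J1 L.bundle, ∃ U : Set (J1 L.bundle), IsOpen U ∧ s₀ ∈ U ∧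
      ∃ D : J1 L.bundle → VM m →L[ℝ] MpiSpace m N, ∀ s ∈ U,
        D s ∈ {D | L.IsFieldSection s D} ∩ {D | ∀ x, j x = s → D = D₀ x} ∧
          IsSmoothSectionAt D s by
    have hconv : ∀ s, Convex ℝ ({D | L.IsFieldSection s D} ∩ {D | ∀ x, j x = s → D = D₀ x}) := by
      refine fun s => (convex_isFieldSection s).inter ?_
      intro D hD D' hD' a b _ _ hab x hx
      rw [hD x hx, hD' x hx, ← add_smul, hab, one_smul]
    obtain ⟨D, hD⟩ := exists_smoothSection hconv h
    exact ⟨D, fun s => ⟨(hD s).1.1, (hD s).2⟩, fun x => (hD (j x)).1.2 x rfl⟩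
  -- The map `r` retracts the jets onto the image of `j`, so that image is the fixed-point set of
  -- `r`.
  let r : J1 L.bundle → J1 L.bundle := fun s => j (L.bundle.proj s.1)
  have hr : ∀ s, SmoothAt (J1Space m N) (J1Space m N) r s := fun s =>
    SmoothAt.comp_of_eq (f := fun s : J1 L.bundle => L.bundle.proj s.1) rfl (hj _)
      (smoothAt_proj_fst s)
  have hrc : Continuous r := ContMDiff.continuous (I := 𝓘(ℝ, J1Space m N))
    (I' := 𝓘(ℝ, J1Space m N)) (n := ∞) hr
  have hrj : ∀ x, r (j x) = j x := fun x => congrArg j (hjx x)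
  have hopen : ∀ c : AdaptedChart L.bundle, IsOpen {s : J1 L.bundle | s.1 ∈ c.chart.source} :=
    fun c => isOpen_iff_mem_nhds.2 fun s hs => eventually_jet_mem c hs
  intro s₀
  obtain ⟨c, hc⟩ := exists_adaptedChart L.bundle s₀.1
  by_cases h0 : r s₀ = s₀
  · refine ⟨{s | s.1 ∈ c.chart.source} ∩ {s | (r s).1 ∈ c.chart.source},
      (hopen c).inter ((hopen c).preimage hrc), ⟨hc, by change (r s₀).1 ∈ c.chart.source; rwa [h0]⟩, ?_⟩
    let G₀ : J1 L.bundle → VM m →L[ℝ] J1Model m N →L[ℝ] ℝ := fun s =>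
      (ContinuousLinearMap.snd ℝ ℝ (J1Model m N →L[ℝ] ℝ)).comp
        ((ContinuousLinearMap.snd ℝ (VE m N) (PModel m N)).comp
          (L.secC c (r s) (D₀ (L.bundle.proj s.1))))
    -- At the retracted jet both `G₀` and `divC` have the required divergence, so their difference
    -- is divergence free and may be added to `divC` at `s`. Where `r s = s` the sum reduces to
    -- `G₀`, the prescribed momenta.
    let G : J1 L.bundle → VM m →L[ℝ] J1Model m N →L[ℝ] ℝ := fun s =>
      divC (L.lam c s₀) (jc c s) + (G₀ s - divC (L.lam c s₀) (jc c (r s)))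
    refine ⟨fun s => ofSecC c s (fieldC (L.lam c s₀) (jc c s) (G s)),
      fun s hs => ⟨⟨?_, ?_⟩, ?_⟩⟩
    · refine isFieldSection_ofSecC c s s₀ hs.1 fun z => ?_
      have h1 := (hD₀ (L.bundle.proj s.1)).sum_eq s₀ hs.2 z
      have h2 : ∑ i, G₀ s (eb i) (tens i z) = _ := h1
      have h3 : ∀ i, G s (eb i) (tens i z) = divC (L.lam c s₀) (jc c s) (eb i) (tens i z) +
        (G₀ s (eb i) (tens i z) - divC (L.lam c s₀) (jc c (r s)) (eb i) (tens i z)) := fun i => rfl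
      rw [Finset.sum_congr rfl fun i _ => h3 i, Finset.sum_add_distrib, Finset.sum_sub_distrib,
        sum_divC hm, sum_divC hm, h2]
      exact (congrArg _ (sub_self _)).trans (add_zero _)
    · rintro x rfl
      refine secC_injective c (j x) hs.1 ?_
      rw [secC_ofSecC c (j x) hs.1, (hD₀ x).secC_eq s₀ hs.1]
      congr 1
      change divC (L.lam c s₀) (jc c (j x)) + (G₀ (j x) - divC (L.lam c s₀) (jc c (r (j x)))) = _
      rw [hrj, add_sub_cancel]
      change (ContinuousLinearMap.snd ℝ ℝ (J1Model m N →L[ℝ] ℝ)).comp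
        ((ContinuousLinearMap.snd ℝ (VE m N) (PModel m N)).comp
          (L.secC c (r (j x)) (D₀ (L.bundle.proj (j x).1)))) = _
      rw [hrj, hjx]
    · refine isSmoothSectionAt_ofSecC hs.1 (smoothAt_fieldC s₀ hs.1 ?_)
      have h1 : SmoothAt (J1Space m N) (VM m →L[ℝ] PSpace m N)
          (fun s => L.secC c (r s) (D₀ (L.bundle.proj s.1))) s :=
        SmoothAt.comp_of_eq (g := fun x => L.secC c (j x) (D₀ x))
          (f := fun s : J1 L.bundle => L.bundle.proj s.1) rfl (hsm c _ hs.2) (smoothAt_proj_fst s)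
      have h2 : SmoothAt (J1Space m N) (VM m →L[ℝ] J1Model m N →L[ℝ] ℝ) G₀ s :=
        ContMDiffAt.clm_comp contMDiffAt_const (ContMDiffAt.clm_comp contMDiffAt_const h1)
      have h3 : SmoothAt (J1Space m N) (VM m →L[ℝ] J1Model m N →L[ℝ] ℝ)
          (fun s => divC (L.lam c s₀) (jc c (r s))) s :=
        SmoothAt.comp_of_eq (g := fun s => divC (L.lam c s₀) (jc c s)) (f := r) rfl
          (smoothAt_divC s₀ hs.2) (hr s)
      exact (smoothAt_divC s₀ hs.1).add (h2.sub h3)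
  -- Away from the fixed points no value is prescribed, and `divC` alone is a local solution.
  · refine ⟨{s | s.1 ∈ c.chart.source} ∩ {s | r s ≠ s}, (hopen c).inter
      (isOpen_ne_fun hrc continuous_id), ⟨hc, h0⟩,
      fun s => ofSecC c s (fieldC (L.lam c s₀) (jc c s) (divC (L.lam c s₀) (jc c s))),
      fun s hs => ⟨⟨isFieldSection_ofSecC c s s₀ hs.1 fun z => sum_divC hm _ _ z, ?_⟩,
        isSmoothSectionAt_ofSecC hs.1 (smoothAt_fieldC s₀ hs.1 (smoothAt_divC s₀ hs.1))⟩⟩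
    rintro x rfl
    exact absurd (hrj x) hs.2

end LagrangianSystem

namespace LagrangianSystem

open exteriorPower

variable [IsManifold 𝓘(ℝ, VM m) ∞ M] [IsManifold 𝓘(ℝ, VM N) ∞ F] [IsManifold 𝓘(ℝ, VE m N) ∞ E]
  {L : LagrangianSystem m N M E F}

/-! ### Operators from families of linear sections -/

variable (L) in
/-- The `m`-vectors of the base that are normalized by the volume form. -/
def unitMV (x : M) : ⋀[ℝ]^m (VM m) := (L.exists_pair_eq_one x).choose

variable (L) in
theorem pair_unitMV (x : M) : pair (L.volAt x) (L.unitMV x) = 1 :=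
  (L.exists_pair_eq_one x).choose_spec

theorem eq_unitMV {x : M} {u : ⋀[ℝ]^m (VM m)} (hu : pair (L.volAt x) u = 1) : u = L.unitMV x := by
  have h := eq_smul_of_pair_eq_one (L.pair_unitMV x) u
  rwa [hu, one_smul] at h

/-- The coordinate basis has volume equal to the density; dividing a single factor, in the slot
`i₀`, normalizes it. -/
theorem unitMV_eq (i₀ : Fin m) (c : AdaptedChart L.bundle) {x : M} (hx : x ∈ c.base.source) :
    L.unitMV x = ιMulti ℝ m (fun i => tg (VM m) (VM m) c.base.symm (c.base x)
      ((if i = i₀ then (L.density c (c.base x))⁻¹ else 1) • eb i)) := by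
  symm
  apply eq_unitMV
  rw [pair_ιMulti]
  have h1 : L.density c (c.base x) = L.volAt (c.base.symm (c.base x))
    (fun i => tg (VM m) (VM m) c.base.symm (c.base x) (eb i)) := rfl
  rw [c.base.left_inv hx] at h1
  simp only [map_smul]
  have h2 := (L.volAt x).toMultilinearMap.map_smul_univ
    (fun i => if i = i₀ then (L.density c (c.base x))⁻¹ else 1)
    (fun i => tg (VM m) (VM m) c.base.symm (c.base x) (eb i))
  refine h2.trans ?_
  rw [Finset.prod_ite_eq' Finset.univ i₀, if_pos (Finset.mem_univ _)]
  change _ * L.volAt x (fun i => tg (VM m) (VM m) c.base.symm (c.base x) (eb i)) = 1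
  rw [← h1, inv_mul_cancel₀ (L.density_ne_zero c (c.base.map_source hx))]

variable (L) in
/-- The `m`-vector field along the extended Legendre map defined by linear sections. -/
def operator (D : J1 L.bundle → VM m →L[ℝ] MpiSpace m N) (s : J1 L.bundle) :
    MVector m (MpiSpace m N) (L.FLt s) :=
  mvAt (L.FLt s) (wmap m (D s) (L.unitMV (L.bundle.proj s.1)))

theorem mv_operator (D : J1 L.bundle → VM m →L[ℝ] MpiSpace m N) (s : J1 L.bundle) :
    mv (L.operator D s) = wmap m (D s) (L.unitMV (L.bundle.proj s.1)) := mv_mvAt _ _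

/-- The factors are the images under `D` of the normalized coordinate frame, whose first vector is
divided by the density. A slot for this correction exists because `1 ≤ m`. -/
theorem operator_decomposable (hm : 1 ≤ m) {D : J1 L.bundle → VM m →L[ℝ] MpiSpace m N}
    (hD : ∀ s, IsSmoothSectionAt D s) (s₀ : J1 L.bundle) : ∃ U ∈ 𝓝 s₀,
    ∃ X : Fin m → ∀ s : J1 L.bundle, TangentSpace 𝓘(ℝ, MpiSpace m N) (L.FLt s),
      (∀ i, IsSmoothFieldAlong (J1Space m N) (MpiSpace m N) L.FLt (X i) U) ∧
      ∀ s ∈ U, L.operator D s = ιMulti ℝ m (fun i => X i s) := by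
  obtain ⟨c, hc⟩ := exists_adaptedChart L.bundle s₀.1
  let i₀ : Fin m := ⟨0, hm⟩
  let e : Fin m → J1 L.bundle → VM m := fun i s =>
    (if i = i₀ then (L.density c (c.base (L.bundle.proj s.1)))⁻¹ else 1) • eb i
  let Y : Fin m → J1 L.bundle → VM m := fun i s =>
    tg (VM m) (VM m) c.base.symm (c.base (L.bundle.proj s.1)) (e i s)
  refine ⟨{s | s.1 ∈ c.chart.source}, eventually_jet_mem c hc,
    fun i s => (tangentId (MpiSpace m N) (L.FLt s)).symm (D s (Y i s)), fun i s hs => ?_,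
    fun s hs => ?_⟩
  · have hs : s.1 ∈ c.chart.source := hs
    have hs' : (L.FLt s).1 ∈ c.chart.source := hs
    have hb : L.bundle.proj s.1 ∈ c.base.source := c.proj_mem _ hs
    have hβ : SmoothAt (J1Space m N) (VM m)
        (fun s : J1 L.bundle => c.base (L.bundle.proj s.1)) s :=
      SmoothAt.comp_of_eq (g := c.base) (f := fun s : J1 L.bundle => L.bundle.proj s.1) rfl
        (c.isSmoothChart_base.at_source hb) (smoothAt_proj_fst s)
    have he : SmoothAt (J1Space m N) (VM m) (e i) s := by
      by_cases hi : i = i₀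
      · have h1 : ContDiffAt ℝ ∞ (fun b => (L.density c b)⁻¹ • (eb i : VM m))
            (c.base (L.bundle.proj s.1)) :=
          ((L.contDiffAt_density c (c.base.map_source hb)).inv
            (L.density_ne_zero c (c.base.map_source hb))).smul contDiffAt_const
        have h2 := SmoothAt.comp_of_eq (f := fun s : J1 L.bundle => c.base (L.bundle.proj s.1)) rfl
          h1.contMDiffAt hβ
        simpa only [e, if_pos hi] using h2
      · simpa only [e, if_neg hi] using contMDiffAt_const
    have hw : SmoothAt (J1Space m N) (PSpace m N) (fun s => L.secC c s (D s) (e i s)) s :=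
      (hD s c hs).clm_apply he
    refine ContMDiffAt.contMDiffWithinAt ?_
    refine contMDiffAt_tangentBundle_mk (isSmoothChart_mpiChart c (L.FLt s)) (L.smoothAt_FLt s)
      hs' hw ?_
    filter_upwards [eventually_jet_mem c hs] with s' hs'
    have hs'' : L.FLt s' ∈ (mpiChart c (L.FLt s)).source := hs'
    exact ((isSmoothChart_mpiChart c (L.FLt s)).tg_symm_tg hs'' (D s' (Y i s'))).symm
  · have hs : s.1 ∈ c.chart.source := hs
    apply mv_injective
    refine (mv_operator D s).trans (Eq.trans ?_ (mv_ιMulti (V := MpiSpace m N) _).symm)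
    rw [unitMV_eq i₀ c (c.proj_mem _ hs), wmap_ιMulti]
    rfl

theorem wmap_fst_operator {D : J1 L.bundle → VM m →L[ℝ] MpiSpace m N} {s : J1 L.bundle}
    (hD : L.IsFieldSection s (D s)) :
    mv (wedgeT m (MpiSpace m N) (VE m N) (fun q : Mpi L.bundle => q.1) (L.FLt s)
      (L.operator D s)) = wmap m s.2.1 (L.unitMV (L.bundle.proj s.1)) := by
  refine (mv_wedgeT (W := VE m N) (f := fun q : Mpi L.bundle => q.1) _).trans ?_
  rw [mv_operator, ← wmap_comp, hD.comp_fst]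

/-- `D` projects to the identity of the base, so the operator projects to the normalized `m`-vector.
-/
theorem operator_transverse {D : J1 L.bundle → VM m →L[ℝ] MpiSpace m N} {s : J1 L.bundle}
    (hD : L.IsFieldSection s (D s)) :
    pair (L.vol (L.bundle.proj s.1)) (wedgeT m (MpiSpace m N) (VM m)
      (fun q : Mpi L.bundle => L.bundle.proj (tau1 L.bundle (mu L.bundle q))) (L.FLt s)
      (L.operator D s)) = 1 := by
  have hcomp : tg (MpiSpace m N) (VM m) (fun q : Mpi L.bundle => L.bundle.proj q.1) (L.FLt s) =
      (L.bundle.dproj s.1).comp (tg (MpiSpace m N) (VE m N)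
        (fun q : Mpi L.bundle => q.1) (L.FLt s)) :=
    tg_comp (g := L.bundle.proj) (L.bundle.contMDiff_proj _) (smoothAt_mpi_fst (L.FLt s))
  refine (pair_mv (L.volAt (L.bundle.proj s.1)) _).trans ?_
  refine (congrArg (pair (L.volAt (L.bundle.proj s.1)))
      (mv_wedgeT (f := fun q : Mpi L.bundle => L.bundle.proj q.1) (L.operator D s))).trans ?_
  have hid : (L.bundle.dproj s.1).comp s.2.1 = .id ℝ (VM m) := s.2.2
  rw [mv_operator, hcomp, ← wmap_comp, ContinuousLinearMap.comp_assoc, hD.comp_fst, hid, wmap_id,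
    pair_unitMV]

theorem operator_semiholonomic {D : J1 L.bundle → VM m →L[ℝ] MpiSpace m N} {s : J1 L.bundle}
    (hD : L.IsFieldSection s (D s)) : ∃ e : MVector m (VM m) (L.bundle.proj s.1),
    wedgeT m (MpiSpace m N) (VE m N)
      (fun q : Mpi L.bundle => tau1 L.bundle (mu L.bundle q)) (L.FLt s) (L.operator D s) =
    exteriorPower.map m (show VM m →L[ℝ] VE m N from s.2.1).toLinearMap e := by
  have h := exists_map_of_mv_eq_wmap (W := VE m N) (wedgeT m (MpiSpace m N) (VE m N)
    (fun q : Mpi L.bundle => tau1 L.bundle (mu L.bundle q)) (L.FLt s) (L.operator D s)) s.2.1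
    _ _ _ _ (show VM m →L[ℝ] VE m N from s.2.1).toLinearMap (wmap_fst_operator hD)
    rfl HEq.rfl rfl HEq.rfl fun _ => rfl
  exact h.elim fun e he => ⟨e, eq_of_heq he⟩

/-- Smooth families of field sections define extended operators. -/
theorem isExtendedOperator_operator (hm : 1 ≤ m) {D : J1 L.bundle → VM m →L[ℝ] MpiSpace m N}
    (hD : ∀ s, L.IsFieldSection s (D s) ∧ IsSmoothSectionAt D s) :
    L.IsExtendedOperator (L.operator D) where
  decomposable := operator_decomposable hm fun s => (hD s).2
  ne_zero s h := by
    have h1 := operator_transverse (hD s).1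
    rw [h, map_zero] at h1
    exact zero_ne_one ((map_zero (pair (L.volAt (L.bundle.proj s.1)))).symm.trans h1)
  transverse s := by
    rw [operator_transverse (hD s).1]
    exact one_ne_zero
  field_eq s w := by
    refine (contractMV_mv (L.operator D s) (L.ΩAt (L.FLt s)) _).trans ?_
    rw [mv_operator]
    exact (hD s).1.field _ w
  semiholonomic s := operator_semiholonomic (hD s).1

/-! ### The operator of a solution. -/

namespace AlmostRegular

variable {VP P : Type*} [NormedAddCommGroup VP] [NormedSpace ℝ VP] [FiniteDimensional ℝ VP]
  [TopologicalSpace P] [ChartedSpace VP P] [IsManifold 𝓘(ℝ, VP) ∞ P] {A : L.AlmostRegular VP P}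
  {ψ₀ : M → P}

/-- The tangent maps of the lifted solution are field sections along its jet. Extended to all jets
they define an operator whose value at the jet is the image of the normalized `m`-vector, so the
relation holds with factor `1`. -/
theorem exists_operator_of_solvesHamilton [T2Space E] [SigmaCompactSpace E] (hm : 1 ≤ m)
    (hψ₀ : IsSmoothSection (VM m) VP A.toBase ψ₀) (h : A.SolvesHamilton ψ₀) :
    ∃ K, L.IsExtendedOperator K ∧ ∃ f, IsNonvanishing (J1Space m N) f ∧
      L.Relation L.FL (L.restrict K) f (A.incl ∘ ψ₀) (jet hψ₀) := by
  have hproj : ∀ x, L.bundle.proj (jet hψ₀ x).1 = x := hψ₀.2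
  have hlift : ∀ x, A.lift (ψ₀ x) = L.FLt (jet hψ₀ x) := fun x =>
    (isFieldSection_of_solvesHamilton hψ₀ h x).1
  suffices hsm : ∀ (c : AdaptedChart L.bundle) (x : M), (jet hψ₀ x).1 ∈ c.chart.source →
      SmoothAt (VM m) (VM m →L[ℝ] PSpace m N) (fun x => L.secC c (jet hψ₀ x)
        (tg (VM m) (MpiSpace m N) (fun x => A.lift (ψ₀ x)) x)) x by
    obtain ⟨D, hD, hDj⟩ := exists_smooth_fieldSection hm
      (contMDiff_j1 (isSmoothSection_phi hψ₀)) hproj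
      (fun x => (isFieldSection_of_solvesHamilton hψ₀ h x).2) hsm
    refine ⟨L.operator D, isExtendedOperator_operator hm hD, fun _ => 1,
      ⟨contMDiff_const, fun _ => one_ne_zero⟩, relation_iff.2 fun x u hu => ⟨?_, ?_⟩⟩
    · change A.incl (ψ₀ x) = mu L.bundle (L.FLt (jet hψ₀ x))
      rw [← hlift, A.mu_lift]
    · rw [mv_restrict, mv_operator, hDj, hproj, ← eq_unitMV hu, ← wmap_comp, ← hlift,
        ← tg_incl_comp hψ₀]
      exact (one_smul ℝ _).symm
  intro c x hx
  have hx' : x ∈ c.base.source := by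
    have := c.proj_mem _ hx
    rwa [hproj] at this
  have hmem : ∀ᶠ x' in 𝓝 x, (jet hψ₀ x').1 ∈ c.chart.source :=
    (contMDiff_j1 (isSmoothSection_phi hψ₀)).continuous.continuousAt.eventually
      (eventually_jet_mem c hx)
  have h1 := smoothAt_tg_chart (W := MpiSpace m N) (g := mc c) (f := fun x => A.lift (ψ₀ x))
    c.isSmoothChart_base hx' (Filter.Eventually.of_forall fun x' => smoothAt_lift_comp hψ₀ x')
    (hmem.mono fun x' h => smoothAt_mc c (by rw [hlift]; exact h))
  refine ContMDiffAt.congr_of_eventuallyEq h1 (Filter.Eventually.of_forall fun x' => ?_)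
  change L.secC c (jet hψ₀ x') _ = _
  rw [secC, hproj, ← hlift]

end AlmostRegular

end LagrangianSystem

end

theorem mainTheorem7 {m N : ℕ} (hm : 1 ≤ m) {M E F VP P : Type*}
    [TopologicalSpace M] [ChartedSpace (VM m) M] [IsManifold 𝓘(ℝ, VM m) ∞ M]
    [T2Space M] [SigmaCompactSpace M]
    [TopologicalSpace E] [ChartedSpace (VE m N) E] [IsManifold 𝓘(ℝ, VE m N) ∞ E]
    [T2Space E] [SigmaCompactSpace E]
    [TopologicalSpace F] [ChartedSpace (VM N) F] [IsManifold 𝓘(ℝ, VM N) ∞ F]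
    [NormedAddCommGroup VP] [NormedSpace ℝ VP] [FiniteDimensional ℝ VP]
    [TopologicalSpace P] [ChartedSpace VP P] [IsManifold 𝓘(ℝ, VP) ∞ P]
    (L : LagrangianSystem m N M E F) (A : L.AlmostRegular VP P)
    (ψ₀ : M → P) (hψ₀ : IsSmoothSection (VM m) VP A.toBase ψ₀) :
    (A.SolvesHamilton ψ₀ ↔
      ∃ K, L.IsExtendedOperator K ∧ ∃ f, IsNonvanishing (J1Space m N) f ∧
        L.Relation L.FL (L.restrict K) f (A.incl ∘ ψ₀)
          (j1 L.bundle _ (LagrangianSystem.AlmostRegular.isSmoothSection_phi hψ₀))) ∧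
    (∀ K, L.IsExtendedOperator K → ∀ f, IsNonvanishing (J1Space m N) f →
      (L.Relation L.FL (L.restrict K) f (A.incl ∘ ψ₀)
          (j1 L.bundle _ (LagrangianSystem.AlmostRegular.isSmoothSection_phi hψ₀)) ↔
        L.Relation L.FLt K f (A.lift ∘ ψ₀)
          (j1 L.bundle _ (LagrangianSystem.AlmostRegular.isSmoothSection_phi_lift hψ₀)))) ∧
    (∀ K, L.IsExtendedOperator K → ∀ (S : Set (J1 L.bundle)) (X : ∀ p : P, MVector m VP p),
      (∀ s ∈ S, (⟨A.incl (A.FL₀ s), wedgeT m VP (J1sSpace m N) A.incl (A.FL₀ s) (X (A.FL₀ s))⟩ :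
        Σ q : J1s L.bundle, MVector m (J1sSpace m N) q) = ⟨L.FL s, L.restrict K s⟩) →
      (((∀ x, ψ₀ x ∈ A.FL₀ '' S) ∧ L.IsIntegralSection X ψ₀) ↔
        ((∀ x, j1 L.bundle _ (LagrangianSystem.AlmostRegular.isSmoothSection_phi hψ₀) x ∈ S) ∧
          ∃ f, IsNonvanishing (J1Space m N) f ∧
            L.Relation L.FL (L.restrict K) f (A.incl ∘ ψ₀)
              (j1 L.bundle _ (LagrangianSystem.AlmostRegular.isSmoothSection_phi hψ₀))))) := by
  refine ⟨⟨fun h => ?_, fun ⟨K, hK, f, _, h⟩ =>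
      LagrangianSystem.AlmostRegular.solvesHamilton_of_relation hψ₀ hK h⟩,
    fun K hK f _ => ?_, fun K hK S X hX =>
      LagrangianSystem.AlmostRegular.integral_iff hψ₀ hK S X hX⟩
  · exact LagrangianSystem.AlmostRegular.exists_operator_of_solvesHamilton hm hψ₀ h
  -- The two sides use prolongations of one and the same section of `E`, written once through the
  -- inclusion and once through the lift.
  · rw [LagrangianSystem.j1_congr (funext fun x => LagrangianSystem.AlmostRegular.tau1_mu_lift _)
      (LagrangianSystem.AlmostRegular.isSmoothSection_phi_lift hψ₀)
      (LagrangianSystem.AlmostRegular.isSmoothSection_phi hψ₀)]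
    exact LagrangianSystem.AlmostRegular.relation_iff_relation_lift hψ₀ hK f
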